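/- **Theorem.** Let $\Delta$ be a smooth rank 2 distribution on a smooth 5-dimensional manifold $M$. Put $\Delta_1=\Delta$ and let $\Delta_{i+1}$ be the distribution generated by $\Delta_i$ and all commutators of local sections of $\Delta_i$ (so $\Delta_2=[\Delta,\Delta]$, $\Delta_3=[\Delta_2,\Delta_2]$, and so on). Assume that $\Delta$ is regular, i.e. that all $\Delta_i$ have locally constant rank. Let $p\in M$. 1. There are an open neighbourhood $U$ of $p$, a smooth 4-dimensional manifold $\bar M$ with a smooth rank 2 distribution $\bar\Delta$, and a smooth submersion $\pi$ from $U$ onto $\bar M$ such that $d_x\pi$ maps $\Delta_x$ isomorphically onto $\bar\Delta_{\pi(x)}$ for every $x\in U$. That is, $(U,\Delta)$ is an integrable extension of $(\bar M,\bar\Delta)$. 2. (Goursat) Suppose that $\Delta_3$ has rank at least $4$ at $p$, i.e. $\Delta$ has growth $(2,3,4,\dots)$ or $(2,3,5)$ near $p$. Then $\Delta$ is, near $p$, the Cartan distribution of a Monge equation $v'=f(x,u,u',u'',v)$: there are smooth local coordinates $(x,u,u_1,u_2,v)$ near $p$ and a smooth function $f$ of them with $$\Delta=\langle \partial_x+u_1\,\partial_u+u_2\,\partial_{u_1}+f\,\partial_v,\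 \partial_{u_2}\rangle .$$ 3. $\Delta$ is near $p$ the Cartan distribution of such a Monge equation if and only if, near $p$, it is an integrable extension, in the sense of part 1, of an open part of the jet space $J^2(\mathbb R,\mathbb R)$ with coordinates $(x,u,u_1,u_2)$ and its Cartan distribution $\langle \partial_x+u_1\,\partial_u+u_2\,\partial_{u_1},\ \partial_{u_2}\rangle$. -/

import Mathlib

open scoped Manifold ContDiff Topology

attribute [-instance] TopCat.of.chartedSpace

namespace RankTwo

/-- The vector field `X` is, near `p`, a smooth local section of the distribution `D`. -/
def IsLocalSectionAt {n : ℕ} {M : Type*} [TopologicalSpace M]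
    [ChartedSpace (EuclideanSpace ℝ (Fin n)) M] [IsManifold (𝓡 n) ∞ M]
    (D : (q : M) → Submodule ℝ (TangentSpace (𝓡 n) q))
    (X : (q : M) → TangentSpace (𝓡 n) q) (p : M) : Prop :=
  ∀ᶠ q in 𝓝 p,
    ContMDiffAt (𝓡 n) (𝓡 n).tangent ∞ (fun q => (⟨q, X q⟩ : TangentBundle (𝓡 n) M)) q ∧ X q ∈ D q

/-- `D` is a smooth distribution of rank `r`: near every point it is spanned by `r` smooth,
pointwise linearly independent vector fields. -/
def IsSmoothDistribution {n : ℕ} {M : Type*} [TopologicalSpace M]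
    [ChartedSpace (EuclideanSpace ℝ (Fin n)) M] [IsManifold (𝓡 n) ∞ M] (r : ℕ)
    (D : (q : M) → Submodule ℝ (TangentSpace (𝓡 n) q)) : Prop :=
  ∀ p : M, ∃ X : Fin r → (q : M) → TangentSpace (𝓡 n) q,
    (∀ i, IsLocalSectionAt D (X i) p) ∧
    ∀ᶠ q in 𝓝 p, LinearIndependent ℝ (fun i => X i q) ∧
      D q = Submodule.span ℝ (Set.range fun i => X i q)

/-- The distribution generated by `D` and all commutators of its smooth local sections. -/
noncomputable def derived {n : ℕ} {M : Type*} [TopologicalSpace M]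
    [ChartedSpace (EuclideanSpace ℝ (Fin n)) M] [IsManifold (𝓡 n) ∞ M]
    (D : (q : M) → Submodule ℝ (TangentSpace (𝓡 n) q)) :
    (q : M) → Submodule ℝ (TangentSpace (𝓡 n) q) :=
  fun q => D q ⊔ Submodule.span ℝ
    {w | ∃ X Y : (q : M) → TangentSpace (𝓡 n) q,
      IsLocalSectionAt D X q ∧ IsLocalSectionAt D Y q ∧ w = VectorField.mlieBracket (𝓡 n) X Y q}

/-- The derived flag `D, [D, D], [[D, D], [D, D]], …`, indexed from `0`. -/
noncomputable def derivedFlag {n : ℕ} {M : Type*} [TopologicalSpace M]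
    [ChartedSpace (EuclideanSpace ℝ (Fin n)) M] [IsManifold (𝓡 n) ∞ M]
    (D : (q : M) → Submodule ℝ (TangentSpace (𝓡 n) q)) :
    ℕ → (q : M) → Submodule ℝ (TangentSpace (𝓡 n) q)
  | 0 => D
  | i + 1 => derived (derivedFlag D i)

/-- `D` is regular: all members of its derived flag have locally constant rank. -/
def IsRegular {n : ℕ} {M : Type*} [TopologicalSpace M]
    [ChartedSpace (EuclideanSpace ℝ (Fin n)) M] [IsManifold (𝓡 n) ∞ M]
    (D : (q : M) → Submodule ℝ (TangentSpace (𝓡 n) q)) : Prop :=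
  ∀ (i : ℕ) (p : M), ∀ᶠ q in 𝓝 p,
    Module.finrank ℝ (derivedFlag D i q) = Module.finrank ℝ (derivedFlag D i p)

/-- On the open set `U`, `π` is an integrable extension (covering) of the distribution `D'` by the
distribution `D`: a smooth submersion whose differential maps `D x` isomorphically onto `D' (π x)`
for every `x ∈ U`. -/
def IsIntegrableExtensionOn {m n : ℕ} {M N : Type*}
    [TopologicalSpace M] [ChartedSpace (EuclideanSpace ℝ (Fin m)) M]
    [TopologicalSpace N] [ChartedSpace (EuclideanSpace ℝ (Fin n)) N]
    (D : (q : M) → Submodule ℝ (TangentSpace (𝓡 m) q))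
    (D' : (q : N) → Submodule ℝ (TangentSpace (𝓡 n) q))
    (π : M → N) (U : Set M) : Prop :=
  ∀ x ∈ U, Manifold.IsSubmersionAt (𝓡 m) (𝓡 n) ∞ π x ∧
    Set.InjOn (mfderiv (𝓡 m) (𝓡 n) π x) (D x) ∧
    (D x).map (mfderiv (𝓡 m) (𝓡 n) π x).toLinearMap = D' (π x)

/-- The Cartan distribution `⟨∂_x + u₁ ∂_u + u₂ ∂_{u₁}, ∂_{u₂}⟩` of the jet space `J²(ℝ, ℝ)`
with coordinates `y = (x, u, u₁, u₂)`. -/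
noncomputable def cartanJ2 (y : EuclideanSpace ℝ (Fin 4)) :
    Submodule ℝ (TangentSpace (𝓡 4) y) :=
  Submodule.span ℝ {(!₂[1, y 2, y 3, 0] : EuclideanSpace ℝ (Fin 4)),
    (!₂[0, 0, 0, 1] : EuclideanSpace ℝ (Fin 4))}

/-- The Cartan distribution `⟨∂_x + u₁ ∂_u + u₂ ∂_{u₁} + f ∂_v, ∂_{u₂}⟩` of the Monge equation
`v' = f(x, u, u', u'', v)`, where `y = (x, u, u₁, u₂, v)` are the coordinates on the equation. -/
noncomputable def mongeDistribution (f : EuclideanSpace ℝ (Fin 5) → ℝ)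
    (y : EuclideanSpace ℝ (Fin 5)) : Submodule ℝ (TangentSpace (𝓡 5) y) :=
  Submodule.span ℝ {(!₂[1, y 2, y 3, 0, f y] : EuclideanSpace ℝ (Fin 5)),
    (!₂[0, 0, 0, 1, 0] : EuclideanSpace ℝ (Fin 5))}

/-- Near `p` there is a chart of the manifold that takes `D` to the Cartan distribution of a Monge
equation `v' = f(x, u, u', u'', v)` with smooth `f`. -/
def IsMongeAt {M : Type*} [TopologicalSpace M] [ChartedSpace (EuclideanSpace ℝ (Fin 5)) M]
    (D : (q : M) → Submodule ℝ (TangentSpace (𝓡 5) q)) (p : M) : Prop :=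
  ∃ φ ∈ IsManifold.maximalAtlas (𝓡 5) ∞ M, p ∈ φ.source ∧
    ∃ f : EuclideanSpace ℝ (Fin 5) → ℝ, ContDiffOn ℝ ∞ f φ.target ∧
      ∀ q ∈ φ.source,
        (D q).map (mfderiv (𝓡 5) (𝓡 5) φ q).toLinearMap = mongeDistribution f (φ q)

end RankTwo

/-! The proof sorts regular rank 2 distributions in dimension five by growth at `p` and finds, in
each case, a local submersion to ℝ⁴ carrying Δ = ⟨X₁, X₂⟩ onto an explicit rank 2 distribution
(`exists_projection`). Write W = [X₁, X₂].

If W lies in Δ at `p`, constant rank gives Δ₂ = Δ nearby. Then `exists_frobenius` straightens the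
leaves, and Δ projects onto ⟨∂₁, ∂₂⟩. If Δ₂ has rank 3 and contains [X₁, W] and [X₂, W] at `p`,
regularity makes Δ₂ involutive. A first integral of Δ₂ together with two first integrals of X₂ and
their slope along X₁ then projects Δ onto ⟨∂ₓ + v ∂ᵤ, ∂ᵥ⟩.

Otherwise, up to exchanging X₁ and X₂, [X₁, W] leaves Δ₂; this is Goursat's case. Let θ₁, θ₂ span
the annihilator of Δ₂. The requirement that θ = θ₁ + tθ₂ have a Cauchy characteristic field Y inside
Δ is one noncharacteristic quasilinear equation for t (`exists_goursat_form`,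
`exists_quasilinear_solution`). Descending along Y and then along one further characteristic leaves
a 1-form in dimension three, whence θ = ρ(du − v dx) with x, u, v constant along Y
(`exists_darboux_five`). Adding w = X₁(v)/X₁(x), which is not constant along Y, gives a submersion
(x, u, v, w) onto the Cartan distribution of J² (`exists_projectsBy_cartan`).

Forgetting v turns Monge coordinates into an extension of J². Conversely, given such an extension, a
first integral of the lift of ∂_{u₂} that is not constant along the fibre serves as v
(`exists_monge_chart`). This proves part 3 and, with Goursat's case, part 2. Part 1 shrinks the
image of the submersion to a ball and identifies the ball with ℝ⁴.

The analytic input throughout is the local existence of first integrals (`exists_firstIntegrals`).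
It comes from smooth flows, which come from the inverse function theorem on a Banach space of curves
(`exists_smooth_flow`). -/

namespace RankTwo

set_option linter.unusedSectionVars false

/-! ### Calculus of maps smooth near a point, and the inverse function theorem. -/

section SmoothGerms

variable {E : Type*} [NormedAddCommGroup E] [NormedSpace ℝ E]
  {F : Type*} [NormedAddCommGroup F] [NormedSpace ℝ F]
  {G : Type*} [NormedAddCommGroup G] [NormedSpace ℝ G]

/-- `f` is smooth in a neighbourhood of `p`. -/
def SmoothNear (f : E → F) (p : E) : Prop := ∀ᶠ q in 𝓝 p, ContDiffAt ℝ ∞ f q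

namespace SmoothNear

variable {f g : E → F} {p : E}

theorem contDiffAt (hf : SmoothNear f p) : ContDiffAt ℝ ∞ f p := hf.self_of_nhds

theorem differentiableAt (hf : SmoothNear f p) : DifferentiableAt ℝ f p :=
  hf.contDiffAt.differentiableAt (by simp)

theorem continuousAt (hf : SmoothNear f p) : ContinuousAt f p := hf.contDiffAt.continuousAt

/-- This stability is why smoothness is asked on a neighbourhood: `ContDiffAt ℝ ∞` at one point only
gives, for each finite order, a neighbourhood that may shrink with the order. -/
theorem eventually (hf : SmoothNear f p) : ∀ᶠ q in 𝓝 p, SmoothNear f q :=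
  eventually_eventually_nhds.2 hf

theorem _root_.ContDiff.smoothNear (hf : ContDiff ℝ ∞ f) (p : E) : SmoothNear f p :=
  Filter.Eventually.of_forall fun _ => hf.contDiffAt

theorem const (c : F) (p : E) : SmoothNear (fun _ => c) p := contDiff_const.smoothNear p

theorem id (p : E) : SmoothNear (fun q : E => q) p := contDiff_id.smoothNear p

theorem clm (L : E →L[ℝ] F) (p : E) : SmoothNear (fun q => L q) p := L.contDiff.smoothNear p

theorem comp {g : F → G} {f : E → F} {p : E} (hg : SmoothNear g (f p)) (hf : SmoothNear f p) :
    SmoothNear (fun q => g (f q)) p := by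
  filter_upwards [hf, hf.continuousAt.eventually hg] with q h1 h2
  exact h2.comp q h1

theorem clm_comp (L : F →L[ℝ] G) (hf : SmoothNear f p) : SmoothNear (fun q => L (f q)) p :=
  (clm L (f p)).comp hf

theorem add (hf : SmoothNear f p) (hg : SmoothNear g p) : SmoothNear (fun q => f q + g q) p := by
  filter_upwards [hf, hg] with q h1 h2 using h1.add h2

theorem sub (hf : SmoothNear f p) (hg : SmoothNear g p) : SmoothNear (fun q => f q - g q) p := by
  filter_upwards [hf, hg] with q h1 h2 using h1.sub h2

theorem neg (hf : SmoothNear f p) : SmoothNear (fun q => -f q) p := by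
  filter_upwards [hf] with q h1 using h1.neg

theorem smul {a : E → ℝ} (ha : SmoothNear a p) (hf : SmoothNear f p) :
    SmoothNear (fun q => a q • f q) p := by
  filter_upwards [ha, hf] with q h1 h2 using h1.smul h2

theorem mul {a b : E → ℝ} (ha : SmoothNear a p) (hb : SmoothNear b p) :
    SmoothNear (fun q => a q * b q) p := ha.smul hb

theorem inv {a : E → ℝ} (ha : SmoothNear a p) (h : a p ≠ 0) : SmoothNear (fun q => (a q)⁻¹) p := by
  filter_upwards [ha, ha.continuousAt.eventually_ne h] with q h1 h2 using h1.inv h2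

theorem div {a b : E → ℝ} (ha : SmoothNear a p) (hb : SmoothNear b p) (h : b p ≠ 0) :
    SmoothNear (fun q => a q / b q) p := by
  simpa [div_eq_mul_inv] using ha.mul (hb.inv h)

theorem sum {ι : Type*} {s : Finset ι} {f : ι → E → F} (hf : ∀ i, SmoothNear (f i) p) :
    SmoothNear (fun q => ∑ i ∈ s, f i q) p := by
  induction s using Finset.cons_induction with
  | empty => simpa using const (0 : F) p
  | cons a s ha ih => simpa [Finset.sum_cons] using (hf a).add ih

theorem fderiv (hf : SmoothNear f p) : SmoothNear (fun q => fderiv ℝ f q) p := by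
  filter_upwards [hf] with q h1
  exact h1.fderiv_right (m := ∞) (by simp)

theorem clm_apply {c : E → F →L[ℝ] G} {v : E → F} (hc : SmoothNear c p) (hv : SmoothNear v p) :
    SmoothNear (fun q => c q (v q)) p := by
  filter_upwards [hc, hv] with q h1 h2 using h1.clm_apply h2

theorem clm_compose {H : Type*} [NormedAddCommGroup H] [NormedSpace ℝ H]
    {c : E → F →L[ℝ] G} {d : E → H →L[ℝ] F} (hc : SmoothNear c p) (hd : SmoothNear d p) :
    SmoothNear (fun q => (c q).comp (d q)) p := by
  filter_upwards [hc, hd] with q h1 h2 using h1.clm_comp h2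

theorem fderiv_apply {v : E → E} (hf : SmoothNear f p) (hv : SmoothNear v p) :
    SmoothNear (fun q => _root_.fderiv ℝ f q (v q)) p := hf.fderiv.clm_apply hv

theorem inverse [CompleteSpace F] {c : E → F →L[ℝ] G} (hc : SmoothNear c p)
    (h : (c p).IsInvertible) : SmoothNear (fun q => (c q).inverse) p := by
  obtain ⟨e, he⟩ := h
  have h1 : ∀ᶠ q in 𝓝 p, c q ∈ Set.range ((↑) : (F ≃L[ℝ] G) → F →L[ℝ] G) :=
    hc.continuousAt.eventually (he ▸ e.nhds)
  filter_upwards [hc, h1] with q h2 ⟨e', he'⟩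
  have := contDiffAt_map_inverse (𝕜 := ℝ) (n := ∞) e'
  rw [he'] at this
  exact this.comp q h2

theorem prodMk {g : E → G} (hf : SmoothNear f p) (hg : SmoothNear g p) :
    SmoothNear (fun q => (f q, g q)) p := by
  filter_upwards [hf, hg] with q h1 h2 using h1.prodMk h2

theorem apply {ι : Type*} [Fintype ι] {f : E → ι → ℝ} (h : SmoothNear f p) (i : ι) :
    SmoothNear (fun q => f q i) p :=
  h.clm_comp (ContinuousLinearMap.proj (R := ℝ) (φ := fun _ : ι => ℝ) i)

theorem euclidean {ι : Type*} [Fintype ι] {f : E → EuclideanSpace ℝ ι}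
    (h : ∀ i, SmoothNear (fun q => f q i) p) : SmoothNear f p := by
  filter_upwards [Filter.eventually_all.2 h] with q hq using contDiffAt_euclidean.2 hq

theorem euclidean_apply {ι : Type*} [Fintype ι] {f : E → EuclideanSpace ℝ ι}
    (h : SmoothNear f p) (i : ι) : SmoothNear (fun q => f q i) p :=
  h.clm_comp (EuclideanSpace.proj (𝕜 := ℝ) i)

theorem lieBracket {X Y : E → E} (hX : SmoothNear X p) (hY : SmoothNear Y p) :
    SmoothNear (VectorField.lieBracket ℝ X Y) p :=
  (hY.fderiv_apply hX).sub (hX.fderiv_apply hY)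

/-- The inverse function theorem for maps smooth near a point. -/
theorem exists_openPartialHomeomorph [CompleteSpace E] (hf : SmoothNear f p)
    (h : (_root_.fderiv ℝ f p).IsInvertible) {s : Set E} (hs : s ∈ 𝓝 p) :
    ∃ e : OpenPartialHomeomorph E F, p ∈ e.source ∧ e.source ⊆ s ∧ (∀ q, e q = f q) ∧
      (∀ q ∈ e.source, ContDiffAt ℝ ∞ f q) ∧ ∀ y ∈ e.target, ContDiffAt ℝ ∞ e.symm y := by
  obtain ⟨f', hf'⟩ := h
  have hd : HasFDerivAt f (f' : E →L[ℝ] F) p := hf' ▸ hf.differentiableAt.hasFDerivAt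
  set e₀ := hf.contDiffAt.toOpenPartialHomeomorph f hd (by simp) with he₀
  -- Invertible operators form an open set. Restricting to where the derivative stays invertible
  -- makes the inverse smooth at every point of the target, not only at `f p`.
  have h1 : ∀ᶠ q in 𝓝 p, _root_.fderiv ℝ f q ∈ Set.range ((↑) : (E ≃L[ℝ] F) → E →L[ℝ] F) :=
    hf.fderiv.continuousAt.eventually (by simp only [← hf']; exact f'.nhds)
  obtain ⟨t, ht, hto, hpt⟩ := mem_nhds_iff.1 (Filter.inter_mem hs (Filter.inter_mem hf h1))
  have key : ∀ q ∈ (e₀.restrOpen t hto).source, q ∈ e₀.source ∧ q ∈ t := by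
    intro q hq
    simpa using hq
  refine ⟨e₀.restrOpen t hto, ?_, fun q hq => (ht (key q hq).2).1, fun q => rfl,
    fun q hq => (ht (key q hq).2).2.1, fun y hy => ?_⟩
  · simp only [OpenPartialHomeomorph.restrOpen_source]
    exact ⟨hf.contDiffAt.mem_toOpenPartialHomeomorph_source hd (by simp), hpt⟩
  · have hq := (e₀.restrOpen t hto).map_target hy
    obtain ⟨e', he'⟩ := (ht (key _ hq).2).2.2
    have hsm : ContDiffAt ℝ ∞ f ((e₀.restrOpen t hto).symm y) := (ht (key _ hq).2).2.1
    refine (e₀.restrOpen t hto).contDiffAt_symm (f₀' := e') hy ?_ hsm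
    rw [he']
    exact (hsm.differentiableAt (by simp)).hasFDerivAt

end SmoothNear

/-- A smooth function near `p` agrees near `p` with a globally smooth one. -/
theorem SmoothNear.exists_contDiff [FiniteDimensional ℝ E] {f : E → F} {p : E}
    (hf : SmoothNear f p) : ∃ g : E → F, ContDiff ℝ ∞ g ∧ ∀ᶠ q in 𝓝 p, g q = f q := by
  obtain ⟨t, ht, hto, hpt⟩ := mem_nhds_iff.1 hf
  obtain ⟨r, hr, hrt⟩ := Metric.isOpen_iff.1 hto p hpt
  -- The closed support has radius `r / 2`, hence lies in the ball of radius `r` on which `f` is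
  -- smooth.
  let b : ContDiffBump p := ⟨r / 4, r / 2, by positivity, by linarith⟩
  refine ⟨fun q => b q • f q, contDiff_iff_contDiffAt.2 fun q => ?_, ?_⟩
  · by_cases hq : q ∈ tsupport b
    · rw [b.tsupport_eq] at hq
      have : q ∈ t := hrt ((Metric.closedBall_subset_ball (by simp [b]; linarith)) hq)
      exact (b.contDiff.contDiffAt).smul (ht this)
    · have : (fun q => b q • f q) =ᶠ[𝓝 q] fun _ => 0 := by
        filter_upwards [(isClosed_tsupport b).isOpen_compl.mem_nhds hq] with y hy
        simp [image_eq_zero_of_notMem_tsupport hy]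
      exact contDiffAt_const.congr_of_eventuallyEq this
  · filter_upwards [b.eventuallyEq_one] with q hq
    simp [hq]

end SmoothGerms

/-! ### Smoothness of postcomposition on spaces of continuous maps. -/

section Postcomp

universe u
variable {K : Type*} [TopologicalSpace K] [CompactSpace K]

/-- Pointwise application of a continuous family of continuous linear maps. -/
noncomputable def familyApply (K : Type*) [TopologicalSpace K] [CompactSpace K]
    (E F : Type*) [NormedAddCommGroup E] [NormedSpace ℝ E]
    [NormedAddCommGroup F] [NormedSpace ℝ F] :
    C(K, E →L[ℝ] F) →L[ℝ] C(K, E) →L[ℝ] C(K, F) :=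
  LinearMap.mkContinuous₂ (E := C(K, E →L[ℝ] F)) (F := C(K, E)) (G := C(K, F))
    (σ₁₃ := RingHom.id ℝ) (σ₂₃ := RingHom.id ℝ)
    (LinearMap.mk₂ ℝ (fun (L : C(K, E →L[ℝ] F)) (β : C(K, E)) =>
        (⟨fun k => L k (β k), L.continuous.clm_apply β.continuous⟩ : C(K, F)))
      (fun _ _ _ => by ext; simp) (fun _ _ _ => by ext; simp)
      (fun _ _ _ => by ext; simp) (fun _ _ _ => by ext; simp)) 1
    (fun L β => by
      refine (ContinuousMap.norm_le _ (by positivity)).2 fun k => ?_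
      rw [one_mul]
      exact ((L k).le_opNorm _).trans
        (by gcongr; exacts [L.norm_coe_le_norm k, β.norm_coe_le_norm k]))

@[simp]
theorem familyApply_apply {E F : Type*} [NormedAddCommGroup E] [NormedSpace ℝ E]
    [NormedAddCommGroup F] [NormedSpace ℝ F] (L : C(K, E →L[ℝ] F)) (β : C(K, E)) (k : K) :
    familyApply K E F L β k = L k (β k) := rfl

/-- The mean value inequality on the segment from `α k` to `α k + β k` gives the pointwise estimate.
It is uniform in `k` because postcomposition with `g'` is continuous for the uniform distance, `K`
being compact. -/
theorem hasFDerivAt_postcomp {E F : Type*} [NormedAddCommGroup E] [NormedSpace ℝ E]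
    [NormedAddCommGroup F] [NormedSpace ℝ F] (g : C(E, F)) (g' : C(E, E →L[ℝ] F))
    (hg : ∀ x, HasFDerivAt g (g' x) x) (α : C(K, E)) :
    HasFDerivAt (fun α : C(K, E) => g.comp α) (familyApply K E F (g'.comp α)) α := by
  rw [hasFDerivAt_iff_isLittleO_nhds_zero, Asymptotics.isLittleO_iff]
  intro ε hε
  have hc : Continuous fun β : C(K, E) => g'.comp (α + β) :=
    (ContinuousMap.continuous_postcomp g').comp (continuous_const.add continuous_id)
  have h0 : ∀ᶠ β : C(K, E) in 𝓝 0, dist (g'.comp (α + β)) (g'.comp (α + 0)) < ε :=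
    (Metric.tendsto_nhds (α := C(K, E →L[ℝ] F)) (f := 𝓝 (0 : C(K, E)))
      (u := fun β : C(K, E) => g'.comp (α + β)) (a := g'.comp (α + 0))).1
      (hc.continuousAt (x := 0)) ε hε
  obtain ⟨δ, hδ, hball⟩ := Metric.eventually_nhds_iff_ball.1 h0
  filter_upwards [Metric.ball_mem_nhds (0 : C(K, E)) hδ] with β hβ
  refine (ContinuousMap.norm_le _ (by positivity)).2 fun k => ?_
  have hmv := (convex_segment (α k) (α k + β k)).norm_image_sub_le_of_norm_hasFDerivWithin_le'
    (f := g) (f' := fun x => g' x) (φ := g' (α k)) (C := ε) (x := α k) (y := α k + β k)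
    (fun x _ => (hg x).hasFDerivWithinAt) ?_ (left_mem_segment _ _ _) (right_mem_segment _ _ _)
  · have h2 : ‖β k‖ ≤ ‖β‖ := β.norm_coe_le_norm k
    calc _ = ‖g (α k + β k) - g (α k) - g' (α k) (α k + β k - α k)‖ := by simp
      _ ≤ ε * ‖α k + β k - α k‖ := hmv
      _ ≤ ε * ‖β‖ := by rw [add_sub_cancel_left]; gcongr
  · intro x hx
    obtain ⟨s, hs0, hs1, rfl⟩ : ∃ s : ℝ, 0 ≤ s ∧ s ≤ 1 ∧ x = α k + s • β k := by
      rw [segment_eq_image'] at hx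
      obtain ⟨s, hs, rfl⟩ := hx
      exact ⟨s, hs.1, hs.2, by simp⟩
    have hm : s • β ∈ Metric.ball (0 : C(K, E)) δ := by
      rw [mem_ball_zero_iff] at hβ ⊢
      rw [norm_smul, Real.norm_of_nonneg hs0]
      exact (mul_le_of_le_one_left (norm_nonneg _) hs1).trans_lt hβ
    have := (ContinuousMap.dist_lt_iff hε).1 (hball _ hm) k
    simpa [dist_eq_norm] using this.le

/-- The derivative of postcomposition by `g` is postcomposition by `g'` followed by the bounded
linear map `familyApply`, so one order is gained per induction step. The step replaces `F` by `E
→L[ℝ] F`, which is why both spaces live in one universe. -/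
theorem contDiff_postcomp_nat (n : ℕ) : ∀ {E F : Type u} [NormedAddCommGroup E] [NormedSpace ℝ E]
    [NormedAddCommGroup F] [NormedSpace ℝ F] (g : C(E, F)), ContDiff ℝ n g →
    ContDiff ℝ n (fun α : C(K, E) => g.comp α) := by
  induction n with
  | zero =>
    intro E F _ _ _ _ g _
    exact contDiff_zero.2 (ContinuousMap.continuous_postcomp g)
  | succ n ih =>
    intro E F _ _ _ _ g hg
    have hg' : ContDiff ℝ (n + 1) g := by exact_mod_cast hg
    obtain ⟨hd, -, hc⟩ := contDiff_succ_iff_fderiv.1 hg'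
    let g' : C(E, E →L[ℝ] F) := ⟨fderiv ℝ g, hc.continuous⟩
    have hder := fun α : C(K, E) => hasFDerivAt_postcomp g g' (fun x => (hd x).hasFDerivAt) α
    have : ContDiff ℝ (n + 1) (fun α : C(K, E) => g.comp α) := by
      refine contDiff_succ_iff_fderiv.2 ⟨fun α => (hder α).differentiableAt, by simp, ?_⟩
      rw [show fderiv ℝ (fun α : C(K, E) => g.comp α) =
        fun α => familyApply K E F (g'.comp α) from funext fun α => (hder α).fderiv]
      exact (familyApply K E F).contDiff.comp (ih g' hc)
    exact_mod_cast this

/-- Postcomposition with a smooth map is smooth on spaces of continuous maps. -/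
theorem contDiff_postcomp {E F : Type u} [NormedAddCommGroup E] [NormedSpace ℝ E]
    [NormedAddCommGroup F] [NormedSpace ℝ F] (g : C(E, F)) (hg : ContDiff ℝ ∞ g) :
    ContDiff ℝ ∞ (fun α : C(K, E) => g.comp α) :=
  contDiff_infty.2 fun n => contDiff_postcomp_nat n g (contDiff_infty.1 hg n)

end Postcomp

/-! ### Smooth local flows from the inverse function theorem on curves. -/

section Flow

universe u
variable {E : Type u} [NormedAddCommGroup E] [NormedSpace ℝ E]

/-- The continuous curves on `[-1, 1]`. -/
abbrev Curves (E : Type*) [TopologicalSpace E] := C(Set.Icc (-1 : ℝ) 1, E)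

/-- The extension of a curve on `[-1, 1]` to the real line by constants. -/
noncomputable def Curves.extend {E : Type*} [TopologicalSpace E] (α : Curves E) : ℝ → E := Set.IccExtend (by norm_num) α

theorem Curves.continuous_extend {E : Type*} [TopologicalSpace E] (α : Curves E) : Continuous α.extend := α.continuous.Icc_extend'

theorem Curves.extend_of_mem {E : Type*} [TopologicalSpace E] (α : Curves E) {t : ℝ} (ht : t ∈ Set.Icc (-1 : ℝ) 1) :
    α.extend t = α ⟨t, ht⟩ := Set.IccExtend_of_mem _ _ ht

theorem Curves.norm_extend_le {E : Type*} [NormedAddCommGroup E] (α : Curves E) (t : ℝ) : ‖α.extend t‖ ≤ ‖α‖ :=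
  α.norm_coe_le_norm _

/-- Integration of curves, from the origin. -/
noncomputable def curveIntegral (E : Type*) [NormedAddCommGroup E] [NormedSpace ℝ E] :
    Curves E →L[ℝ] Curves E :=
  LinearMap.mkContinuous
    { toFun := fun α => ⟨fun s => ∫ r in (0 : ℝ)..s, α.extend r,
        (intervalIntegral.continuous_primitive
          (fun _ _ => α.continuous_extend.intervalIntegrable _ _) 0).comp continuous_subtype_val⟩
      map_add' := fun α β => by
        ext s
        exact intervalIntegral.integral_add (α.continuous_extend.intervalIntegrable _ _)
          (β.continuous_extend.intervalIntegrable _ _)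
      map_smul' := fun c α => by
        ext s
        exact intervalIntegral.integral_smul c α.extend } 1
    (fun α => by
      refine (ContinuousMap.norm_le _ (by positivity)).2 fun s => ?_
      refine (intervalIntegral.norm_integral_le_of_norm_le_const
        (fun r _ => α.norm_extend_le r)).trans ?_
      rw [one_mul, sub_zero]
      exact mul_le_of_le_one_right (norm_nonneg _) (abs_le.2 s.2))

theorem curveIntegral_apply (α : Curves E) (s : Set.Icc (-1 : ℝ) 1) :
    curveIntegral E α s = ∫ r in (0 : ℝ)..s, α.extend r := rfl

/-- Constant curves. -/
noncomputable def constCurve (E : Type*) [NormedAddCommGroup E] [NormedSpace ℝ E] :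
    E →L[ℝ] Curves E :=
  LinearMap.mkContinuous
    { toFun := fun x => ContinuousMap.const _ x
      map_add' := fun _ _ => rfl
      map_smul' := fun _ _ => rfl } 1
    (fun x => by
      rw [one_mul]
      exact (ContinuousMap.norm_le _ (norm_nonneg x)).2 fun s => le_rfl)

@[simp]
theorem constCurve_apply (x : E) (s : Set.Icc (-1 : ℝ) 1) : constCurve E x s = x := rfl

/-- The curves `α` solving `α(s) = x + τ ∫₀ˢ V(α)`, for `(x, τ)` near `(p, 0)`. -/
theorem exists_curve_family [CompleteSpace E] (V : C(E, E)) (hV : ContDiff ℝ ∞ V) (p : E) :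
    ∃ (A : E × ℝ → Curves E) (δ : ℝ), 0 < δ ∧
      (∀ z, dist z (p, 0) < δ → ContDiffAt ℝ ∞ A z) ∧
      (∀ z, dist z (p, 0) < δ → A z = constCurve E z.1 + z.2 • curveIntegral E (V.comp (A z))) ∧
      ∀ z, dist z (p, 0) < δ → ∀ w, dist w (p, (0 : ℝ)) < δ → ∀ h : C(Set.Icc (-1 : ℝ) 1, Set.Icc (-1 : ℝ) 1),
        (A z).comp h = constCurve E w.1 + w.2 • curveIntegral E (V.comp ((A z).comp h)) →
        A w = (A z).comp h := by
  let N : Curves E → Curves E := fun α => curveIntegral E (V.comp α)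
  have hN : ContDiff ℝ ∞ N := (curveIntegral E).contDiff.comp (contDiff_postcomp V hV)
  -- The integral equation is the vanishing of the second component of `f`, with the parameters
  -- carried along in the first.
  let f : (E × ℝ) × Curves E → (E × ℝ) × Curves E :=
    fun y => (y.1, y.2 - (constCurve E y.1.1 + y.1.2 • N y.2))
  have hf : ContDiff ℝ ∞ f := by
    refine contDiff_fst.prodMk (contDiff_snd.sub (ContDiff.add ?_ ?_))
    · exact (constCurve E).contDiff.comp (contDiff_fst.comp contDiff_fst)
    · exact (contDiff_snd.comp contDiff_fst).smul (hN.comp contDiff_snd)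
  set y₀ : (E × ℝ) × Curves E := ((p, 0), constCurve E p) with hy₀
  have hf₀ : f y₀ = ((p, 0), 0) := by simp [f, hy₀]
  let T : E × ℝ →L[ℝ] Curves E := (constCurve E).comp (ContinuousLinearMap.fst ℝ E ℝ) +
    (ContinuousLinearMap.snd ℝ E ℝ).smulRight (N (constCurve E p))
  -- At `τ = 0` the integral term has no derivative in the curve variable. The derivative is
  -- therefore triangular with identities on the diagonal, and no contraction estimate is needed.
  let f' := ContinuousLinearEquiv.skewProd (.refl ℝ (E × ℝ)) (.refl ℝ (Curves E)) (-T)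
  have hder : HasFDerivAt f (f' : (E × ℝ) × Curves E →L[ℝ] (E × ℝ) × Curves E) y₀ := by
    have h1 : HasFDerivAt (fun y : (E × ℝ) × Curves E => y.1.2) _ y₀ :=
      ((ContinuousLinearMap.snd ℝ E ℝ).comp (ContinuousLinearMap.fst ℝ (E × ℝ) (Curves E))).hasFDerivAt
    have h2 : HasFDerivAt (fun y : (E × ℝ) × Curves E => N y.2) _ y₀ :=
      ((hN.differentiable (by simp)).differentiableAt.hasFDerivAt (x := y₀.2)).comp y₀
        (ContinuousLinearMap.snd ℝ (E × ℝ) (Curves E)).hasFDerivAt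
    have h3 : HasFDerivAt (fun y : (E × ℝ) × Curves E => constCurve E y.1.1) _ y₀ :=
      ((constCurve E).comp ((ContinuousLinearMap.fst ℝ E ℝ).comp
        (ContinuousLinearMap.fst ℝ (E × ℝ) (Curves E)))).hasFDerivAt
    have h4 := (ContinuousLinearMap.fst ℝ (E × ℝ) (Curves E)).hasFDerivAt (x := y₀) |>.prodMk
      (((ContinuousLinearMap.snd ℝ (E × ℝ) (Curves E)).hasFDerivAt (x := y₀)).sub
        (h3.add (h1.smul h2)))
    refine h4.congr_fderiv ?_
    refine ContinuousLinearMap.ext fun y => Prod.ext rfl ?_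
    simp [f', T, hy₀, sub_eq_add_neg]
  obtain ⟨e, hys, -, hef, -, hsymm⟩ := (hf.smoothNear y₀).exists_openPartialHomeomorph
    ⟨f', hder.fderiv.symm⟩ Filter.univ_mem
  have hyt : ((p, 0), 0) ∈ e.target := by
    rw [← hf₀, ← hef]; exact e.map_source hys
  let A : E × ℝ → Curves E := fun z => (e.symm (z, 0)).2
  have hfst : ∀ z, (z, 0) ∈ e.target → e.symm (z, 0) = (z, A z) := by
    intro z hz
    have h1 := e.right_inv hz
    rw [hef] at h1
    exact Prod.ext (show (e.symm (z, 0)).1 = z from congrArg Prod.fst h1) rfl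
  have hA₀ : A (p, 0) = constCurve E p := by
    have : e.symm ((p, 0), 0) = y₀ := by rw [← hf₀, ← hef]; exact e.left_inv hys
    simp [A, this, hy₀]
  obtain ⟨r, hr, hball⟩ := Metric.isOpen_iff.1 e.open_source y₀ hys
  have hcont : Continuous fun z : E × ℝ => (z, (0 : Curves E)) := by fun_prop
  have ht : ∀ᶠ z in 𝓝 ((p, 0) : E × ℝ), (z, (0 : Curves E)) ∈ e.target :=
    hcont.continuousAt.eventually (e.open_target.mem_nhds hyt)
  have hAs : ∀ z, (z, (0 : Curves E)) ∈ e.target → ContDiffAt ℝ ∞ A z := fun z hz =>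
    contDiff_snd.contDiffAt.comp z ((hsymm _ hz).comp z (contDiff_prodMk_left 0).contDiffAt)
  have hAc : ∀ᶠ z in 𝓝 ((p, 0) : E × ℝ), dist (A z) (constCurve E p) < r := by
    have := (hAs (p, 0) hyt).continuousAt
    rw [ContinuousAt, hA₀] at this
    exact Metric.tendsto_nhds.1 this r hr
  obtain ⟨δ, hδ, hδb⟩ := Metric.eventually_nhds_iff.1 (ht.and hAc)
  have hfix : ∀ z, dist z (p, 0) < δ →
      A z = constCurve E z.1 + z.2 • curveIntegral E (V.comp (A z)) := by
    intro z hz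
    have h1 := e.right_inv (hδb hz).1
    rw [hfst z (hδb hz).1, hef] at h1
    exact sub_eq_zero.1 (congrArg Prod.snd h1)
  refine ⟨A, min δ r, lt_min hδ hr, fun z hz => hAs z (hδb (hz.trans_le (min_le_left _ _))).1,
    fun z hz => hfix z (hz.trans_le (min_le_left _ _)), fun z hz w hw h heq => ?_⟩
  -- Reparametrisation does not increase the distance to a constant curve, so the reparametrised
  -- solution stays where `e` is injective. This is the source of uniqueness.
  have hd : dist ((A z).comp h) (constCurve E p) < r := by
    refine (ContinuousMap.dist_lt_iff hr).2 fun s => ?_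
    exact (ContinuousMap.dist_lt_iff hr).1 (hδb (hz.trans_le (min_le_left _ _))).2 (h s)
  have hmem : (w, (A z).comp h) ∈ e.source := by
    refine hball ?_
    rw [Metric.mem_ball, Prod.dist_eq]
    exact max_lt (hw.trans_le (min_le_right _ _)) hd
  have hval : e (w, (A z).comp h) = (w, 0) := by
    rw [hef]
    exact Prod.ext rfl (sub_eq_zero.2 heq)
  have := e.left_inv hmem
  rw [hval] at this
  exact congrArg Prod.snd this

/-- A smooth vector field has a smooth local flow. -/
theorem exists_smooth_flow [CompleteSpace E] {V : E → E} (hV : ContDiff ℝ ∞ V) (p : E) :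
    ∃ φ : E × ℝ → E, SmoothNear φ (p, 0) ∧
      (∀ᶠ z in 𝓝 ((p, 0) : E × ℝ), HasDerivAt (fun t => φ (z.1, t)) (V (φ z)) z.2) ∧
      ∀ᶠ x in 𝓝 p, φ (x, 0) = x := by
  obtain ⟨A, δ, hδ, hAs, hfix, huniq⟩ := exists_curve_family ⟨V, hV.continuous⟩ hV p
  set I1 : Set.Icc (-1 : ℝ) 1 := ⟨1, by norm_num, le_rfl⟩
  -- The solution with time scale `τ`, run at speed `σ`, solves the equation with time scale `σ *
  -- τ`. Evaluation at the endpoint `1` thus sees the whole curve.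
  have key : ∀ x τ, dist ((x, τ) : E × ℝ) (p, 0) < δ → ∀ σ (hσ : σ ∈ Set.Icc (-1 : ℝ) 1),
      A (x, σ * τ) I1 = A (x, τ) ⟨σ, hσ⟩ := by
    intro x τ hx σ hσ
    have hmul : ∀ s ∈ Set.Icc (-1 : ℝ) 1, σ * s ∈ Set.Icc (-1 : ℝ) 1 := by
      intro s hs
      rw [Set.mem_Icc, ← abs_le] at hs hσ ⊢
      rw [abs_mul]
      exact mul_le_one₀ hσ (abs_nonneg _) hs
    let h : C(Set.Icc (-1 : ℝ) 1, Set.Icc (-1 : ℝ) 1) :=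
      ⟨fun s => ⟨σ * s, hmul s s.2⟩, by fun_prop⟩
    have hw : dist ((x, σ * τ) : E × ℝ) (p, 0) < δ := by
      refine lt_of_le_of_lt ?_ hx
      rw [Prod.dist_eq, Prod.dist_eq]
      refine max_le_max le_rfl ?_
      simp only [dist_zero_right, norm_mul]
      exact mul_le_of_le_one_left (norm_nonneg _) (abs_le.2 hσ)
    rw [huniq (x, τ) hx (x, σ * τ) hw h ?_]
    · exact congrArg (A (x, τ)) (Subtype.ext (mul_one σ))
    · ext s
      have h1 := congrArg (fun α : Curves E => α (h s)) (hfix (x, τ) hx)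
      refine h1.trans ?_
      simp only [ContinuousMap.add_apply, constCurve_apply, ContinuousMap.smul_apply,
        curveIntegral_apply]
      congr 1
      have h2 : ((h s : Set.Icc (-1 : ℝ) 1) : ℝ) = σ * s := rfl
      rw [h2, mul_comm σ τ, mul_smul]
      congr 1
      have h3 := intervalIntegral.smul_integral_comp_mul_left (a := 0) (b := (s : ℝ))
        (Curves.extend (ContinuousMap.comp ⟨V, hV.continuous⟩ (A (x, τ)))) σ
      rw [mul_zero] at h3
      rw [← h3]
      congr 1
      refine intervalIntegral.integral_congr fun r hr => ?_
      have hr' : r ∈ Set.Icc (-1 : ℝ) 1 :=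
        Set.uIcc_subset_Icc (by norm_num) s.2 hr
      rw [Curves.extend_of_mem _ hr', Curves.extend_of_mem _ (hmul r hr')]
      rfl
  have hnear : ∀ᶠ z in 𝓝 ((p, 0) : E × ℝ), dist z (p, 0) < δ := Metric.ball_mem_nhds _ hδ
  refine ⟨fun z => A z I1, ?_, ?_, ?_⟩
  · filter_upwards [hnear] with z hz
    exact (ContinuousMap.evalCLM ℝ I1).contDiff.contDiffAt.comp z (hAs z hz)
  · have hnear2 : ∀ᶠ z in 𝓝 ((p, 0) : E × ℝ), dist z (p, 0) < δ / 2 :=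
      Metric.ball_mem_nhds _ (half_pos hδ)
    filter_upwards [hnear2] with z hz
    obtain ⟨x, t⟩ := z
    rw [Prod.dist_eq, max_lt_iff] at hz
    obtain ⟨hx, ht⟩ := hz
    simp only [dist_zero_right, Real.norm_eq_abs] at hx ht
    -- With this scale fixed, the value at time `t` is `x` plus `τ` times an integral up to `t / τ`
    -- of one fixed curve, and the fundamental theorem of calculus differentiates it.
    set τ := δ / 2 with hτ
    have hτ0 : 0 < τ := half_pos hδ
    have hxτ : dist ((x, τ) : E × ℝ) (p, 0) < δ := by
      rw [Prod.dist_eq]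
      refine max_lt (hx.trans (half_lt_self hδ)) ?_
      simp only [dist_zero_right, Real.norm_eq_abs, abs_of_pos hτ0]
      exact half_lt_self hδ
    have hmem : ∀ t', |t'| < τ → t' / τ ∈ Set.Icc (-1 : ℝ) 1 := by
      intro t' ht'
      rw [Set.mem_Icc, ← abs_le, abs_div, abs_of_pos hτ0]
      exact (div_le_one hτ0).2 ht'.le
    have hev : ∀ t', |t'| < τ → A (x, t') I1 =
        x + τ • ∫ r in (0 : ℝ)..(t' / τ),
          Curves.extend (ContinuousMap.comp ⟨V, hV.continuous⟩ (A (x, τ))) r := by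
      intro t' ht'
      have h1 := key x τ hxτ (t' / τ) (hmem t' ht')
      rw [div_mul_cancel₀ _ hτ0.ne'] at h1
      rw [h1]
      exact congrArg (fun α : Curves E => α ⟨t' / τ, hmem t' ht'⟩) (hfix (x, τ) hxτ)
    have hopen : ∀ᶠ t' in 𝓝 t, |t'| < τ := (continuous_abs.tendsto t).eventually (gt_mem_nhds ht)
    have hderiv := ((Curves.continuous_extend
      (ContinuousMap.comp ⟨V, hV.continuous⟩ (A (x, τ)))).integral_hasStrictDerivAt
        0 (t / τ)).hasDerivAt.scomp t ((hasDerivAt_id t).div_const τ)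
    have h2 := (hderiv.const_smul τ).const_add x
    refine (h2.congr_of_eventuallyEq ?_).congr_deriv ?_
    · filter_upwards [hopen] with t' ht'
      exact hev t' ht'
    · rw [Curves.extend_of_mem _ (hmem t ht), smul_smul, mul_one_div, div_self hτ0.ne', one_smul]
      have h1 := key x τ hxτ (t / τ) (hmem t ht)
      rw [div_mul_cancel₀ _ hτ0.ne'] at h1
      rw [h1]
      rfl
  · have hc : Continuous fun x : E => (x, (0 : ℝ)) := by fun_prop
    filter_upwards [(hc.tendsto p).eventually hnear] with x hx
    rw [hfix (x, 0) hx]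
    simp

end Flow

/-! ### Invertibility, surjectivity and kernels in finite dimension. -/

section LinearAlgebra

variable {E : Type*} [NormedAddCommGroup E] [NormedSpace ℝ E] [FiniteDimensional ℝ E]
  {F : Type*} [NormedAddCommGroup F] [NormedSpace ℝ F] [FiniteDimensional ℝ F]

theorem isInvertible_of_injective {T : E →L[ℝ] F}
    (hdim : Module.finrank ℝ E = Module.finrank ℝ F) (h : ∀ v, T v = 0 → v = 0) :
    T.IsInvertible :=
  ⟨(LinearMap.linearEquivOfInjective T.toLinearMap
    ((injective_iff_map_eq_zero T).2 h) hdim).toContinuousLinearEquiv, by ext; rfl⟩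

/-- With `s` a right inverse at `p`, the composite of `c q` with `s` is near the identity, hence
invertible. -/
theorem eventually_surjective {X : Type*} [TopologicalSpace X] {c : X → E →L[ℝ] F} {p : X}
    (hc : ContinuousAt c p) (h : Function.Surjective (c p)) :
    ∀ᶠ q in 𝓝 p, Function.Surjective (c q) := by
  obtain ⟨s, hs⟩ := (c p).exists_rightInverse_of_surjective (LinearMap.range_eq_top.2 h)
  have h1 : ContinuousAt (fun q => (c q).comp s) p := hc.clm_comp continuousAt_const
  have h2 : ∀ᶠ q in 𝓝 p, (c q).comp s ∈ Set.range ((↑) : (F ≃L[ℝ] F) → F →L[ℝ] F) := by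
    refine h1.eventually ?_
    simp only [hs]
    exact (ContinuousLinearEquiv.refl ℝ F).nhds
  filter_upwards [h2] with q ⟨e, he⟩ y
  refine ⟨s (e.symm y), ?_⟩
  have := congrArg (fun L : F →L[ℝ] F => L (e.symm y)) he
  simpa using this.symm

theorem finrank_ker_of_surjective {T : E →L[ℝ] F} (h : Function.Surjective T) :
    Module.finrank ℝ F + Module.finrank ℝ (LinearMap.ker T.toLinearMap) = Module.finrank ℝ E := by
  rw [← LinearMap.finrank_range_add_finrank_ker T.toLinearMap, LinearMap.range_eq_top.2 h,
    finrank_top]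

/-- If `T` is onto and kills as many independent vectors as it can, they span its kernel. -/
theorem mem_span_of_map_eq_zero {T : E →L[ℝ] F} (h : Function.Surjective T) {k : ℕ}
    {v : Fin k → E} (hv : LinearIndependent ℝ v) (hT : ∀ i, T (v i) = 0)
    (hdim : Module.finrank ℝ E = Module.finrank ℝ F + k) {x : E} (hx : T x = 0) :
    x ∈ Submodule.span ℝ (Set.range v) := by
  have hle : Submodule.span ℝ (Set.range v) ≤ LinearMap.ker T.toLinearMap := by
    rw [Submodule.span_le]
    rintro _ ⟨i, rfl⟩
    exact hT i
  have hk := finrank_ker_of_surjective h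
  rw [Submodule.eq_of_le_of_finrank_eq hle (by rw [finrank_span_eq_card hv]; simp; omega)]
  exact hx

theorem exists_smul_of_map_eq_zero {T : E →L[ℝ] F} (h : Function.Surjective T) {v : E}
    (hv : v ≠ 0) (hT : T v = 0) (hdim : Module.finrank ℝ E = Module.finrank ℝ F + 1) {x : E}
    (hx : T x = 0) : ∃ a : ℝ, x = a • v := by
  have := mem_span_of_map_eq_zero (v := fun _ : Fin 1 => v) h
    (LinearIndependent.of_subsingleton (i := 0) (by simpa using hv)) (fun _ => hT) hdim hx
  simp only [Set.range_const, Submodule.mem_span_singleton] at this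
  obtain ⟨a, ha⟩ := this
  exact ⟨a, ha.symm⟩

end LinearAlgebra

/-! ### First integrals of a vector field, and descent through submersions. -/

section FirstIntegrals

universe u
variable {E : Type u} [NormedAddCommGroup E] [NormedSpace ℝ E] [FiniteDimensional ℝ E]

/-- The rectification theorem: a nonvanishing vector field has a full set of first integrals. -/
theorem exists_firstIntegrals {n : ℕ} (hdim : Module.finrank ℝ E = n + 1) {V : E → E} {p : E}
    (hV : SmoothNear V p) (hp : V p ≠ 0) :
    ∃ F : E → Fin n → ℝ, SmoothNear F p ∧ Function.Surjective (fderiv ℝ F p) ∧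
      ∀ᶠ q in 𝓝 p, fderiv ℝ F q (V q) = 0 := by
  have : CompleteSpace E := FiniteDimensional.complete ℝ E
  obtain ⟨V', hV', hVV'⟩ := hV.exists_contDiff
  obtain ⟨φ, hφs, hφd, hφ0⟩ := exists_smooth_flow hV' p
  -- The hyperplane `p + ker l` is transverse to `V` at `p` and serves as the slice from which the
  -- flow starts.
  obtain ⟨l, hl⟩ := SeparatingDual.exists_eq_one (R := ℝ) hp
  have hlsurj : Function.Surjective l := fun r => ⟨r • V p, by simp [hl]⟩
  have hker := finrank_ker_of_surjective hlsurj
  have hker' : Module.finrank ℝ (Fin n → ℝ) = Module.finrank ℝ (LinearMap.ker l.toLinearMap) := by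
    simp at hker ⊢; omega
  let κ₀ : (Fin n → ℝ) ≃ₗ[ℝ] LinearMap.ker l.toLinearMap := LinearEquiv.ofFinrankEq _ _ hker'
  let κ : (Fin n → ℝ) →L[ℝ] E :=
    ((LinearMap.ker l.toLinearMap).subtype.comp κ₀.toLinearMap).toContinuousLinearMap
  have hκl : ∀ k, l (κ k) = 0 := fun k => (κ₀ k).2
  have hκ0 : ∀ k, κ k = 0 → k = 0 := fun k hk => κ₀.map_eq_zero_iff.1 (Subtype.ext hk)
  let ι : (Fin n → ℝ) × ℝ → E × ℝ := fun z => (p + κ z.1, z.2)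
  have hι0 : ι 0 = (p, 0) := by simp [ι]
  have hιd : HasFDerivAt ι ((κ.comp (.fst ℝ _ ℝ)).prod (.snd ℝ (Fin n → ℝ) ℝ)) 0 :=
    ((κ.comp (.fst ℝ _ ℝ)).hasFDerivAt.const_add p).prodMk
      (ContinuousLinearMap.snd ℝ (Fin n → ℝ) ℝ).hasFDerivAt
  have hιs : SmoothNear ι 0 :=
    ((SmoothNear.const p _).add (.clm (κ.comp (.fst ℝ _ ℝ)) _)).prodMk
      (.clm (ContinuousLinearMap.snd ℝ (Fin n → ℝ) ℝ) _)
  -- Flow box coordinates: the slice point and the elapsed time. The slice coordinate of the inverse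
  -- of `Φ` is constant on flow lines and gives the first integrals.
  let Φ : (Fin n → ℝ) × ℝ → E := fun z => φ (ι z)
  have hΦs : SmoothNear Φ 0 := SmoothNear.comp (by rwa [hι0]) hιs
  have hφp : φ (p, 0) = p := hφ0.self_of_nhds
  have hΦ0 : Φ 0 = p := by simp only [Φ, hι0, hφp]
  have hφ1 : ∀ ξ, fderiv ℝ φ (p, 0) (ξ, 0) = ξ := by
    intro ξ
    have h1 : HasFDerivAt (fun x : E => φ (x, 0))
        ((fderiv ℝ φ (p, 0)).comp (.inl ℝ E ℝ)) p :=
      (hφs.differentiableAt.hasFDerivAt).comp p (hasFDerivAt_prodMk_left p 0)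
    have h2 : HasFDerivAt (fun x : E => φ (x, 0)) (.id ℝ E) p :=
      (hasFDerivAt_id p).congr_of_eventuallyEq hφ0
    simpa using congrArg (fun L : E →L[ℝ] E => L ξ) (h1.unique h2)
  have hφ2 : fderiv ℝ φ (p, 0) (0, 1) = V p := by
    have h1 : HasDerivAt (fun t : ℝ => φ (p, t)) (fderiv ℝ φ (p, 0) (0, 1)) 0 := by
      have := (hφs.differentiableAt.hasFDerivAt).comp_hasDerivAt (0 : ℝ)
        ((hasDerivAt_const (0 : ℝ) p).prodMk (hasDerivAt_id (0 : ℝ)))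
      exact this
    rw [h1.unique hφd.self_of_nhds, hφp, hVV'.self_of_nhds]
  have hΦd : ∀ z, fderiv ℝ Φ 0 z = κ z.1 + z.2 • V p := by
    intro z
    have h0 : HasFDerivAt φ (fderiv ℝ φ (p, 0)) (ι 0) := by
      rw [hι0]; exact hφs.differentiableAt.hasFDerivAt
    rw [show fderiv ℝ Φ 0 = _ from (h0.comp 0 hιd).fderiv]
    have : ((κ z.1, z.2) : E × ℝ) = (κ z.1, 0) + z.2 • ((0, 1) : E × ℝ) := by simp
    change fderiv ℝ φ (p, 0) (κ z.1, z.2) = _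
    rw [this, map_add, map_smul, hφ1, hφ2]
  have hinv : (fderiv ℝ Φ 0).IsInvertible := by
    refine isInvertible_of_injective (by simp [hdim]) fun z hz => ?_
    rw [hΦd] at hz
    have h1 := congrArg l hz
    simp only [map_add, hκl, map_smul, hl, smul_eq_mul, mul_one, zero_add, map_zero] at h1
    rw [h1, zero_smul, add_zero] at hz
    exact Prod.ext (hκ0 _ hz) h1
  have hgood : ∀ᶠ z in 𝓝 (0 : (Fin n → ℝ) × ℝ),
      HasDerivAt (fun t => φ (p + κ z.1, t)) (V (Φ z)) z.2 := by
    have h1 : ∀ᶠ z in 𝓝 (0 : (Fin n → ℝ) × ℝ), V' (Φ z) = V (Φ z) :=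
      hΦs.continuousAt.eventually (by rw [hΦ0]; exact hVV')
    have h2 := hιs.continuousAt.eventually (by rw [hι0]; exact hφd)
    filter_upwards [h1, h2] with z h1 h2
    rw [← h1]; exact h2
  obtain ⟨e, h0e, hes, hef, -, hsymm⟩ := hΦs.exists_openPartialHomeomorph hinv hgood
  have hpt : p ∈ e.target := by rw [← hΦ0, ← hef]; exact e.map_source h0e
  have hFs : ∀ q ∈ e.target, ContDiffAt ℝ ∞ (fun q => (e.symm q).1) q := fun q hq =>
    contDiff_fst.contDiffAt.comp q (hsymm q hq)
  refine ⟨fun q => (e.symm q).1, ?_, ?_, ?_⟩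
  · filter_upwards [e.open_target.mem_nhds hpt] with q hq using hFs q hq
  · have h1 : HasFDerivAt (fun z => (e.symm (Φ z)).1)
        ((fderiv ℝ (fun q => (e.symm q).1) p).comp (fderiv ℝ Φ 0)) 0 := by
      have h2 : HasFDerivAt (fun q => (e.symm q).1) (fderiv ℝ (fun q => (e.symm q).1) p) (Φ 0) := by
        rw [hΦ0]; exact ((hFs p hpt).differentiableAt (by simp)).hasFDerivAt
      exact h2.comp 0 hΦs.differentiableAt.hasFDerivAt
    have h3 : HasFDerivAt (fun z => (e.symm (Φ z)).1)
        (ContinuousLinearMap.fst ℝ (Fin n → ℝ) ℝ) 0 := by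
      refine (ContinuousLinearMap.fst ℝ (Fin n → ℝ) ℝ).hasFDerivAt.congr_of_eventuallyEq ?_
      filter_upwards [e.open_source.mem_nhds h0e] with z hz
      rw [← hef, e.left_inv hz]; rfl
    intro k
    refine ⟨fderiv ℝ Φ 0 (k, 0), ?_⟩
    exact congrArg (fun L : (Fin n → ℝ) × ℝ →L[ℝ] (Fin n → ℝ) => L (k, 0)) (h1.unique h3)
  · filter_upwards [e.open_target.mem_nhds hpt] with q hq
    set z := e.symm q with hz
    have hzs : z ∈ e.source := e.map_target hq
    have hΦz : Φ z = q := by rw [← hef]; exact e.right_inv hq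
    have h1 : HasDerivAt (fun t => φ (p + κ z.1, t)) (V q) z.2 := hΦz ▸ hes hzs
    have h2 : HasFDerivAt (fun q => (e.symm q).1) (fderiv ℝ (fun q => (e.symm q).1) q)
        (φ (p + κ z.1, z.2)) := by
      rw [show φ (p + κ z.1, z.2) = q from hΦz]
      exact ((hFs q hq).differentiableAt (by simp)).hasFDerivAt
    have h3 := h2.comp_hasDerivAt z.2 h1
    have h4 : HasDerivAt ((fun q => (e.symm q).1) ∘ fun t => φ (p + κ z.1, t)) 0 z.2 := by
      refine (hasDerivAt_const z.2 z.1).congr_of_eventuallyEq ?_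
      have hc : Continuous fun t : ℝ => (z.1, t) := by fun_prop
      filter_upwards [(hc.tendsto z.2).eventually (e.open_source.mem_nhds hzs)] with t ht
      have := congrArg Prod.fst (e.left_inv ht)
      rw [hef] at this
      exact this
    exact h3.unique h4

/-- A function whose differential vanishes on the kernel of the differential of a submersion
factors locally through the submersion. -/
theorem exists_descent {K : Type*} [NormedAddCommGroup K] [NormedSpace ℝ K]
    [FiniteDimensional ℝ K] {G : Type*} [NormedAddCommGroup G] [NormedSpace ℝ G]
    {F : E → K} {g : E → G} {p : E} (hF : SmoothNear F p)
    (hsurj : Function.Surjective (fderiv ℝ F p)) (hg : SmoothNear g p)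
    (h : ∀ᶠ q in 𝓝 p, ∀ ξ, fderiv ℝ F q ξ = 0 → fderiv ℝ g q ξ = 0) :
    ∃ g' : K → G, SmoothNear g' (F p) ∧ ∀ᶠ q in 𝓝 p, g q = g' (F q) := by
  have : CompleteSpace E := FiniteDimensional.complete ℝ E
  set N := LinearMap.ker (fderiv ℝ F p).toLinearMap with hN
  obtain ⟨P, hP⟩ : ∃ P : E →L[ℝ] N, ∀ x : N, P x = x :=
    Submodule.ClosedComplemented.of_finiteDimensional N
  -- A projection onto the kernel at `p` completes `F` to local coordinates. The descended function
  -- is `g` on the slice where this projection has the value `P p`.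
  let Ψ : E → K × N := fun q => (F q, P q)
  have hΨ : SmoothNear Ψ p := hF.prodMk (.clm P p)
  have hΨd : HasFDerivAt Ψ ((fderiv ℝ F p).prod P) p :=
    hF.differentiableAt.hasFDerivAt.prodMk P.hasFDerivAt
  have hinv : (fderiv ℝ Ψ p).IsInvertible := by
    rw [hΨd.fderiv]
    refine isInvertible_of_injective ?_ fun v hv => ?_
    · rw [Module.finrank_prod, ← finrank_ker_of_surjective hsurj]
    · have h1 : fderiv ℝ F p v = 0 := congrArg Prod.fst hv
      have h2 : P v = 0 := congrArg Prod.snd hv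
      have h3 := hP ⟨v, h1⟩
      rw [h2] at h3
      exact (congrArg Subtype.val h3).symm
  obtain ⟨e, hpe, hes, hef, -, hsymm⟩ :=
    hΨ.exists_openPartialHomeomorph hinv (Filter.inter_mem hF (Filter.inter_mem hg h))
  have hpt : (F p, P p) ∈ e.target := by
    have := e.map_source hpe
    rwa [hef] at this
  have hsp : e.symm (F p, P p) = p := by
    have := e.left_inv hpe
    rwa [hef] at this
  obtain ⟨r, hr, hball⟩ := Metric.isOpen_iff.1 e.open_target _ hpt
  have hmem : ∀ y n, dist y (F p) < r → dist n (P p) < r → (y, n) ∈ e.target := by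
    intro y n hy hn
    refine hball ?_
    rw [Metric.mem_ball, Prod.dist_eq]
    exact max_lt hy hn
  refine ⟨fun y => g (e.symm (y, P p)), ?_, ?_⟩
  · have h1 : SmoothNear (fun y : K => e.symm (y, P p)) (F p) := by
      filter_upwards [Metric.ball_mem_nhds (F p) hr] with y hy
      exact (hsymm _ (hmem y _ hy (by simpa using hr))).comp y
        (contDiff_prodMk_left (P p)).contDiffAt
    refine SmoothNear.comp ?_ h1
    rw [hsp]
    exact hg
  · have h1 : ∀ᶠ q in 𝓝 p, dist (F q) (F p) < r :=
      Metric.tendsto_nhds.1 hF.continuousAt r hr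
    have h2 : ∀ᶠ q in 𝓝 p, dist (P q) (P p) < r :=
      Metric.tendsto_nhds.1 P.continuous.continuousAt r hr
    filter_upwards [h1, h2, e.open_source.mem_nhds hpe] with q hq1 hq2 hqs
    -- In these coordinates the fibre of `F` is a ball, which is connected, so a vanishing
    -- derivative along the fibre makes `g` constant on it.
    have hd : ∀ n ∈ Metric.ball (P p) r,
        HasFDerivAt (fun n => g (e.symm (F q, n))) (0 : N →L[ℝ] G) n := by
      intro n hn
      have ht := hmem (F q) n hq1 hn
      have hx : ContDiffAt ℝ ∞ F (e.symm (F q, n)) ∧ ContDiffAt ℝ ∞ g (e.symm (F q, n)) ∧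
          ∀ ξ, fderiv ℝ F (e.symm (F q, n)) ξ = 0 → fderiv ℝ g (e.symm (F q, n)) ξ = 0 :=
        hes (e.map_target ht)
      set x := e.symm (F q, n) with hxdef
      have hs : HasFDerivAt e.symm (fderiv ℝ e.symm (F q, n)) (F q, n) :=
        ((hsymm _ ht).differentiableAt (by simp)).hasFDerivAt
      have hs' : HasFDerivAt (fun n => e.symm (F q, n))
          ((fderiv ℝ e.symm (F q, n)).comp (.inr ℝ K N)) n :=
        hs.comp n (hasFDerivAt_prodMk_right (F q) n)
      have hg' : HasFDerivAt g (fderiv ℝ g x) x := (hx.2.1.differentiableAt (by simp)).hasFDerivAt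
      refine (hg'.comp n hs').congr_fderiv (ContinuousLinearMap.ext fun w => ?_)
      refine hx.2.2 _ ?_
      have hF' : HasFDerivAt F (fderiv ℝ F x) x := (hx.1.differentiableAt (by simp)).hasFDerivAt
      have h3 := hF'.comp n hs'
      have h4 : HasFDerivAt (F ∘ fun n => e.symm (F q, n)) (0 : N →L[ℝ] K) n := by
        refine (hasFDerivAt_const (F q) n).congr_of_eventuallyEq ?_
        filter_upwards [Metric.isOpen_ball.mem_nhds hn] with n' hn'
        have := congrArg Prod.fst (e.right_inv (hmem (F q) n' hq1 hn'))
        rw [hef] at this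
        exact this
      exact congrArg (fun L : N →L[ℝ] K => L w) (h3.unique h4)
    have hconst := Metric.isOpen_ball.is_const_of_fderiv_eq_zero
      (convex_ball (P p) r).isPreconnected
      (fun n hn => (hd n hn).differentiableAt.differentiableWithinAt)
      (fun n hn => (hd n hn).fderiv) (x := P q) (y := P p) hq2 (by simpa using hr)
    rw [← hconst]
    have := e.left_inv hqs
    rw [hef] at this
    rw [show (F q, P q) = Ψ q from rfl, this]

end FirstIntegrals

/-! ### Smooth coefficients in a frame, and brackets modulo the frame. -/

section Tensoriality

variable {E : Type*} [NormedAddCommGroup E] [NormedSpace ℝ E] [FiniteDimensional ℝ E]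
  {ι : Type*} [Fintype ι]

theorem exists_leftInverse [DecidableEq ι] {v : ι → E} (hv : LinearIndependent ℝ v) :
    ∃ L : E →L[ℝ] ι → ℝ, ∀ i, L (v i) = Pi.single i 1 := by
  obtain ⟨L, hL⟩ := (Fintype.linearCombination ℝ v).exists_leftInverse_of_injective
    (LinearMap.ker_eq_bot.2 (hv.fintypeLinearCombination_injective))
  refine ⟨L.toContinuousLinearMap, fun i => ?_⟩
  have := congrArg (fun T : (ι → ℝ) →ₗ[ℝ] (ι → ℝ) => T (Pi.single i 1)) hL
  simpa [Fintype.linearCombination_apply_single] using this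

theorem eventually_linearIndependent {X : ι → E → E} {p : E} (hX : ∀ i, SmoothNear (X i) p)
    (hli : LinearIndependent ℝ fun i => X i p) :
    ∀ᶠ q in 𝓝 p, LinearIndependent ℝ fun i => X i q := by
  have : ContinuousAt (fun q => fun i => X i q) p :=
    continuousAt_pi.2 fun i => (hX i).continuousAt
  exact this.eventually hli.eventually

/-- A smooth section of the span of a smooth frame has smooth coefficients. -/
theorem exists_smooth_coeffs {X : ι → E → E} {S : E → E} {p : E} (hX : ∀ i, SmoothNear (X i) p)
    (hli : LinearIndependent ℝ fun i => X i p) (hS : SmoothNear S p)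
    (hmem : ∀ᶠ q in 𝓝 p, S q ∈ Submodule.span ℝ (Set.range fun i => X i q)) :
    ∃ c : ι → E → ℝ, (∀ i, SmoothNear (c i) p) ∧ ∀ᶠ q in 𝓝 p, S q = ∑ i, c i q • X i q := by
  classical
  obtain ⟨L, hL⟩ := exists_leftInverse hli
  -- `B q` sends coefficients to `L` of the combination they define. It is the identity at `p`, so
  -- inverting it nearby recovers the coefficients smoothly.
  let B : E → (ι → ℝ) →L[ℝ] (ι → ℝ) := fun q =>
    L.comp (∑ i, (ContinuousLinearMap.proj i : (ι → ℝ) →L[ℝ] ℝ).smulRight (X i q))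
  have hBapp : ∀ q d, B q d = L (∑ i, d i • X i q) := fun q d => by simp [B]
  have hB : SmoothNear B p := by
    refine SmoothNear.clm_compose (.const L p) (SmoothNear.sum fun i => ?_)
    exact (hX i).clm_comp (ContinuousLinearMap.smulRightL ℝ (ι → ℝ) E
      (ContinuousLinearMap.proj i : (ι → ℝ) →L[ℝ] ℝ))
  have hBp : B p = .id ℝ (ι → ℝ) := by
    ext d i
    simp [hBapp, hL, Finset.sum_apply, Pi.single_apply]
  have hBi : (B p).IsInvertible := by rw [hBp]; exact ⟨.refl ℝ _, rfl⟩
  refine ⟨fun i q => (B q).inverse (L (S q)) i,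
    fun i => ((hB.inverse hBi).clm_apply (hS.clm_comp L)).apply i, ?_⟩
  have hev : ∀ᶠ q in 𝓝 p, (B q).IsInvertible := by
    refine hB.continuousAt.eventually ?_
    rw [hBp]
    exact (ContinuousLinearEquiv.refl ℝ (ι → ℝ)).nhds
  filter_upwards [hmem, hev] with q hq hqi
  obtain ⟨d, hd⟩ := (Submodule.mem_span_range_iff_exists_fun ℝ).1 hq
  have : (B q).inverse (L (S q)) = d := by
    rw [← hd, ← hBapp, hqi.inverse_apply_self]
  rw [this, hd]

theorem fderiv_sum_smul {X : ι → E → E} {c : ι → E → ℝ} {S : E → E} {p : E}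
    (hX : ∀ i, SmoothNear (X i) p) (hc : ∀ i, SmoothNear (c i) p)
    (hS : ∀ᶠ q in 𝓝 p, S q = ∑ i, c i q • X i q) (ξ : E) :
    fderiv ℝ S p ξ = ∑ i, (fderiv ℝ (c i) p ξ • X i p + c i p • fderiv ℝ (X i) p ξ) := by
  have h1 : HasFDerivAt S (∑ i, (c i p • fderiv ℝ (X i) p + (fderiv ℝ (c i) p).smulRight (X i p)))
      p := by
    refine HasFDerivAt.congr_of_eventuallyEq ?_ hS
    exact HasFDerivAt.fun_sum fun i _ =>
      (hc i).differentiableAt.hasFDerivAt.smul (hX i).differentiableAt.hasFDerivAt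
  rw [h1.fderiv]
  simp [add_comm]

/-- Brackets of sections of the span of a smooth frame are controlled by brackets of the frame. -/
theorem lieBracket_mem_span {X : ι → E → E} {S T : E → E} {p : E}
    (hX : ∀ i, SmoothNear (X i) p) (hli : LinearIndependent ℝ fun i => X i p)
    (hS : SmoothNear S p) (hT : SmoothNear T p)
    (hSm : ∀ᶠ q in 𝓝 p, S q ∈ Submodule.span ℝ (Set.range fun i => X i q))
    (hTm : ∀ᶠ q in 𝓝 p, T q ∈ Submodule.span ℝ (Set.range fun i => X i q))
    {W : Submodule ℝ E} (hW : ∀ i, X i p ∈ W)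
    (hW' : ∀ i j, VectorField.lieBracket ℝ (X i) (X j) p ∈ W) :
    VectorField.lieBracket ℝ S T p ∈ W := by
  obtain ⟨c, hc, hcS⟩ := exists_smooth_coeffs hX hli hS hSm
  obtain ⟨d, hd, hdT⟩ := exists_smooth_coeffs hX hli hT hTm
  have h1 : ∀ (a b : ι → ℝ), ∑ i, a i • fderiv ℝ (X i) p (∑ j, b j • X j p) =
      ∑ i, ∑ j, (a i * b j) • fderiv ℝ (X i) p (X j p) := by
    intro a b
    simp [Finset.smul_sum, mul_smul, map_sum]
  have hdS : ∑ i, d i p • fderiv ℝ (X i) p (S p) =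
      ∑ i, ∑ j, (d i p * c j p) • fderiv ℝ (X i) p (X j p) := by
    rw [hcS.self_of_nhds]; exact h1 (fun i => d i p) (fun i => c i p)
  have hcT : ∑ i, c i p • fderiv ℝ (X i) p (T p) =
      ∑ i, ∑ j, (d i p * c j p) • fderiv ℝ (X j) p (X i p) := by
    rw [hdT.self_of_nhds, Finset.sum_comm]
    simpa only [mul_comm (c _ p)] using h1 (fun i => c i p) (fun i => d i p)
  -- Leibniz expansion: differentiating coefficients gives combinations of the frame, and the
  -- remaining terms are brackets of the frame.
  have h2 : VectorField.lieBracket ℝ S T p =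
      (∑ i, fderiv ℝ (d i) p (S p) • X i p - ∑ i, fderiv ℝ (c i) p (T p) • X i p) +
      ∑ i, ∑ j, (d i p * c j p) • VectorField.lieBracket ℝ (X j) (X i) p := by
    simp only [VectorField.lieBracket, fderiv_sum_smul hX hd hdT, fderiv_sum_smul hX hc hcS,
      Finset.sum_add_distrib, smul_sub, Finset.sum_sub_distrib, hdS, hcT]
    abel
  rw [h2]
  refine W.add_mem (W.sub_mem ?_ ?_) ?_
  · exact W.sum_mem fun i _ => W.smul_mem _ (hW i)
  · exact W.sum_mem fun i _ => W.smul_mem _ (hW i)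
  · exact W.sum_mem fun i _ => W.sum_mem fun j _ => W.smul_mem _ (hW' j i)

theorem fderiv_apply_lieBracket {G : Type*} [NormedAddCommGroup G] [NormedSpace ℝ G]
    {f : E → G} {X Y : E → E} {p : E} (hf : SmoothNear f p) (hX : SmoothNear X p)
    (hY : SmoothNear Y p) :
    fderiv ℝ f p (VectorField.lieBracket ℝ X Y p) =
      fderiv ℝ (fun q => fderiv ℝ f q (Y q)) p (X p) -
        fderiv ℝ (fun q => fderiv ℝ f q (X q)) p (Y p) :=
  VectorField.fderiv_apply_lieBracket (n := ∞) hf.contDiffAt (by simp; norm_cast)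
    hY.differentiableAt hX.differentiableAt

end Tensoriality

/-! ### The Frobenius theorem, by induction on the rank. -/

section Frobenius

universe u
variable {E : Type u} [NormedAddCommGroup E] [NormedSpace ℝ E] [FiniteDimensional ℝ E]

/-- A vector field with constant value under a linear functional brackets into its kernel. -/
theorem map_lieBracket_eq_zero {l : E →L[ℝ] ℝ} {X Y : E → E} {p : E} {a b : ℝ}
    (hX : SmoothNear X p) (hY : SmoothNear Y p)
    (ha : ∀ᶠ q in 𝓝 p, l (X q) = a) (hb : ∀ᶠ q in 𝓝 p, l (Y q) = b) :
    l (VectorField.lieBracket ℝ X Y p) = 0 := by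
  have key : ∀ {Z : E → E} {c : ℝ}, SmoothNear Z p → (∀ᶠ q in 𝓝 p, l (Z q) = c) →
      ∀ ξ, l (fderiv ℝ Z p ξ) = 0 := by
    intro Z c hZ hc ξ
    have h1 : HasFDerivAt (fun q => l (Z q)) (l.comp (fderiv ℝ Z p)) p :=
      l.hasFDerivAt.comp p hZ.differentiableAt.hasFDerivAt
    have h2 : HasFDerivAt (fun q => l (Z q)) (0 : E →L[ℝ] ℝ) p :=
      (hasFDerivAt_const c p).congr_of_eventuallyEq hc
    exact congrArg (fun L : E →L[ℝ] ℝ => L ξ) (h1.unique h2)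
  rw [VectorField.lieBracket, map_sub, key hY hb, key hX ha, sub_zero]

/-- The Frobenius theorem: an involutive frame of `k` fields has `n = dim E - k` independent
first integrals. -/
theorem exists_frobenius (k : ℕ) : ∀ {n : ℕ}, Module.finrank ℝ E = n + k →
    ∀ {X : Fin k → E → E} {p : E}, (∀ i, SmoothNear (X i) p) →
    (LinearIndependent ℝ fun i => X i p) →
    (∀ᶠ q in 𝓝 p, ∀ i j, VectorField.lieBracket ℝ (X i) (X j) q ∈
      Submodule.span ℝ (Set.range fun i => X i q)) →
    ∃ F : E → Fin n → ℝ, SmoothNear F p ∧ Function.Surjective (fderiv ℝ F p) ∧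
      ∀ᶠ q in 𝓝 p, ∀ i, fderiv ℝ F q (X i q) = 0 := by
  induction k with
  | zero =>
    intro n hdim X p _ _ _
    let T : E ≃L[ℝ] (Fin n → ℝ) :=
      (LinearEquiv.ofFinrankEq E (Fin n → ℝ) (by simpa using hdim)).toContinuousLinearEquiv
    refine ⟨fun q => T q, .clm (T : E →L[ℝ] Fin n → ℝ) p, ?_, .of_forall fun q i => i.elim0⟩
    rw [show fderiv ℝ (fun q => T q) p = (T : E →L[ℝ] Fin n → ℝ) from T.fderiv]
    exact T.surjective
  | succ k ih =>
    intro n hdim X p hX hli hinv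
    obtain ⟨L, hL⟩ := exists_leftInverse hli
    let l : E →L[ℝ] ℝ := (ContinuousLinearMap.proj 0).comp L
    have hl0 : l (X 0 p) = 1 := by simp [l, hL]
    have hls : ∀ i : Fin k, l (X i.succ p) = 0 := fun i => by simp [l, hL]
    let a : E → ℝ := fun q => l (X 0 q)
    have ha : SmoothNear a p := (hX 0).clm_comp l
    have hap : a p ≠ 0 := by simp [a, hl0]
    -- The frame is normalised so that `l` is 1 on `X0` and 0 on every `Y i`. Where `a` vanishes the
    -- inverse is 0, so `X0` still belongs to the span at every point.
    let X0 : E → E := fun q => (a q)⁻¹ • X 0 q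
    let Y : Fin k → E → E := fun i q => X i.succ q - l (X i.succ q) • X0 q
    have hX0 : SmoothNear X0 p := (ha.inv hap).smul (hX 0)
    have hY : ∀ i, SmoothNear (Y i) p := fun i =>
      (hX i.succ).sub (((hX i.succ).clm_comp l).smul hX0)
    have hane : ∀ᶠ q in 𝓝 p, a q ≠ 0 := ha.continuousAt.eventually_ne hap
    have hlX0 : ∀ᶠ q in 𝓝 p, l (X0 q) = 1 := by
      filter_upwards [hane] with q hq
      simp only [X0, map_smul, smul_eq_mul]
      exact inv_mul_cancel₀ hq
    have hlY : ∀ᶠ q in 𝓝 p, ∀ i, l (Y i q) = 0 := by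
      filter_upwards [hlX0] with q hq i
      simp [Y, hq]
    have hYp : ∀ i, Y i p = X i.succ p := fun i => by simp [Y, hls]
    have hYli : LinearIndependent ℝ fun i => Y i p := by
      simp only [hYp]
      exact hli.comp Fin.succ (Fin.succ_injective k)
    have hX0mem : ∀ q, X0 q ∈ Submodule.span ℝ (Set.range fun i => X i q) := fun q =>
      Submodule.smul_mem _ _ (Submodule.subset_span ⟨0, rfl⟩)
    have hYmem : ∀ i q, Y i q ∈ Submodule.span ℝ (Set.range fun i => X i q) := fun i q =>
      Submodule.sub_mem _ (Submodule.subset_span ⟨i.succ, rfl⟩)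
        (Submodule.smul_mem _ _ (hX0mem q))
    have hspan : ∀ᶠ q in 𝓝 p, ∀ v ∈ Submodule.span ℝ (Set.range fun i => X i q), l v = 0 →
        v ∈ Submodule.span ℝ (Set.range fun i => Y i q) := by
      filter_upwards [hane, hlX0, hlY] with q hq hq0 hqY v hv hlv
      obtain ⟨c, rfl⟩ := (Submodule.mem_span_range_iff_exists_fun ℝ).1 hv
      have hX00 : X 0 q = a q • X0 q := by simp [X0, smul_smul, mul_inv_cancel₀ hq]
      have hXs : ∀ i : Fin k, X i.succ q = Y i q + l (X i.succ q) • X0 q := fun i => by simp [Y]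
      have hdec : ∑ i, c i • X i q = (c 0 * a q + ∑ i : Fin k, c i.succ * l (X i.succ q)) • X0 q +
          ∑ i : Fin k, c i.succ • Y i q := by
        rw [Fin.sum_univ_succ, hX00, add_smul, Finset.sum_smul, add_assoc, smul_smul,
          ← Finset.sum_add_distrib]
        congr 1
        refine Finset.sum_congr rfl fun i _ => ?_
        conv_lhs => rw [hXs i]
        rw [smul_add, smul_smul, add_comm]
      rw [hdec] at hlv ⊢
      have hz : ∑ i : Fin k, c i.succ • l (Y i q) = 0 :=
        Finset.sum_eq_zero fun i _ => by rw [hqY i, smul_zero]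
      simp only [map_add, map_smul, map_sum, hq0, smul_eq_mul, mul_one] at hlv
      simp only [smul_eq_mul] at hz
      rw [hz, add_zero] at hlv
      rw [hlv, zero_smul, zero_add]
      exact Submodule.sum_mem _ fun i _ => Submodule.smul_mem _ _ (Submodule.subset_span ⟨i, rfl⟩)
    have hXev : ∀ᶠ q in 𝓝 p, ∀ i, SmoothNear (X i) q :=
      Filter.eventually_all.2 fun i => (hX i).eventually
    -- Involutivity puts the bracket in the span of the `X i`; constant values under `l` put it in
    -- the kernel of `l`. Together they leave the span of the `Y i`, so the smaller frame is
    -- involutive and `X0` preserves it.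
    have hbr : ∀ᶠ q in 𝓝 p, ∀ {A B : E → E} {α β : ℝ}, SmoothNear A q → SmoothNear B q →
        (∀ z, A z ∈ Submodule.span ℝ (Set.range fun i => X i z)) →
        (∀ z, B z ∈ Submodule.span ℝ (Set.range fun i => X i z)) →
        (∀ᶠ z in 𝓝 q, l (A z) = α) → (∀ᶠ z in 𝓝 q, l (B z) = β) →
        VectorField.lieBracket ℝ A B q ∈ Submodule.span ℝ (Set.range fun i => Y i q) := by
      filter_upwards [hXev, eventually_linearIndependent hX hli, hinv, hspan]
        with q hq1 hq2 hq3 hq4 A B α β hA hB hAm hBm hα hβ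
      refine hq4 _ ?_ (map_lieBracket_eq_zero hA hB hα hβ)
      exact lieBracket_mem_span hq1 hq2 hA hB (.of_forall hAm) (.of_forall hBm)
        (fun i => Submodule.subset_span ⟨i, rfl⟩) hq3
    have hYev : ∀ᶠ q in 𝓝 p, ∀ i, SmoothNear (Y i) q :=
      Filter.eventually_all.2 fun i => (hY i).eventually
    have hYinv : ∀ᶠ q in 𝓝 p, ∀ i j, VectorField.lieBracket ℝ (Y i) (Y j) q ∈
        Submodule.span ℝ (Set.range fun i => Y i q) := by
      filter_upwards [hbr, hYev, eventually_eventually_nhds.2 hlY] with q hq hqY hql i j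
      exact hq (hqY i) (hqY j) (hYmem i) (hYmem j) (hql.mono fun z hz => hz i)
        (hql.mono fun z hz => hz j)
    have hdim' : Module.finrank ℝ E = (n + 1) + k := by omega
    obtain ⟨F, hF, hFs, hFY⟩ := ih hdim' hY hYli hYinv
    let g : E → Fin (n + 1) → ℝ := fun q => fderiv ℝ F q (X0 q)
    have hg : SmoothNear g p := hF.fderiv_apply hX0
    have hker : ∀ᶠ q in 𝓝 p, ∀ ξ, fderiv ℝ F q ξ = 0 →
        ξ ∈ Submodule.span ℝ (Set.range fun i => Y i q) := by
      filter_upwards [eventually_surjective hF.fderiv.continuousAt hFs,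
        eventually_linearIndependent hY hYli, hFY] with q h1 h2 h3 ξ hξ
      exact mem_span_of_map_eq_zero h1 h2 h3 (by simpa using hdim') hξ
    -- Here Yᵢ(X₀F) = [Yᵢ, X₀]F + X₀(YᵢF), and `F` is killed by the span of the `Y i`, so both terms
    -- vanish.
    have hgY : ∀ᶠ q in 𝓝 p, ∀ i, fderiv ℝ g q (Y i q) = 0 := by
      filter_upwards [hF.eventually, hX0.eventually, hYev, hbr, eventually_eventually_nhds.2 hlY,
        eventually_eventually_nhds.2 hlX0, eventually_eventually_nhds.2 hFY]
        with q h1 h2 h3 h4 h5 h6 h7 i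
      have hmem := h4 (h3 i) h2 (hYmem i) hX0mem (h5.mono fun z hz => hz i) h6
      have h8 : fderiv ℝ F q (VectorField.lieBracket ℝ (Y i) X0 q) = 0 := by
        refine Submodule.span_induction (p := fun v _ => fderiv ℝ F q v = 0) ?_ (map_zero _)
          (fun x y _ _ hx hy => by rw [map_add, hx, hy, add_zero])
          (fun c x _ hx => by rw [map_smul, hx, smul_zero]) hmem
        rintro _ ⟨j, rfl⟩
        exact h7.self_of_nhds j
      rw [fderiv_apply_lieBracket h1 (h3 i) h2] at h8
      have h9 : fderiv ℝ (fun z => fderiv ℝ F z (Y i z)) q = 0 := by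
        have : (fun z => fderiv ℝ F z (Y i z)) =ᶠ[𝓝 q] fun _ => 0 := h7.mono fun z hz => hz i
        rw [this.fderiv_eq]
        simp
      rw [h9] at h8
      simpa using h8
    -- `V` is the vector field on the quotient by the `Y i` to which `X0` is `F`-related; composing
    -- its first integrals with `F` completes the induction.
    obtain ⟨V, hV, hgV⟩ := exists_descent hF hFs hg (by
      filter_upwards [hker, hgY] with q h1 h2 ξ hξ
      refine Submodule.span_induction (p := fun v _ => fderiv ℝ g q v = 0) ?_ (map_zero _)
        (fun x y _ _ hx hy => by rw [map_add, hx, hy, add_zero])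
        (fun c x _ hx => by rw [map_smul, hx, smul_zero]) (h1 ξ hξ)
      rintro _ ⟨j, rfl⟩
      exact h2 j)
    have hVp : V (F p) ≠ 0 := by
      rw [← hgV.self_of_nhds]
      intro h0
      have hm := hker.self_of_nhds _ h0
      have : l (X0 p) = 0 := by
        refine Submodule.span_induction (p := fun v _ => l v = 0) ?_ (map_zero _)
          (fun x y _ _ hx hy => by rw [map_add, hx, hy, add_zero])
          (fun c x _ hx => by rw [map_smul, hx, smul_zero]) hm
        rintro _ ⟨j, rfl⟩
        exact hlY.self_of_nhds j
      rw [hlX0.self_of_nhds] at this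
      exact one_ne_zero this
    obtain ⟨H, hH, hHs, hHV⟩ := exists_firstIntegrals (n := n) (by simp) hV hVp
    have hcomp : ∀ᶠ q in 𝓝 p, fderiv ℝ (fun q => H (F q)) q =
        (fderiv ℝ H (F q)).comp (fderiv ℝ F q) := by
      filter_upwards [hF.eventually, hF.continuousAt.eventually hH.eventually] with q h1 h2
      exact (h2.differentiableAt.hasFDerivAt.comp q h1.differentiableAt.hasFDerivAt).fderiv
    refine ⟨fun q => H (F q), hH.comp hF, ?_, ?_⟩
    · rw [hcomp.self_of_nhds]
      exact hHs.comp hFs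
    · filter_upwards [hcomp, hFY, hgV, hF.continuousAt.eventually hHV, hane]
        with q h1 h2 h3 h4 h5 i
      have h0 : fderiv ℝ H (F q) (fderiv ℝ F q (X0 q)) = 0 := by
        rw [show fderiv ℝ F q (X0 q) = V (F q) from h3, h4]
      rw [h1, ContinuousLinearMap.comp_apply]
      refine Fin.cases ?_ (fun i => ?_) i
      · rw [show X 0 q = a q • X0 q by simp [X0, smul_smul, mul_inv_cancel₀ h5], map_smul, map_smul,
          h0, smul_zero]
      · rw [show X i.succ q = Y i q + l (X i.succ q) • X0 q by simp [Y], map_add, map_add, map_smul,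
          map_smul, h0, h2 i, map_zero, smul_zero, add_zero]

end Frobenius

/-! ### First-order quasilinear equations by characteristics. -/

section QuasiLinear

universe u
variable {E : Type u} [NormedAddCommGroup E] [NormedSpace ℝ E] [FiniteDimensional ℝ E]

/-- A noncharacteristic first-order quasilinear equation `dt(Y(q, t)) = g(q, t)` has local
solutions. -/
theorem exists_quasilinear_solution {Y : E × ℝ → E} {g : E × ℝ → ℝ} {p : E} {t₀ : ℝ}
    (hY : SmoothNear Y (p, t₀)) (hg : SmoothNear g (p, t₀)) (hp : Y (p, t₀) ≠ 0) :
    ∃ t : E → ℝ, SmoothNear t p ∧ t p = t₀ ∧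
      ∀ᶠ q in 𝓝 p, fderiv ℝ t q (Y (q, t q)) = g (q, t q) := by
  have : CompleteSpace E := FiniteDimensional.complete ℝ E
  -- The characteristic field. A function solves the equation exactly when its graph is tangent to
  -- `V`, so a level set of a first integral is sought as the graph.
  let V : E × ℝ → E × ℝ := fun z => (Y z, g z)
  have hV : SmoothNear V (p, t₀) := hY.prodMk hg
  have hVp : V (p, t₀) ≠ 0 := fun h => hp (congrArg Prod.fst h)
  obtain ⟨F, hF, hFs, hFV⟩ := exists_firstIntegrals (n := Module.finrank ℝ E) (by simp) hV hVp
  -- The kernel of the differential is the line of `V`, whose horizontal part is nonzero. The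
  -- vertical vector is thus not in it, and some component of `F` can be solved for the last
  -- variable.
  have h01 : fderiv ℝ F (p, t₀) (0, 1) ≠ 0 := by
    intro h
    obtain ⟨a, ha⟩ := exists_smul_of_map_eq_zero hFs hVp hFV.self_of_nhds (by simp) h
    have h1 : (0 : E) = a • Y (p, t₀) := congrArg Prod.fst ha
    have h2 : (1 : ℝ) = a • g (p, t₀) := congrArg Prod.snd ha
    rcases smul_eq_zero.1 h1.symm with h3 | h3
    · simp [h3] at h2
    · exact hp h3
  obtain ⟨i, hi⟩ := Function.ne_iff.1 h01
  let w : E × ℝ → ℝ := fun z => F z i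
  have hw : SmoothNear w (p, t₀) := hF.apply i
  have hwd : ∀ᶠ z in 𝓝 (p, t₀), ∀ ξ, fderiv ℝ w z ξ = fderiv ℝ F z ξ i := by
    filter_upwards [hF.eventually] with z hz ξ
    rw [show fderiv ℝ w z = (ContinuousLinearMap.proj i).comp (fderiv ℝ F z) from
      ((ContinuousLinearMap.proj (R := ℝ) (φ := fun _ => ℝ) i).hasFDerivAt.comp z
        hz.differentiableAt.hasFDerivAt).fderiv]
    rfl
  have hw1 : fderiv ℝ w (p, t₀) (0, 1) ≠ 0 := by rw [hwd.self_of_nhds]; exact hi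
  let Ψ : E × ℝ → E × ℝ := fun z => (z.1, w z)
  have hΨ : SmoothNear Ψ (p, t₀) := (SmoothNear.clm (.fst ℝ E ℝ) _).prodMk hw
  have hΨd : HasFDerivAt Ψ ((ContinuousLinearMap.fst ℝ E ℝ).prod (fderiv ℝ w (p, t₀))) (p, t₀) :=
    (ContinuousLinearMap.fst ℝ E ℝ).hasFDerivAt.prodMk hw.differentiableAt.hasFDerivAt
  have hinv : (fderiv ℝ Ψ (p, t₀)).IsInvertible := by
    rw [hΨd.fderiv]
    refine isInvertible_of_injective rfl fun v hv => ?_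
    have h1 : v.1 = 0 := congrArg Prod.fst hv
    have h2 : fderiv ℝ w (p, t₀) v = 0 := congrArg Prod.snd hv
    have h3 : v = v.2 • ((0, 1) : E × ℝ) := Prod.ext (by simp [h1]) (by simp)
    rw [h3, map_smul, smul_eq_mul] at h2
    rw [h3, (mul_eq_zero.1 h2).resolve_right hw1, zero_smul]
  have hdw : ∀ᶠ z in 𝓝 (p, t₀), fderiv ℝ w z (0, 1) ≠ 0 :=
    (hw.fderiv_apply (.const (0, 1) _)).continuousAt.eventually_ne hw1
  obtain ⟨e, hpe, hes, hef, -, hsymm⟩ := hΨ.exists_openPartialHomeomorph hinv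
    (Filter.inter_mem hw (Filter.inter_mem hdw (Filter.inter_mem hFV hwd)))
  set w₀ := w (p, t₀)
  have hpt : (p, w₀) ∈ e.target := by
    have := e.map_source hpe
    rwa [hef] at this
  have hcont : Continuous fun q : E => (q, w₀) := by fun_prop
  let t : E → ℝ := fun q => (e.symm (q, w₀)).2
  have hq : ∀ q, (q, w₀) ∈ e.target → e.symm (q, w₀) = (q, t q) ∧ w (q, t q) = w₀ := by
    intro q hq
    have h1 := e.right_inv hq
    rw [hef] at h1
    have h2 : e.symm (q, w₀) = (q, t q) :=
      Prod.ext (show (e.symm (q, w₀)).1 = q from congrArg Prod.fst h1) rfl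
    refine ⟨h2, ?_⟩
    rw [← h2]
    exact congrArg Prod.snd h1
  have hev : ∀ᶠ q in 𝓝 p, (q, w₀) ∈ e.target :=
    hcont.continuousAt.eventually (e.open_target.mem_nhds hpt)
  have hts : SmoothNear t p := by
    filter_upwards [hev] with q hq
    exact contDiff_snd.contDiffAt.comp q ((hsymm _ hq).comp q (contDiff_prodMk_left w₀).contDiffAt)
  refine ⟨t, hts, ?_, ?_⟩
  · have := e.left_inv hpe
    rw [hef] at this
    exact congrArg Prod.snd this
  · filter_upwards [hts.eventually, hev, eventually_eventually_nhds.2 hev] with q h1 h2 h3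
    have hmem : (q, t q) ∈ e.source := by
      rw [← (hq q h2).1]; exact e.map_target h2
    obtain ⟨hs1, hs2, hs3, hs4⟩ : ContDiffAt ℝ ∞ w (q, t q) ∧ fderiv ℝ w (q, t q) (0, 1) ≠ 0 ∧
      fderiv ℝ F (q, t q) (V (q, t q)) = 0 ∧
      ∀ ξ, fderiv ℝ w (q, t q) ξ = fderiv ℝ F (q, t q) ξ i := hes hmem
    have hd1 : HasFDerivAt (fun q => w (q, t q))
        ((fderiv ℝ w (q, t q)).comp ((ContinuousLinearMap.id ℝ E).prod (fderiv ℝ t q))) q :=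
      HasFDerivAt.comp (g := w) q (hs1.differentiableAt (by simp)).hasFDerivAt
        ((hasFDerivAt_id q).prodMk h1.differentiableAt.hasFDerivAt)
    have hd2 : HasFDerivAt (fun q => w (q, t q)) (0 : E →L[ℝ] ℝ) q :=
      (hasFDerivAt_const w₀ q).congr_of_eventuallyEq (h3.mono fun z hz => (hq z hz).2)
    have h4 : fderiv ℝ w (q, t q) (Y (q, t q), fderiv ℝ t q (Y (q, t q))) = 0 :=
      congrArg (fun L : E →L[ℝ] ℝ => L (Y (q, t q))) (hd1.unique hd2)
    have h5 : fderiv ℝ w (q, t q) (Y (q, t q), g (q, t q)) = 0 := by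
      rw [hs4, show (Y (q, t q), g (q, t q)) = V (q, t q) from rfl, hs3]; rfl
    -- The graph tangent over `Y` and the characteristic vector are both in the kernel of `dw`.
    -- Their difference is vertical, where `dw` is injective.
    have h6 : fderiv ℝ w (q, t q) (0, fderiv ℝ t q (Y (q, t q)) - g (q, t q)) = 0 := by
      have : ((0, fderiv ℝ t q (Y (q, t q)) - g (q, t q)) : E × ℝ) =
          (Y (q, t q), fderiv ℝ t q (Y (q, t q))) - (Y (q, t q), g (q, t q)) := by simp
      rw [this, map_sub, h4, h5, sub_zero]
    have h7 : ((0, fderiv ℝ t q (Y (q, t q)) - g (q, t q)) : E × ℝ) =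
        (fderiv ℝ t q (Y (q, t q)) - g (q, t q)) • (0, 1) := by simp
    rw [h7, map_smul, smul_eq_mul] at h6
    exact sub_eq_zero.1 ((mul_eq_zero.1 h6).resolve_right hs2)

end QuasiLinear

/-! ### Exterior derivatives of 1-forms, Cauchy characteristics, Darboux in dimension three. -/

section Forms

universe u
variable {E : Type u} [NormedAddCommGroup E] [NormedSpace ℝ E] [FiniteDimensional ℝ E]
  {K : Type*} [NormedAddCommGroup K] [NormedSpace ℝ K] [FiniteDimensional ℝ K]

/-- The exterior derivative of a 1-form. -/
noncomputable def dForm (θ : E → E →L[ℝ] ℝ) (q : E) : E →L[ℝ] E →L[ℝ] ℝ :=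
  fderiv ℝ θ q - (fderiv ℝ θ q).flip

theorem dForm_apply (θ : E → E →L[ℝ] ℝ) (q a b : E) :
    dForm θ q a b = fderiv ℝ θ q a b - fderiv ℝ θ q b a := rfl

theorem dForm_swap (θ : E → E →L[ℝ] ℝ) (q a b : E) : dForm θ q a b = -dForm θ q b a := by
  simp [dForm_apply]

@[simp]
theorem dForm_self (θ : E → E →L[ℝ] ℝ) (q a : E) : dForm θ q a a = 0 := by simp [dForm_apply]

theorem SmoothNear.dForm {θ : E → E →L[ℝ] ℝ} {p : E} (h : SmoothNear θ p) :
    SmoothNear (dForm θ) p :=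
  h.fderiv.sub (h.fderiv.clm_comp (LinearMap.toContinuousLinearMap
    { toFun := fun B : E →L[ℝ] E →L[ℝ] ℝ => B.flip
      map_add' := fun _ _ => rfl
      map_smul' := fun _ _ => rfl }))

theorem SmoothNear.dForm_apply {θ : E → E →L[ℝ] ℝ} {X Y : E → E} {p : E} (h : SmoothNear θ p)
    (hX : SmoothNear X p) (hY : SmoothNear Y p) :
    SmoothNear (fun q => RankTwo.dForm θ q (X q) (Y q)) p :=
  (h.dForm.clm_apply hX).clm_apply hY

theorem fderiv_clm_apply_eq {c : E → K →L[ℝ] ℝ} {v : E → K} {p : E} (hc : SmoothNear c p)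
    (hv : SmoothNear v p) (ξ : E) :
    fderiv ℝ (fun q => c q (v q)) p ξ = fderiv ℝ c p ξ (v p) + c p (fderiv ℝ v p ξ) := by
  rw [(hc.differentiableAt.hasFDerivAt.clm_apply hv.differentiableAt.hasFDerivAt).fderiv]
  simp [add_comm]

/-- Cartan's formula dθ(X, Y) = X(θ(Y)) − Y(θ(X)) − θ([X, Y]), whose first two terms vanish here. -/
theorem dForm_eq_neg_lieBracket {θ : E → E →L[ℝ] ℝ} {X Y : E → E} {p : E} (h : SmoothNear θ p)
    (hX : SmoothNear X p) (hY : SmoothNear Y p) (h1 : ∀ᶠ q in 𝓝 p, θ q (X q) = 0)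
    (h2 : ∀ᶠ q in 𝓝 p, θ q (Y q) = 0) :
    dForm θ p (X p) (Y p) = -θ p (VectorField.lieBracket ℝ X Y p) := by
  have key : ∀ {Z : E → E}, SmoothNear Z p → (∀ᶠ q in 𝓝 p, θ q (Z q) = 0) → ∀ ξ,
      fderiv ℝ θ p ξ (Z p) = -θ p (fderiv ℝ Z p ξ) := by
    intro Z hZ hz ξ
    have h3 := fderiv_clm_apply_eq h hZ ξ
    have h4 : (fun q => θ q (Z q)) =ᶠ[𝓝 p] fun _ => 0 := hz
    rw [h4.fderiv_eq] at h3
    simp only [fderiv_fun_const, Pi.zero_apply, zero_apply] at h3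
    linarith
  rw [dForm_apply, key hY h2, key hX h1, VectorField.lieBracket, map_sub]
  ring

/-- A 1-form vanishing on the kernel of the differential of a submersion is a combination of the
differentials of its components. -/
theorem exists_factor {θ : E → E →L[ℝ] ℝ} {F : E → K} {p : E} (hθ : SmoothNear θ p)
    (hF : SmoothNear F p) (hFs : Function.Surjective (fderiv ℝ F p))
    (h : ∀ᶠ q in 𝓝 p, ∀ ξ, fderiv ℝ F q ξ = 0 → θ q ξ = 0) :
    ∃ c : E → K →L[ℝ] ℝ, SmoothNear c p ∧ ∀ᶠ q in 𝓝 p, ∀ ξ, θ q ξ = c q (fderiv ℝ F q ξ) := by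
  have : CompleteSpace K := FiniteDimensional.complete ℝ K
  obtain ⟨s, hs⟩ := (fderiv ℝ F p).exists_rightInverse_of_surjective (LinearMap.range_eq_top.2 hFs)
  -- The right inverse `s` at `p`, corrected by the inverse of `B q`, is a right inverse at `q`. It
  -- lifts `dF ξ` up to an element of the kernel, on which `θ` vanishes.
  let B : E → K →L[ℝ] K := fun q => (fderiv ℝ F q).comp s
  have hB : SmoothNear B p := hF.fderiv.clm_compose (.const s p)
  have hBp : (B p).IsInvertible := by rw [show B p = .id ℝ K from hs]; exact ⟨.refl ℝ _, rfl⟩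
  have hev : ∀ᶠ q in 𝓝 p, (B q).IsInvertible := by
    refine hB.continuousAt.eventually ?_
    rw [show B p = .id ℝ K from hs]
    exact (ContinuousLinearEquiv.refl ℝ K).nhds
  refine ⟨fun q => ((θ q).comp s).comp (B q).inverse,
    (hθ.clm_compose (.const s p)).clm_compose (hB.inverse hBp), ?_⟩
  filter_upwards [h, hev] with q h1 h2 ξ
  have h3 : fderiv ℝ F q (ξ - s ((B q).inverse (fderiv ℝ F q ξ))) = 0 := by
    rw [map_sub]
    have := h2.self_apply_inverse (fderiv ℝ F q ξ)
    rw [show fderiv ℝ F q (s ((B q).inverse (fderiv ℝ F q ξ))) = _ from this, sub_self]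
  have h4 := h1 _ h3
  rw [map_sub] at h4
  exact sub_eq_zero.1 h4

/-- On the kernel of `θ` the terms with `dr` drop out, and the second derivatives of `F` cancel by
symmetry. Only the derivative of `c` survives. -/
theorem dForm_of_factor {θ : E → E →L[ℝ] ℝ} {F : E → K} {c : E → K →L[ℝ] ℝ} {r : E → ℝ} {p : E}
    (hF : SmoothNear F p) (hc : SmoothNear c p) (hr : SmoothNear r p) (hrp : r p ≠ 0)
    (h : ∀ᶠ q in 𝓝 p, ∀ ξ, θ q ξ = r q * c q (fderiv ℝ F q ξ)) {a b : E} (ha : θ p a = 0)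
    (hb : θ p b = 0) :
    dForm θ p a b =
      r p * (fderiv ℝ c p a (fderiv ℝ F p b) - fderiv ℝ c p b (fderiv ℝ F p a)) := by
  have h1 : θ =ᶠ[𝓝 p] fun q => r q • (c q).comp (fderiv ℝ F q) := by
    filter_upwards [h] with q hq
    ext ξ
    simpa using hq ξ
  have h2 : HasFDerivAt (fun q => r q • (c q).comp (fderiv ℝ F q)) _ p :=
    hr.differentiableAt.hasFDerivAt.smul
      (hc.differentiableAt.hasFDerivAt.clm_comp hF.fderiv.differentiableAt.hasFDerivAt)
  have hz : ∀ x, θ p x = 0 → c p (fderiv ℝ F p x) = 0 := by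
    intro x hx
    rw [h.self_of_nhds] at hx
    exact (mul_eq_zero.1 hx).resolve_left hrp
  have hsymm : fderiv ℝ (fderiv ℝ F) p a b = fderiv ℝ (fderiv ℝ F) p b a :=
    (hF.contDiffAt.isSymmSndFDerivAt (by simp; norm_cast)) a b
  rw [dForm_apply, h1.fderiv_eq, h2.fderiv]
  simp [hz a ha, hz b hb, hsymm]
  ring

theorem dForm_of_descent {θ : E → E →L[ℝ] ℝ} {F : E → K} {c : K → K →L[ℝ] ℝ} {r : E → ℝ} {p : E}
    (hF : SmoothNear F p) (hc : SmoothNear c (F p)) (hr : SmoothNear r p) (hrp : r p ≠ 0)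
    (h : ∀ᶠ q in 𝓝 p, ∀ ξ, θ q ξ = r q * c (F q) (fderiv ℝ F q ξ)) {a b : E} (ha : θ p a = 0)
    (hb : θ p b = 0) :
    dForm θ p a b = r p * dForm c (F p) (fderiv ℝ F p a) (fderiv ℝ F p b) := by
  rw [dForm_of_factor (c := fun q => c (F q)) hF (hc.comp hF) hr hrp h ha hb,
    show fderiv ℝ (fun q => c (F q)) p = (fderiv ℝ c (F p)).comp (fderiv ℝ F p) from
      (hc.differentiableAt.hasFDerivAt.comp p hF.differentiableAt.hasFDerivAt).fderiv]
  rfl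

/-- A 1-form with a Cauchy characteristic field descends, up to a factor, to the space of integral
curves of this field. -/
theorem exists_cauchy_descent {n : ℕ} (hdim : Module.finrank ℝ E = n + 1) {θ : E → E →L[ℝ] ℝ}
    {Y : E → E} {p : E} (hθ : SmoothNear θ p) (hY : SmoothNear Y p) (hYp : Y p ≠ 0)
    (hθp : θ p ≠ 0) (hθY : ∀ᶠ q in 𝓝 p, θ q (Y q) = 0)
    (hC : ∀ᶠ q in 𝓝 p, ∀ ξ, θ q ξ = 0 → dForm θ q (Y q) ξ = 0) :
    ∃ (F : E → Fin n → ℝ) (c : (Fin n → ℝ) → (Fin n → ℝ) →L[ℝ] ℝ) (r : E → ℝ),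
      SmoothNear F p ∧ SmoothNear c (F p) ∧ SmoothNear r p ∧ r p ≠ 0 ∧
      (∀ᶠ q in 𝓝 p, fderiv ℝ F q (Y q) = 0) ∧
      ∀ᶠ q in 𝓝 p, ∀ ξ, θ q ξ = r q * c (F q) (fderiv ℝ F q ξ) := by
  obtain ⟨F, hF, hFs, hFY⟩ := exists_firstIntegrals hdim hY hYp
  have hFs' := eventually_surjective hF.fderiv.continuousAt hFs
  have hker : ∀ᶠ q in 𝓝 p, ∀ ξ, fderiv ℝ F q ξ = 0 → ∃ a : ℝ, ξ = a • Y q := by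
    filter_upwards [hFs', hY.continuousAt.eventually_ne hYp, hFY] with q h1 h2 h3 ξ hξ
    exact exists_smul_of_map_eq_zero h1 h2 h3 (by simpa using hdim) hξ
  obtain ⟨c₀, hc₀, hθc⟩ := exists_factor hθ hF hFs (by
    filter_upwards [hker, hθY] with q h1 h2 ξ hξ
    obtain ⟨a, rfl⟩ := h1 ξ hξ
    rw [map_smul, h2, smul_zero])
  obtain ⟨k₀, hk₀⟩ : ∃ k₀, c₀ p k₀ ≠ 0 := by
    by_contra! hcon
    refine hθp (ContinuousLinearMap.ext fun ξ => ?_)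
    rw [hθc.self_of_nhds, hcon]; rfl
  let r : E → ℝ := fun q => c₀ q k₀
  have hr : SmoothNear r p := hc₀.clm_apply (.const k₀ p)
  have hrne : ∀ᶠ q in 𝓝 p, r q ≠ 0 := hr.continuousAt.eventually_ne hk₀
  -- Only the line spanned by the coefficient form is invariant along `Y`. Normalising its value on
  -- `k₀` to 1 picks a representative that is itself invariant.
  let c₁ : E → (Fin n → ℝ) →L[ℝ] ℝ := fun q => (r q)⁻¹ • c₀ q
  have hc₁ : SmoothNear c₁ p := (hr.inv hk₀).smul hc₀
  have hθc₁ : ∀ᶠ q in 𝓝 p, ∀ ξ, θ q ξ = r q * c₁ q (fderiv ℝ F q ξ) := by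
    filter_upwards [hθc, hrne] with q h1 h2 ξ
    simp [c₁, h1, mul_inv_cancel_left₀ h2]
  have hc₁k : ∀ᶠ q in 𝓝 p, c₁ q k₀ = 1 := by
    filter_upwards [hrne] with q h2
    exact inv_mul_cancel₀ h2
  have hc₁Y : ∀ᶠ q in 𝓝 p, fderiv ℝ c₁ q (Y q) = 0 := by
    filter_upwards [hF.eventually, hc₁.eventually, hr.eventually, hrne,
      eventually_eventually_nhds.2 hθc₁, eventually_eventually_nhds.2 hc₁k, hC, hθY, hFY, hFs']
      with q h1 h2 h3 h4 h5 h6 h7 h8 h9 h10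
    have hk : fderiv ℝ c₁ q (Y q) k₀ = 0 := by
      have h11 := fderiv_clm_apply_eq h2 (.const k₀ q) (Y q)
      have h12 : (fun q => c₁ q k₀) =ᶠ[𝓝 q] fun _ => 1 := h6
      rw [h12.fderiv_eq] at h11
      simpa using h11.symm
    -- Lift `k` to `ξ` in the kernel of `θ`. By `dForm_of_factor` the derivative of `c₁` along `Y`
    -- at `k` is dθ(Y, ξ)/r, which the Cauchy condition kills.
    have hz : ∀ k, c₁ q k = 0 → fderiv ℝ c₁ q (Y q) k = 0 := by
      intro k hk
      obtain ⟨ξ, rfl⟩ := h10 k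
      have hθξ : θ q ξ = 0 := by rw [h5.self_of_nhds, hk, mul_zero]
      have h11 := dForm_of_factor h1 h2 h3 h4 h5 h8 hθξ
      rw [h7 ξ hθξ, h9, map_zero, sub_zero] at h11
      exact (mul_eq_zero.1 h11.symm).resolve_left h4
    ext k
    have h11 : k = (k - c₁ q k • k₀) + c₁ q k • k₀ := by simp
    have h12 : c₁ q (k - c₁ q k • k₀) = 0 := by
      rw [map_sub, map_smul, h6.self_of_nhds]; simp
    rw [h11, map_add, map_smul, hk, hz _ h12]
    simp
  obtain ⟨c, hc, hcc⟩ := exists_descent hF hFs hc₁ (by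
    filter_upwards [hker, hc₁Y] with q h1 h2 ξ hξ
    obtain ⟨a, rfl⟩ := h1 ξ hξ
    rw [map_smul, h2, smul_zero])
  refine ⟨F, c, r, hF, hc, hr, hk₀, hFY, ?_⟩
  filter_upwards [hθc₁, hcc] with q h1 h2 ξ
  rw [h1, h2]

/-- Near `p`, `θ = ρ (du - v dx)` with smooth functions and `ρ` nowhere zero. -/
structure DarbouxAt (θ : E → E →L[ℝ] ℝ) (p : E) (x u v ρ : E → ℝ) : Prop where
  smooth_x : SmoothNear x p
  smooth_u : SmoothNear u p
  smooth_v : SmoothNear v p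
  smooth_rho : SmoothNear ρ p
  rho_ne : ρ p ≠ 0
  eq : ∀ᶠ q in 𝓝 p, ∀ ξ, θ q ξ = ρ q * (fderiv ℝ u q ξ - v q * fderiv ℝ x q ξ)

theorem fderiv_comp_apply {G : Type*} [NormedAddCommGroup G] [NormedSpace ℝ G] {F : E → K}
    {f : K → G} {p : E} (hF : SmoothNear F p) (hf : SmoothNear f (F p)) :
    ∀ᶠ q in 𝓝 p, ∀ ξ, fderiv ℝ (fun z => f (F z)) q ξ = fderiv ℝ f (F q) (fderiv ℝ F q ξ) := by
  filter_upwards [hF.eventually, hF.continuousAt.eventually hf.eventually] with q h1 h2 ξ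
  rw [show fderiv ℝ (fun z => f (F z)) q = (fderiv ℝ f (F q)).comp (fderiv ℝ F q) from
    (h2.differentiableAt.hasFDerivAt.comp q h1.differentiableAt.hasFDerivAt).fderiv]
  rfl

/-- Normal forms found on the space of characteristics pull back, the factor `r` being absorbed into
the new ρ. -/
theorem DarbouxAt.comp {c : K → K →L[ℝ] ℝ} {x u v ρ : K → ℝ} {F : E → K} {r : E → ℝ} {p : E}
    {θ : E → E →L[ℝ] ℝ} (h : DarbouxAt c (F p) x u v ρ) (hF : SmoothNear F p)
    (hr : SmoothNear r p) (hrp : r p ≠ 0)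
    (hθ : ∀ᶠ q in 𝓝 p, ∀ ξ, θ q ξ = r q * c (F q) (fderiv ℝ F q ξ)) :
    DarbouxAt θ p (fun q => x (F q)) (fun q => u (F q)) (fun q => v (F q))
      (fun q => r q * ρ (F q)) where
  smooth_x := h.smooth_x.comp hF
  smooth_u := h.smooth_u.comp hF
  smooth_v := h.smooth_v.comp hF
  smooth_rho := hr.mul (h.smooth_rho.comp hF)
  rho_ne := mul_ne_zero hrp h.rho_ne
  eq := by
    filter_upwards [hθ, hF.continuousAt.eventually h.eq, fderiv_comp_apply hF h.smooth_x,
      fderiv_comp_apply hF h.smooth_u] with q h1 h2 h3 h4 ξ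
    rw [h1, h2, h3, h4]
    ring

/-- From d(du − v dx) = dx ∧ dv; the term with dρ vanishes on the kernel of `θ`. -/
theorem DarbouxAt.dForm_eq {θ : E → E →L[ℝ] ℝ} {p : E} {x u v ρ : E → ℝ}
    (h : DarbouxAt θ p x u v ρ) {a b : E} (ha : θ p a = 0) (hb : θ p b = 0) :
    dForm θ p a b = ρ p * (fderiv ℝ x p a * fderiv ℝ v p b - fderiv ℝ x p b * fderiv ℝ v p a) := by
  have hFd : ∀ᶠ q in 𝓝 p, ∀ ξ, fderiv ℝ (fun q => (u q, x q)) q ξ =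
      (fderiv ℝ u q ξ, fderiv ℝ x q ξ) := by
    filter_upwards [h.smooth_u.eventually, h.smooth_x.eventually] with q h1 h2 ξ
    rw [(h1.differentiableAt.hasFDerivAt.prodMk h2.differentiableAt.hasFDerivAt).fderiv]
    rfl
  let c : E → ℝ × ℝ →L[ℝ] ℝ := fun q => .fst ℝ ℝ ℝ - v q • .snd ℝ ℝ ℝ
  have hc : SmoothNear c p := (SmoothNear.const _ p).sub (h.smooth_v.smul (.const _ p))
  have hcd : ∀ ξ k, fderiv ℝ c p ξ k = -(fderiv ℝ v p ξ * k.2) := by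
    intro ξ k
    have : HasFDerivAt c _ p := (hasFDerivAt_const (ContinuousLinearMap.fst ℝ ℝ ℝ) p).sub
      (h.smooth_v.differentiableAt.hasFDerivAt.smul_const (ContinuousLinearMap.snd ℝ ℝ ℝ))
    rw [this.fderiv]
    simp
  have h2 := dForm_of_factor (θ := θ) (F := fun q => (u q, x q)) (c := c)
    (h.smooth_u.prodMk h.smooth_x) hc h.smooth_rho h.rho_ne (by
      filter_upwards [h.eq, hFd] with q h1 h2 ξ
      rw [h1, h2]
      simp [c]) ha hb
  rw [h2, hcd, hcd, hFd.self_of_nhds, hFd.self_of_nhds]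
  ring

theorem fderiv_pi_apply {ι : Type*} [Fintype ι] {F : E → ι → ℝ} {p : E} (hF : SmoothNear F p)
    (i : ι) (ξ : E) : fderiv ℝ (fun q => F q i) p ξ = fderiv ℝ F p ξ i := by
  rw [show fderiv ℝ (fun q => F q i) p = (ContinuousLinearMap.proj i).comp (fderiv ℝ F p) from
    ((ContinuousLinearMap.proj (R := ℝ) (φ := fun _ => ℝ) i).hasFDerivAt.comp p
      hF.differentiableAt.hasFDerivAt).fderiv]
  rfl

/-- Every nonvanishing 1-form in dimension three is `ρ (du - v dx)`. -/
theorem exists_darboux_three (hdim : Module.finrank ℝ E = 3) {θ : E → E →L[ℝ] ℝ} {p : E}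
    (hθ : SmoothNear θ p) (hθp : θ p ≠ 0) : ∃ x u v ρ, DarbouxAt θ p x u v ρ := by
  obtain ⟨e, he⟩ : ∃ e, θ p e ≠ 0 := by
    by_contra! hcon
    exact hθp (ContinuousLinearMap.ext hcon)
  obtain ⟨a, ha, ha0⟩ : ∃ a, θ p a = 0 ∧ a ≠ 0 := by
    have h1 := finrank_ker_of_surjective (T := θ p) fun y => ⟨(y / θ p e) • e, by
      simp [div_mul_cancel₀ _ he]⟩
    have h2 : 0 < Module.finrank ℝ (LinearMap.ker (θ p).toLinearMap) := by simp at h1; omega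
    obtain ⟨a, ha⟩ := Module.finrank_pos_iff_exists_ne_zero.1 h2
    exact ⟨a, a.2, fun h => ha (Subtype.ext h)⟩
  -- A constant vector is corrected along `e` so as to remain in the kernel of `θ`. By
  -- `exists_factor`, `θ` is then a combination of the differentials of the two first integrals of
  -- `V`.
  let V : E → E := fun q => a - (θ q a / θ q e) • e
  have hθe : SmoothNear (fun q => θ q e) p := hθ.clm_apply (.const e p)
  have hV : SmoothNear V p :=
    (SmoothNear.const a p).sub (((hθ.clm_apply (.const a p)).div hθe he).smul (.const e p))
  have hVp : V p ≠ 0 := by simpa [V, ha] using ha0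
  have hθV : ∀ᶠ q in 𝓝 p, θ q (V q) = 0 := by
    filter_upwards [hθe.continuousAt.eventually_ne he] with q hq
    simp [V, div_mul_cancel₀ _ hq]
  obtain ⟨F, hF, hFs, hFV⟩ := exists_firstIntegrals (n := 2) hdim hV hVp
  obtain ⟨c, hc, hθc⟩ := exists_factor hθ hF hFs (by
    filter_upwards [eventually_surjective hF.fderiv.continuousAt hFs,
      hV.continuousAt.eventually_ne hVp, hFV, hθV] with q h1 h2 h3 h4 ξ hξ
    obtain ⟨t, rfl⟩ := exists_smul_of_map_eq_zero h1 h2 h3 (by simpa using hdim) hξ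
    rw [map_smul, h4, smul_zero])
  have hdec : ∀ i j : Fin 2, i ≠ j → ∀ k : Fin 2 → ℝ,
      k = k i • Pi.single i 1 + k j • Pi.single j 1 := by
    intro i j hij k
    ext l
    fin_cases i <;> fin_cases j <;> fin_cases l <;> simp at hij ⊢
  -- A coefficient nonzero at `p` becomes ρ. Its first integral becomes u, the other one x, and
  -- minus the ratio of the coefficients v.
  obtain ⟨i, j, hij, hi⟩ : ∃ i j : Fin 2, i ≠ j ∧ c p (Pi.single i 1) ≠ 0 := by
    by_contra! hcon
    refine hθp (ContinuousLinearMap.ext fun ξ => ?_)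
    rw [hθc.self_of_nhds, hdec 0 1 (by simp) (fderiv ℝ F p ξ), map_add, map_smul, map_smul,
      hcon 0 1 (by simp), hcon 1 0 (by simp)]
    simp
  have hci : SmoothNear (fun q => c q (Pi.single i 1)) p := hc.clm_apply (.const _ p)
  have hcj : SmoothNear (fun q => c q (Pi.single j 1)) p := hc.clm_apply (.const _ p)
  refine ⟨fun q => F q j, fun q => F q i, fun q => -(c q (Pi.single j 1) / c q (Pi.single i 1)),
    fun q => c q (Pi.single i 1), hF.apply j, hF.apply i, (hcj.div hci hi).neg, hci, hi, ?_⟩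
  filter_upwards [hθc, hF.eventually, hci.continuousAt.eventually_ne hi] with q h1 h2 h3 ξ
  have hcomp : ∀ l, fderiv ℝ (fun q => F q l) q ξ = fderiv ℝ F q ξ l := fun l =>
    fderiv_pi_apply h2 l ξ
  rw [h1, hdec i j hij (fderiv ℝ F q ξ), map_add, map_smul, map_smul, hcomp, hcomp]
  simp only [smul_eq_mul]
  field_simp
  ring

end Forms

/-! ### Darboux normal forms in dimensions four and five. -/

section DarbouxFive

universe u
variable {E : Type u} [NormedAddCommGroup E] [NormedSpace ℝ E] [FiniteDimensional ℝ E]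

theorem surjective_of_apply_ne_zero {K : Type*} [NormedAddCommGroup K] [NormedSpace ℝ K]
    {T : K →L[ℝ] ℝ} {e : K} (h : T e ≠ 0) : Function.Surjective T :=
  fun y => ⟨(y / T e) • e, by simp [div_mul_cancel₀ _ h]⟩

/-- In dimension four a 1-form has a Cauchy characteristic field wherever it is not integrable. -/
theorem exists_cauchy_field (hdim : Module.finrank ℝ E = 4) {θ : E → E →L[ℝ] ℝ} {p a₀ b₀ : E}
    (hθ : SmoothNear θ p) (hθp : θ p ≠ 0) (ha₀ : θ p a₀ = 0) (hb₀ : θ p b₀ = 0)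
    (hab : dForm θ p a₀ b₀ ≠ 0) :
    ∃ Y : E → E, SmoothNear Y p ∧ Y p ≠ 0 ∧ (∀ᶠ q in 𝓝 p, θ q (Y q) = 0) ∧
      ∀ᶠ q in 𝓝 p, ∀ ξ, θ q ξ = 0 → dForm θ q (Y q) ξ = 0 := by
  obtain ⟨e, he⟩ : ∃ e, θ p e ≠ 0 := by
    by_contra! hcon
    exact hθp (ContinuousLinearMap.ext hcon)
  obtain ⟨m₀, hm₀, hm₀s⟩ : ∃ m₀, θ p m₀ = 0 ∧ m₀ ∉ Submodule.span ℝ {a₀, b₀} := by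
    by_contra! hcon
    have h1 := finrank_ker_of_surjective (surjective_of_apply_ne_zero he)
    have h2 : LinearMap.ker (θ p).toLinearMap ≤ Submodule.span ℝ {a₀, b₀} := fun m hm => hcon m hm
    have h3 := Submodule.finrank_mono h2
    classical
    have h4 : Module.finrank ℝ (Submodule.span ℝ {a₀, b₀}) ≤ 2 := by
      have := finrank_span_finset_le_card (R := ℝ) ({a₀, b₀} : Finset E)
      rw [Finset.coe_pair] at this
      exact this.trans Finset.card_le_two
    rw [Module.finrank_self, hdim] at h1
    omega
  have hθe : SmoothNear (fun q => θ q e) p := hθ.clm_apply (.const e p)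
  -- Projection to the kernel of `θ q` along `e`; it carries a basis of the kernel at `p` to bases
  -- of the nearby kernels.
  let pr : E → E → E := fun x q => x - (θ q x / θ q e) • e
  have hpr : ∀ x, SmoothNear (pr x) p := fun x =>
    (SmoothNear.const x p).sub (((hθ.clm_apply (.const x p)).div hθe he).smul (.const e p))
  have hprθ : ∀ᶠ q in 𝓝 p, ∀ x, θ q (pr x q) = 0 := by
    filter_upwards [hθe.continuousAt.eventually_ne he] with q hq x
    simp [pr, div_mul_cancel₀ _ hq]
  have hprp : ∀ x, θ p x = 0 → pr x p = x := fun x hx => by simp [pr, hx]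
  let w : Fin 3 → E := ![a₀, b₀, m₀]
  have hwθ : ∀ i, θ p (w i) = 0 := by
    intro i; fin_cases i
    exacts [ha₀, hb₀, hm₀]
  have hli : LinearIndependent ℝ w := by
    rw [Fintype.linearIndependent_iff]
    intro g hg
    rw [Fin.sum_univ_three] at hg
    change g 0 • a₀ + g 1 • b₀ + g 2 • m₀ = 0 at hg
    have h2 : g 2 = 0 := by
      by_contra h2
      refine hm₀s (Submodule.mem_span_pair.2 ⟨-(g 0 / g 2), -(g 1 / g 2), ?_⟩)
      have h3 : m₀ = (g 2)⁻¹ • (g 2 • m₀) := by rw [smul_smul, inv_mul_cancel₀ h2, one_smul]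
      have h4 : g 2 • m₀ = -(g 0 • a₀) - g 1 • b₀ := by
        rw [← sub_eq_zero, ← hg]; abel
      rw [h3, h4, smul_sub, smul_neg, smul_smul, smul_smul, div_eq_inv_mul, div_eq_inv_mul,
        neg_smul, neg_smul, sub_eq_add_neg]
    rw [h2, zero_smul, add_zero] at hg
    have h0 : g 0 = 0 := by
      have := congrArg (fun v => dForm θ p v b₀) hg
      simpa [hab] using this
    have h1 : g 1 = 0 := by
      have := congrArg (fun v => dForm θ p a₀ v) hg
      simpa [hab] using this
    intro i; fin_cases i
    exacts [h0, h1, h2]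
  have hli' : ∀ᶠ q in 𝓝 p, LinearIndependent ℝ fun i => pr (w i) q :=
    eventually_linearIndependent (fun i => hpr (w i)) (by
      simpa only [hprp _ (hwθ _)] using hli)
  let β : Fin 3 → Fin 3 → E → ℝ := fun i j q => dForm θ q (pr (w i) q) (pr (w j) q)
  have hβ : ∀ i j, SmoothNear (β i j) p := fun i j => hθ.dForm_apply (hpr _) (hpr _)
  have hβself : ∀ i q, β i i q = 0 := fun i q => dForm_self _ _ _
  have hβswap : ∀ i j q, β i j q = -β j i q := fun i j q => dForm_swap _ _ _ _
  -- An alternating form on a three-dimensional space is degenerate; this cross product formula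
  -- gives a null vector. Its last coefficient at `p` is dθ(a₀, b₀), so it is nonzero there.
  let Y : E → E := fun q => β 1 2 q • pr (w 0) q + β 2 0 q • pr (w 1) q + β 0 1 q • pr (w 2) q
  have hY0 : ∀ᶠ q in 𝓝 p, ∀ j, dForm θ q (Y q) (pr (w j) q) = 0 := by
    refine .of_forall fun q j => ?_
    have : dForm θ q (Y q) (pr (w j) q) =
        β 1 2 q * β 0 j q + β 2 0 q * β 1 j q + β 0 1 q * β 2 j q := by simp [Y, β]
    rw [this]
    fin_cases j
    · change β 1 2 q * β 0 0 q + β 2 0 q * β 1 0 q + β 0 1 q * β 2 0 q = 0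
      rw [hβself, hβswap 1 0]; ring
    · change β 1 2 q * β 0 1 q + β 2 0 q * β 1 1 q + β 0 1 q * β 2 1 q = 0
      rw [hβself, hβswap 2 1]; ring
    · change β 1 2 q * β 0 2 q + β 2 0 q * β 1 2 q + β 0 1 q * β 2 2 q = 0
      rw [hβself, hβswap 0 2]; ring
  refine ⟨Y, (((hβ 1 2).smul (hpr _)).add ((hβ 2 0).smul (hpr _))).add ((hβ 0 1).smul (hpr _)),
    fun hYp => ?_, ?_, ?_⟩
  · have h1 := Fintype.linearIndependent_iff.1 hli'.self_of_nhds ![β 1 2 p, β 2 0 p, β 0 1 p] (by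
      rw [Fin.sum_univ_three]
      exact hYp) 2
    have h2 : β 0 1 p = dForm θ p a₀ b₀ := by
      simp only [β]
      rw [hprp _ (hwθ 0), hprp _ (hwθ 1)]; rfl
    exact hab (h2 ▸ h1)
  · filter_upwards [hprθ] with q hq
    simp [Y, hq]
  · filter_upwards [hprθ, hli', hθe.continuousAt.eventually_ne he, hY0] with q h1 h2 h3 h4 ξ hξ
    have hm := mem_span_of_map_eq_zero (surjective_of_apply_ne_zero h3) h2 (fun i => h1 (w i))
      (by simpa using hdim) hξ
    refine Submodule.span_induction (p := fun v _ => dForm θ q (Y q) v = 0) ?_ (map_zero _)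
      (fun x y _ _ hx hy => by rw [map_add, hx, hy, add_zero])
      (fun c x _ hx => by rw [map_smul, hx, smul_zero]) hm
    rintro _ ⟨j, rfl⟩
    exact h4 j

theorem ne_zero_of_descent {K : Type*} [NormedAddCommGroup K] [NormedSpace ℝ K]
    {θ : E →L[ℝ] ℝ} {c : K →L[ℝ] ℝ} {T : E →L[ℝ] K} {r : ℝ} (hθ : θ ≠ 0)
    (h : ∀ ξ, θ ξ = r * c (T ξ)) : c ≠ 0 := by
  rintro rfl
  exact hθ (ContinuousLinearMap.ext fun ξ => by simp [h])

/-- Every 1-form in dimension four is `ρ (du - v dx)` wherever it is not integrable. -/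
theorem exists_darboux_four (hdim : Module.finrank ℝ E = 4) {θ : E → E →L[ℝ] ℝ} {p a b : E}
    (hθ : SmoothNear θ p) (hθp : θ p ≠ 0) (ha : θ p a = 0) (hb : θ p b = 0)
    (hab : dForm θ p a b ≠ 0) : ∃ x u v ρ, DarbouxAt θ p x u v ρ := by
  obtain ⟨Y, hY, hYp, hθY, hC⟩ := exists_cauchy_field hdim hθ hθp ha hb hab
  obtain ⟨F, c, r, hF, hc, hr, hrp, -, hθc⟩ :=
    exists_cauchy_descent (n := 3) hdim hθ hY hYp hθp hθY hC
  obtain ⟨x, u, v, ρ, hD⟩ := exists_darboux_three (by simp) hc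
    (ne_zero_of_descent hθp hθc.self_of_nhds)
  exact ⟨_, _, _, _, hD.comp hF hr hrp hθc⟩

/-- In dimension five, a 1-form with a Cauchy characteristic field `Y` is `ρ (du - v dx)` with first
integrals `x`, `u`, `v` of `Y`, wherever it is not integrable. -/
theorem exists_darboux_five (hdim : Module.finrank ℝ E = 5) {θ : E → E →L[ℝ] ℝ} {Y : E → E}
    {p a b : E} (hθ : SmoothNear θ p) (hY : SmoothNear Y p) (hYp : Y p ≠ 0) (hθp : θ p ≠ 0)
    (hθY : ∀ᶠ q in 𝓝 p, θ q (Y q) = 0)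
    (hC : ∀ᶠ q in 𝓝 p, ∀ ξ, θ q ξ = 0 → dForm θ q (Y q) ξ = 0)
    (ha : θ p a = 0) (hb : θ p b = 0) (hab : dForm θ p a b ≠ 0) :
    ∃ x u v ρ, DarbouxAt θ p x u v ρ ∧ ∀ᶠ q in 𝓝 p,
      fderiv ℝ x q (Y q) = 0 ∧ fderiv ℝ u q (Y q) = 0 ∧ fderiv ℝ v q (Y q) = 0 := by
  obtain ⟨F, c, r, hF, hc, hr, hrp, hFY, hθc⟩ :=
    exists_cauchy_descent (n := 4) hdim hθ hY hYp hθp hθY hC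
  have hz : ∀ {ξ}, θ p ξ = 0 → c (F p) (fderiv ℝ F p ξ) = 0 := by
    intro ξ hξ
    rw [hθc.self_of_nhds] at hξ
    exact (mul_eq_zero.1 hξ).resolve_left hrp
  obtain ⟨x, u, v, ρ, hD⟩ := exists_darboux_four (by simp) hc
    (ne_zero_of_descent hθp hθc.self_of_nhds) (hz ha) (hz hb) (by
      rw [dForm_of_descent hF hc hr hrp hθc ha hb] at hab
      exact right_ne_zero_of_mul hab)
  refine ⟨_, _, _, _, hD.comp hF hr hrp hθc, ?_⟩
  filter_upwards [hFY, fderiv_comp_apply hF hD.smooth_x, fderiv_comp_apply hF hD.smooth_u,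
    fderiv_comp_apply hF hD.smooth_v] with q h1 h2 h3 h4
  rw [h2, h3, h4, h1]
  simp

/-- The Legendre transformation, du − v dx = d(u − vx) + x dv. It makes v the independent variable
when x is not usable as one. -/
theorem DarbouxAt.legendre {θ : E → E →L[ℝ] ℝ} {p : E} {x u v ρ : E → ℝ}
    (h : DarbouxAt θ p x u v ρ) :
    DarbouxAt θ p v (fun q => u q - v q * x q) (fun q => -x q) ρ where
  smooth_x := h.smooth_v
  smooth_u := h.smooth_u.sub (h.smooth_v.mul h.smooth_x)
  smooth_v := h.smooth_x.neg
  smooth_rho := h.smooth_rho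
  rho_ne := h.rho_ne
  eq := by
    filter_upwards [h.eq, h.smooth_x.eventually, h.smooth_u.eventually, h.smooth_v.eventually]
      with q h1 h2 h3 h4 ξ
    rw [h1, show fderiv ℝ (fun q => u q - v q * x q) q = _ from
      (h3.differentiableAt.hasFDerivAt.sub
        (h4.differentiableAt.hasFDerivAt.mul h2.differentiableAt.hasFDerivAt)).fderiv]
    simp
    ring_nf
    simp

end DarbouxFive

/-! ### Goursat's form with a Cauchy characteristic in the distribution. -/

section Goursat

universe u
variable {E : Type u} [NormedAddCommGroup E] [NormedSpace ℝ E] [FiniteDimensional ℝ E]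

/-- The smooth dual coframe of a smooth frame. -/
theorem exists_coframe {ι : Type*} [Fintype ι] [DecidableEq ι] {X : ι → E → E} {p : E}
    (hX : ∀ i, SmoothNear (X i) p) (hli : LinearIndependent ℝ fun i => X i p)
    (hdim : Fintype.card ι = Module.finrank ℝ E) :
    ∃ ϑ : ι → E → E →L[ℝ] ℝ, (∀ i, SmoothNear (ϑ i) p) ∧ ∀ᶠ q in 𝓝 p,
      (∀ i j, ϑ i q (X j q) = (Pi.single j 1 : ι → ℝ) i) ∧ ∀ ξ, ξ = ∑ i, ϑ i q ξ • X i q := by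
  have : CompleteSpace E := FiniteDimensional.complete ℝ E
  let B : E → (ι → ℝ) →L[ℝ] E := fun q =>
    ∑ i, (ContinuousLinearMap.proj i : (ι → ℝ) →L[ℝ] ℝ).smulRight (X i q)
  have hBapp : ∀ q d, B q d = ∑ i, d i • X i q := fun q d => by simp [B]
  have hB : SmoothNear B p := SmoothNear.sum fun i =>
    (hX i).clm_comp (ContinuousLinearMap.smulRightL ℝ (ι → ℝ) E
      (ContinuousLinearMap.proj i : (ι → ℝ) →L[ℝ] ℝ))
  have hBi : ∀ᶠ q in 𝓝 p, (B q).IsInvertible := by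
    filter_upwards [eventually_linearIndependent hX hli] with q hq
    refine isInvertible_of_injective (by simpa using hdim) fun d hd => ?_
    rw [hBapp] at hd
    exact funext (Fintype.linearIndependent_iff.1 hq d hd)
  refine ⟨fun i q => (ContinuousLinearMap.proj i).comp (B q).inverse,
    fun i => (SmoothNear.const _ p).clm_compose (hB.inverse hBi.self_of_nhds), ?_⟩
  filter_upwards [hBi] with q hq
  refine ⟨fun i j => ?_, fun ξ => ?_⟩
  · have : X j q = B q (Pi.single j 1) := by simp [hBapp, Pi.single_apply]
    rw [this, ContinuousLinearMap.comp_apply, hq.inverse_apply_self]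
    rfl
  · have := hq.self_apply_inverse ξ
    rw [hBapp] at this
    exact this.symm

/-- The term dt ∧ θ₂ is what turns the Cauchy condition on θ₁ + tθ₂ into a differential equation for
`t`. -/
theorem dForm_add_smul {θ₁ θ₂ : E → E →L[ℝ] ℝ} {t : E → ℝ} {p : E} (h₁ : SmoothNear θ₁ p)
    (h₂ : SmoothNear θ₂ p) (ht : SmoothNear t p) (a b : E) :
    dForm (fun q => θ₁ q + t q • θ₂ q) p a b = dForm θ₁ p a b + t p * dForm θ₂ p a b +
      (fderiv ℝ t p a * θ₂ p b - fderiv ℝ t p b * θ₂ p a) := by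
  rw [dForm_apply, show fderiv ℝ (fun q => θ₁ q + t q • θ₂ q) p = _ from
    (h₁.differentiableAt.hasFDerivAt.add
      (ht.differentiableAt.hasFDerivAt.smul h₂.differentiableAt.hasFDerivAt)).fderiv]
  simp [dForm_apply]
  ring

theorem fderiv_smul_apply {a : E → ℝ} {X : E → E} {p : E} (ha : SmoothNear a p)
    (hX : SmoothNear X p) (ξ : E) :
    fderiv ℝ (fun q => a q • X q) p ξ = a p • fderiv ℝ X p ξ + fderiv ℝ a p ξ • X p := by
  rw [show fderiv ℝ (fun q => a q • X q) p = _ from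
    (ha.differentiableAt.hasFDerivAt.smul hX.differentiableAt.hasFDerivAt).fderiv]
  rfl

/-- Goursat's theorem on 1-forms: a rank two distribution `⟨X₁, X₂⟩` in dimension five with
`[X₁, [X₁, X₂]]` outside its derived distribution is annihilated, together with its derived
distribution, by a nonintegrable form having a Cauchy characteristic field in `⟨X₁, X₂⟩`. -/
theorem exists_goursat_form (hdim : Module.finrank ℝ E = 5) {X₁ X₂ : E → E} {p : E}
    (hX₁ : SmoothNear X₁ p) (hX₂ : SmoothNear X₂ p)
    (hli : LinearIndependent ℝ ![X₁ p, X₂ p, VectorField.lieBracket ℝ X₁ X₂ p])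
    (hG : VectorField.lieBracket ℝ X₁ (VectorField.lieBracket ℝ X₁ X₂) p ∉
      Submodule.span ℝ (Set.range ![X₁ p, X₂ p, VectorField.lieBracket ℝ X₁ X₂ p])) :
    ∃ (θ : E → E →L[ℝ] ℝ) (a b : E → ℝ), SmoothNear θ p ∧ SmoothNear a p ∧ SmoothNear b p ∧
      a p ≠ 0 ∧ θ p ≠ 0 ∧ (∀ᶠ q in 𝓝 p, θ q (X₁ q) = 0) ∧ (∀ᶠ q in 𝓝 p, θ q (X₂ q) = 0) ∧
      (∀ᶠ q in 𝓝 p, ∀ ξ, θ q ξ = 0 → dForm θ q (b q • X₁ q - a q • X₂ q) ξ = 0) ∧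
      dForm θ p (X₁ p) (VectorField.lieBracket ℝ (fun q => b q • X₁ q - a q • X₂ q) X₁ p) ≠ 0 := by
  set W := VectorField.lieBracket ℝ X₁ X₂ with hW
  have hWs : SmoothNear W p := hX₁.lieBracket hX₂
  set e₄ := VectorField.lieBracket ℝ X₁ W p with he₄
  have hli4 : LinearIndependent ℝ (Fin.snoc ![X₁ p, X₂ p, W p] e₄ : Fin 4 → E) :=
    linearIndependent_finSnoc.2 ⟨hli, hG⟩
  obtain ⟨e₅, he₅⟩ : ∃ e₅, e₅ ∉ Submodule.span ℝ
      (Set.range (Fin.snoc ![X₁ p, X₂ p, W p] e₄ : Fin 4 → E)) := by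
    by_contra! hcon
    have h1 := finrank_span_eq_card hli4
    rw [Submodule.eq_top_iff'.2 hcon, finrank_top, hdim] at h1
    simp at h1
  have hli5 : LinearIndependent ℝ
      (Fin.snoc (Fin.snoc ![X₁ p, X₂ p, W p] e₄ : Fin 4 → E) e₅ : Fin 5 → E) :=
    linearIndependent_finSnoc.2 ⟨hli4, he₅⟩
  -- The value of [X₁, W] at `p` and a complementary vector are extended as constant fields: these
  -- only complete the frame and enter no bracket. The last two dual forms annihilate X₁, X₂ and W.
  let X : Fin 5 → E → E := ![X₁, X₂, W, fun _ => e₄, fun _ => e₅]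
  have hX : ∀ i, SmoothNear (X i) p := by
    intro i
    fin_cases i
    exacts [hX₁, hX₂, hWs, .const _ p, .const _ p]
  have hXp : (fun i => X i p) = Fin.snoc (Fin.snoc ![X₁ p, X₂ p, W p] e₄ : Fin 4 → E) e₅ := by
    funext i
    fin_cases i <;> rfl
  obtain ⟨ϑ, hϑ, hϑX⟩ := exists_coframe hX (by rw [hXp]; exact hli5) (by simp [hdim])
  set θ₁ := ϑ 3
  set θ₂ := ϑ 4
  have h1v : ∀ᶠ q in 𝓝 p, θ₁ q (X₁ q) = 0 ∧ θ₁ q (X₂ q) = 0 ∧ θ₁ q (W q) = 0 ∧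
      θ₁ q e₄ = 1 ∧ θ₁ q e₅ = 0 := by
    filter_upwards [hϑX] with q hq
    refine ⟨(hq.1 3 0).trans ?_, (hq.1 3 1).trans ?_, (hq.1 3 2).trans ?_, (hq.1 3 3).trans ?_,
      (hq.1 3 4).trans ?_⟩ <;> simp
  have h2v : ∀ᶠ q in 𝓝 p, θ₂ q (X₁ q) = 0 ∧ θ₂ q (X₂ q) = 0 ∧ θ₂ q (W q) = 0 ∧
      θ₂ q e₄ = 0 ∧ θ₂ q e₅ = 1 := by
    filter_upwards [hϑX] with q hq
    refine ⟨(hq.1 4 0).trans ?_, (hq.1 4 1).trans ?_, (hq.1 4 2).trans ?_, (hq.1 4 3).trans ?_,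
      (hq.1 4 4).trans ?_⟩ <;> simp
  have hlift : ∀ {f : E → ℝ}, SmoothNear f p → SmoothNear (fun z : E × ℝ => f z.1) (p, (0 : ℝ)) :=
    fun hf => SmoothNear.comp (f := fun z : E × ℝ => z.1) hf (.clm (.fst ℝ E ℝ) _)
  have hliftE : ∀ {f : E → E}, SmoothNear f p → SmoothNear (fun z : E × ℝ => f z.1) (p, (0 : ℝ)) :=
    fun hf => SmoothNear.comp (f := fun z : E × ℝ => z.1) hf (.clm (.fst ℝ E ℝ) _)
  have hsnd : SmoothNear (fun z : E × ℝ => z.2) (p, (0 : ℝ)) := .clm (.snd ℝ E ℝ) _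
  -- The part of d(θ₁ + tθ₂) free of dt, with `t` an independent variable. The omitted terms carry a
  -- factor θ₂, so they vanish on pairs taken from X₁, X₂, W.
  let D : E × ℝ → E → E → ℝ := fun z x y => dForm θ₁ z.1 x y + z.2 * dForm θ₂ z.1 x y
  have hD : ∀ {x y : E → E}, SmoothNear x p → SmoothNear y p →
      SmoothNear (fun z => D z (x z.1) (y z.1)) (p, 0) := fun hx hy =>
    (hlift ((hϑ 3).dForm_apply hx hy)).add (hsnd.mul (hlift ((hϑ 4).dForm_apply hx hy)))
  let A : E × ℝ → ℝ := fun z => D z (X₁ z.1) (W z.1)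
  let B : E × ℝ → ℝ := fun z => D z (X₂ z.1) (W z.1)
  have hA : SmoothNear A (p, 0) := hD hX₁ hWs
  have hB : SmoothNear B (p, 0) := hD hX₂ hWs
  -- This combination pairs to zero with X₁, X₂ and W: dθ(X₁, X₂) = 0, and the coefficients are
  -- chosen to cancel against W.
  let Y : E × ℝ → E := fun z => B z • X₁ z.1 - A z • X₂ z.1
  have hY : SmoothNear Y (p, 0) := (hB.smul (hliftE hX₁)).sub (hA.smul (hliftE hX₂))
  -- The kernel of `θ` is completed by e₅ − t e₄. Since θ₂(e₅ − t e₄) = 1 and θ₂(Y) = 0, one has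
  -- dθ(Y, e₅ − t e₄) = D(Y, e₅ − t e₄) + dt(Y), so the last Cauchy condition reads dt(Y) = g.
  let g : E × ℝ → ℝ := fun z => -(D z (Y z) e₅ - z.2 * D z (Y z) e₄)
  have hDY : ∀ z y, D z (Y z) y = B z * D z (X₁ z.1) y - A z * D z (X₂ z.1) y := by
    intro z y
    simp only [D, Y, map_sub, map_smul, sub_apply, smul_apply, smul_eq_mul]
    ring
  have hg : SmoothNear g (p, 0) := by
    simp only [g, hDY]
    exact (((hB.mul (hD hX₁ (.const e₅ p))).sub (hA.mul (hD hX₂ (.const e₅ p)))).sub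
      (hsnd.mul ((hB.mul (hD hX₁ (.const e₄ p))).sub (hA.mul (hD hX₂ (.const e₄ p)))))).neg
  have hAp : A (p, 0) = -1 := by
    simp only [A, D, zero_mul, add_zero]
    rw [dForm_eq_neg_lieBracket (hϑ 3) hX₁ hWs (h1v.mono fun q h => h.1)
      (h1v.mono fun q h => h.2.2.1), ← he₄, h1v.self_of_nhds.2.2.2.1]
  have hli2 : ∀ c d : ℝ, c • X₁ p - d • X₂ p = 0 → d = 0 := by
    intro c d h
    have := Fintype.linearIndependent_iff.1 hli ![c, -d, 0] (by
      rw [Fin.sum_univ_three]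
      simpa [sub_eq_add_neg] using h) 1
    simpa using this
  have hYp : Y (p, 0) ≠ 0 := by
    intro h
    have := hli2 _ _ h
    rw [hAp] at this
    norm_num at this
  obtain ⟨t, ht, htp, htY⟩ := exists_quasilinear_solution hY hg hYp
  have hgr : SmoothNear (fun q => (q, t q)) p := (SmoothNear.id p).prodMk ht
  have hat : SmoothNear (fun q => A (q, t q)) p := SmoothNear.comp (by rwa [htp]) hgr
  have hbt : SmoothNear (fun q => B (q, t q)) p := SmoothNear.comp (by rwa [htp]) hgr
  let θ : E → E →L[ℝ] ℝ := fun q => θ₁ q + t q • θ₂ q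
  have hθ : SmoothNear θ p := (hϑ 3).add (ht.smul (hϑ 4))
  have hθv : ∀ᶠ q in 𝓝 p, θ q (X₁ q) = 0 ∧ θ q (X₂ q) = 0 ∧ θ q (W q) = 0 := by
    filter_upwards [h1v, h2v] with q h1 h2
    simp [θ, h1, h2]
  have hD12 : ∀ᶠ q in 𝓝 p, dForm θ₁ q (X₁ q) (X₂ q) = 0 ∧ dForm θ₂ q (X₁ q) (X₂ q) = 0 := by
    filter_upwards [hX₁.eventually, hX₂.eventually, (hϑ 3).eventually, (hϑ 4).eventually,
      eventually_eventually_nhds.2 h1v, eventually_eventually_nhds.2 h2v] with q k1 k2 k3 k4 k5 k6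
    rw [dForm_eq_neg_lieBracket k3 k1 k2 (k5.mono fun q h => h.1) (k5.mono fun q h => h.2.1),
      dForm_eq_neg_lieBracket k4 k1 k2 (k6.mono fun q h => h.1) (k6.mono fun q h => h.2.1),
      ← hW, k5.self_of_nhds.2.2.1, k6.self_of_nhds.2.2.1]
    simp
  refine ⟨θ, fun q => A (q, t q), fun q => B (q, t q), hθ, hat, hbt, ?_, ?_,
    hθv.mono fun q h => h.1, hθv.mono fun q h => h.2.1, ?_, ?_⟩
  · simp only [htp, hAp]; norm_num
  · intro h
    have h1 : θ p e₄ = 1 := by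
      simp [θ, htp, h1v.self_of_nhds]
    rw [h] at h1
    simp at h1
  · filter_upwards [h1v, h2v, hD12, htY, (hϑ 3).eventually, (hϑ 4).eventually, ht.eventually, hϑX]
      with q h1 h2 h3 h4 k1 k2 k3 k4 ξ hξ
    set z : E × ℝ := (q, t q) with hz
    change dForm θ q (Y z) ξ = 0
    have hdθ : ∀ x y, dForm θ q x y = D z x y +
        (fderiv ℝ t q x * θ₂ q y - fderiv ℝ t q y * θ₂ q x) := fun x y =>
      dForm_add_smul k1 k2 k3 x y
    have hθ₂Y : θ₂ q (Y z) = 0 := by simp [Y, hz, h2]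
    have hξd := k4.2 ξ
    rw [Fin.sum_univ_five] at hξd
    change ξ = ϑ 0 q ξ • X₁ q + ϑ 1 q ξ • X₂ q + ϑ 2 q ξ • W q + θ₁ q ξ • e₄ + θ₂ q ξ • e₅ at hξd
    have hθ₁ξ : θ₁ q ξ = -(t q * θ₂ q ξ) := by
      have : θ₁ q ξ + t q * θ₂ q ξ = 0 := hξ
      linarith
    have hDlin : ∀ x, D z x ξ = ϑ 0 q ξ * D z x (X₁ q) + ϑ 1 q ξ * D z x (X₂ q) +
        ϑ 2 q ξ * D z x (W q) + θ₂ q ξ * (D z x e₅ - t q * D z x e₄) := by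
      intro x
      have hgen : ∀ L : E →L[ℝ] ℝ, L ξ = ϑ 0 q ξ * L (X₁ q) + ϑ 1 q ξ * L (X₂ q) +
          ϑ 2 q ξ * L (W q) + θ₂ q ξ * (L e₅ - t q * L e₄) := by
        intro L
        conv_lhs => rw [hξd]
        simp only [map_add, map_smul, smul_eq_mul, hθ₁ξ]
        ring
      simp only [D]
      rw [hgen (dForm θ₁ z.1 x), hgen (dForm θ₂ z.1 x)]
      ring
    have hDY1 : D z (Y z) (X₁ q) = 0 := by
      rw [hDY]
      simp only [D, hz, dForm_self, dForm_swap _ q (X₂ q) (X₁ q), h3]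
      ring
    have hDY2 : D z (Y z) (X₂ q) = 0 := by
      rw [hDY]
      simp only [D, hz, dForm_self, h3]
      ring
    have hDYW : D z (Y z) (W q) = 0 := by
      rw [hDY]
      simp only [A, B, hz]
      ring
    rw [hdθ, hθ₂Y, mul_zero, sub_zero, hDlin, hDY1, hDY2, hDYW, h4]
    simp only [g, hz]
    ring
  · have hdθ : ∀ x y, dForm θ p x y = D (p, 0) x y +
        (fderiv ℝ t p x * θ₂ p y - fderiv ℝ t p y * θ₂ p x) := fun x y => by
      have := dForm_add_smul (hϑ 3) (hϑ 4) ht x y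
      rw [htp] at this
      exact this
    -- Modulo X₁ and X₂ the bracket [Y, X₁] is A·W. At `p` both A and dθ(X₁, W) equal −1, so the
    -- pairing is 1.
    have hbr : VectorField.lieBracket ℝ (fun q => B (q, t q) • X₁ q - A (q, t q) • X₂ q) X₁ p =
        A (p, t p) • W p - fderiv ℝ (fun q => B (q, t q)) p (X₁ p) • X₁ p +
          fderiv ℝ (fun q => A (q, t q)) p (X₁ p) • X₂ p := by
      have h5 : fderiv ℝ (fun q => B (q, t q) • X₁ q - A (q, t q) • X₂ q) p (X₁ p) =
          fderiv ℝ (fun q => B (q, t q) • X₁ q) p (X₁ p) -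
            fderiv ℝ (fun q => A (q, t q) • X₂ q) p (X₁ p) := by
        rw [fderiv_fun_sub (hbt.smul hX₁).differentiableAt (hat.smul hX₂).differentiableAt]
        rfl
      rw [VectorField.lieBracket, h5, fderiv_smul_apply hbt hX₁, fderiv_smul_apply hat hX₂,
        hW, VectorField.lieBracket]
      simp only [map_sub, map_smul, smul_sub]
      abel
    have h6 : dForm θ p (X₁ p) (W p) = -1 := by
      rw [hdθ, h2v.self_of_nhds.1, h2v.self_of_nhds.2.2.1, ← hAp]
      simp [A]
    have h7 : dForm θ p (X₁ p) (X₂ p) = 0 := by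
      rw [hdθ, h2v.self_of_nhds.1, h2v.self_of_nhds.2.1]
      simp [D, hD12.self_of_nhds]
    rw [hbr, map_add, map_sub, map_smul, map_smul, map_smul, h6, h7, dForm_self, htp, hAp]
    norm_num

end Goursat

/-! ### Submersions to dimension four; Goursat's projection onto J². -/

section Projections

variable {E : Type} [NormedAddCommGroup E] [NormedSpace ℝ E] [FiniteDimensional ℝ E]

/-- Near `p` the map `π` is a submersion taking the distribution `⟨X₁, X₂⟩` onto `⟨C₁, C₂⟩`. -/
structure ProjectsBy (π : E → EuclideanSpace ℝ (Fin 4)) (X₁ X₂ : E → E) (p : E)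
    (C₁ C₂ : EuclideanSpace ℝ (Fin 4) → EuclideanSpace ℝ (Fin 4)) : Prop where
  smooth : SmoothNear π p
  surj : Function.Surjective (fderiv ℝ π p)
  map_eq : ∀ᶠ q in 𝓝 p, (Submodule.span ℝ {X₁ q, X₂ q}).map (fderiv ℝ π q).toLinearMap =
    Submodule.span ℝ {C₁ (π q), C₂ (π q)}

theorem span_pair_eq_of_det_ne_zero {V : Type*} [AddCommGroup V] [Module ℝ V] {x₁ x₂ y₁ y₂ : V}
    {a b c d : ℝ} (h₁ : y₁ = a • x₁ + b • x₂) (h₂ : y₂ = c • x₁ + d • x₂)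
    (hdet : a * d - b * c ≠ 0) :
    Submodule.span ℝ {y₁, y₂} = Submodule.span ℝ {x₁, x₂} := by
  refine le_antisymm ?_ ?_
  · rw [Submodule.span_le]
    rintro _ (rfl | rfl)
    · exact Submodule.mem_span_pair.2 ⟨a, b, h₁.symm⟩
    · exact Submodule.mem_span_pair.2 ⟨c, d, h₂.symm⟩
  · rw [Submodule.span_le]
    rintro z hz
    rcases hz with rfl | rfl
    · refine Submodule.mem_span_pair.2 ⟨(a * d - b * c)⁻¹ * d, -((a * d - b * c)⁻¹ * b), ?_⟩
      rw [neg_smul, mul_smul, mul_smul, ← sub_eq_add_neg, ← smul_sub, h₁, h₂,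
        inv_smul_eq_iff₀ hdet]
      module
    · refine Submodule.mem_span_pair.2 ⟨-((a * d - b * c)⁻¹ * c), (a * d - b * c)⁻¹ * a, ?_⟩
      rw [neg_smul, mul_smul, mul_smul, neg_add_eq_sub, ← smul_sub, h₁, h₂,
        inv_smul_eq_iff₀ hdet]
      module

theorem map_span_pair {V W : Type*} [AddCommGroup V] [Module ℝ V] [AddCommGroup W] [Module ℝ W]
    (T : V →ₗ[ℝ] W) (x y : V) :
    (Submodule.span ℝ {x, y}).map T = Submodule.span ℝ {T x, T y} := by
  rw [Submodule.map_span, Set.image_pair]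

/-- By duality: a proper range is killed by a nonzero functional. Submersion checks become the
solution of linear equations for the covector `f`. -/
theorem surjective_of_forall_sum {ι : Type*} [Fintype ι] {T : E →L[ℝ] EuclideanSpace ℝ ι}
    (h : ∀ f : ι → ℝ, (∀ ξ, ∑ i, f i * T ξ i = 0) → f = 0) : Function.Surjective T := by
  classical
  by_contra hcon
  have hlt : LinearMap.range T.toLinearMap < ⊤ :=
    lt_top_iff_ne_top.2 fun ht => hcon (LinearMap.range_eq_top.1 ht)
  obtain ⟨f, hf, hle⟩ := Submodule.exists_le_ker_of_lt_top _ hlt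
  have hfy : ∀ y : EuclideanSpace ℝ ι, f y = ∑ i, f (EuclideanSpace.single i 1) * y i := by
    intro y
    conv_lhs => rw [← (EuclideanSpace.basisFun ι ℝ).sum_repr y]
    simp [mul_comm]
  have hz := h (fun i => f (EuclideanSpace.single i 1)) fun ξ => by
    rw [← hfy]
    exact hle ⟨ξ, rfl⟩
  refine hf (LinearMap.ext fun y => ?_)
  rw [hfy]
  simp [fun i => congrFun hz i]

theorem fderiv_euclidean_apply {ι : Type*} [Fintype ι] {F : E → EuclideanSpace ℝ ι} {p : E}
    (hF : SmoothNear F p) (i : ι) (ξ : E) :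
    fderiv ℝ F p ξ i = fderiv ℝ (fun q => F q i) p ξ := by
  rw [show fderiv ℝ (fun q => F q i) p = (EuclideanSpace.proj (𝕜 := ℝ) i).comp (fderiv ℝ F p) from
    ((EuclideanSpace.proj (𝕜 := ℝ) i).hasFDerivAt.comp p hF.differentiableAt.hasFDerivAt).fderiv]
  rfl

theorem SmoothNear.vec4 {x u v w : E → ℝ} {p : E} (hx : SmoothNear x p) (hu : SmoothNear u p)
    (hv : SmoothNear v p) (hw : SmoothNear w p) :
    SmoothNear (fun q => (!₂[x q, u q, v q, w q] : EuclideanSpace ℝ (Fin 4))) p := by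
  refine SmoothNear.euclidean fun i => ?_
  fin_cases i
  exacts [hx, hu, hv, hw]

theorem fderiv_vec4 {x u v w : E → ℝ} {p : E} (hx : SmoothNear x p) (hu : SmoothNear u p)
    (hv : SmoothNear v p) (hw : SmoothNear w p) (ξ : E) :
    fderiv ℝ (fun q => (!₂[x q, u q, v q, w q] : EuclideanSpace ℝ (Fin 4))) p ξ =
      !₂[fderiv ℝ x p ξ, fderiv ℝ u p ξ, fderiv ℝ v p ξ, fderiv ℝ w p ξ] := by
  ext i
  rw [fderiv_euclidean_apply (hx.vec4 hu hv hw)]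
  fin_cases i <;> rfl

theorem fderiv_div_apply {n m : E → ℝ} {p : E} (hn : SmoothNear n p) (hm : SmoothNear m p)
    (h : m p ≠ 0) (ξ : E) : fderiv ℝ (fun q => n q / m q) p ξ =
      (fderiv ℝ n p ξ * m p - n p * fderiv ℝ m p ξ) / m p ^ 2 := by
  have hd := (hasDerivAt_inv h).comp_hasFDerivAt p hm.differentiableAt.hasFDerivAt
  rw [show fderiv ℝ (fun q => n q / m q) p = _ from
    (hn.differentiableAt.hasFDerivAt.mul hd).fderiv]
  simp
  field_simp
  ring

/-- A common first integral of `Y` has its `X`-derivative differentiated along `Y` by `[Y, X]`. -/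
theorem fderiv_fderiv_apply_of_firstIntegral {f : E → ℝ} {X Y : E → E} {p : E}
    (hf : SmoothNear f p) (hX : SmoothNear X p) (hY : SmoothNear Y p)
    (h : ∀ᶠ q in 𝓝 p, fderiv ℝ f q (Y q) = 0) :
    fderiv ℝ (fun q => fderiv ℝ f q (X q)) p (Y p) =
      fderiv ℝ f p (VectorField.lieBracket ℝ Y X p) := by
  have h1 : (fun q => fderiv ℝ f q (Y q)) =ᶠ[𝓝 p] fun _ => 0 := h
  rw [fderiv_apply_lieBracket hf hY hX, h1.fderiv_eq]
  simp

/-- Goursat: a rank two distribution `⟨X₁, X₂⟩` in dimension five with `[X₁, [X₁, X₂]]` outside its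
derived distribution projects locally onto the Cartan distribution of `J²`. -/
theorem exists_projectsBy_cartan (hdim : Module.finrank ℝ E = 5) {X₁ X₂ : E → E} {p : E}
    (hX₁ : SmoothNear X₁ p) (hX₂ : SmoothNear X₂ p)
    (hli : LinearIndependent ℝ ![X₁ p, X₂ p, VectorField.lieBracket ℝ X₁ X₂ p])
    (hG : VectorField.lieBracket ℝ X₁ (VectorField.lieBracket ℝ X₁ X₂) p ∉
      Submodule.span ℝ (Set.range ![X₁ p, X₂ p, VectorField.lieBracket ℝ X₁ X₂ p])) :
    ∃ π, ProjectsBy π X₁ X₂ p (fun y => !₂[1, y 2, y 3, 0]) (fun _ => !₂[0, 0, 0, 1]) := by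
  obtain ⟨θ, a, b, hθ, ha, hb, hap, hθp, hθ₁, hθ₂, hC, hN⟩ :=
    exists_goursat_form hdim hX₁ hX₂ hli hG
  set Y : E → E := fun q => b q • X₁ q - a q • X₂ q with hYdef
  have hY : SmoothNear Y p := (hb.smul hX₁).sub (ha.smul hX₂)
  have hθY : ∀ᶠ q in 𝓝 p, θ q (Y q) = 0 := by
    filter_upwards [hθ₁, hθ₂] with q h1 h2
    simp [Y, h1, h2]
  have hYp : Y p ≠ 0 := by
    intro h
    have := Fintype.linearIndependent_iff.1 hli ![b p, -a p, 0] (by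
      rw [Fin.sum_univ_three]
      simpa [sub_eq_add_neg, Y] using h) 1
    exact hap (by simpa using this)
  set N := VectorField.lieBracket ℝ Y X₁ p with hNdef
  have hθN : θ p N = 0 := by
    have h1 := dForm_eq_neg_lieBracket hθ hY hX₁ hθY hθ₁
    rw [hC.self_of_nhds _ hθ₁.self_of_nhds] at h1
    linarith
  obtain ⟨x, u, v, ρ, hD, hI, hx1⟩ : ∃ x u v ρ, DarbouxAt θ p x u v ρ ∧ (∀ᶠ q in 𝓝 p,
      fderiv ℝ x q (Y q) = 0 ∧ fderiv ℝ u q (Y q) = 0 ∧ fderiv ℝ v q (Y q) = 0) ∧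
      fderiv ℝ x p (X₁ p) ≠ 0 := by
    obtain ⟨x, u, v, ρ, hD, hI⟩ := exists_darboux_five hdim hθ hY hYp hθp hθY hC
      hθ₁.self_of_nhds hθN hN
    -- If both dx and dv vanished on X₁, then dθ(X₁, N) would vanish by `DarbouxAt.dForm_eq`. The
    -- Legendre transformation therefore repairs the bad case.
    by_cases hx1 : fderiv ℝ x p (X₁ p) = 0
    · refine ⟨_, _, _, _, hD.legendre, ?_, fun hv1 => hN ?_⟩
      · filter_upwards [hI, hD.smooth_x.eventually, hD.smooth_u.eventually, hD.smooth_v.eventually]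
          with q ⟨h1, h2, h3⟩ k1 k2 k3
        refine ⟨h3, ?_, ?_⟩
        · rw [show fderiv ℝ (fun q => u q - v q * x q) q = _ from
            (k2.differentiableAt.hasFDerivAt.sub
              (k3.differentiableAt.hasFDerivAt.mul k1.differentiableAt.hasFDerivAt)).fderiv]
          simp [h1, h2, h3]
        · rw [fderiv_fun_neg, neg_apply, h1, neg_zero]
      · rw [hD.dForm_eq hθ₁.self_of_nhds hθN, hx1, hv1]
        ring
    · exact ⟨x, u, v, ρ, hD, hI, hx1⟩
  have hm : SmoothNear (fun q => fderiv ℝ x q (X₁ q)) p := hD.smooth_x.fderiv_apply hX₁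
  have hn : SmoothNear (fun q => fderiv ℝ v q (X₁ q)) p := hD.smooth_v.fderiv_apply hX₁
  have hmne := hm.continuousAt.eventually_ne hx1
  -- With v in the role of u₁, this quotient is the second derivative u₂. Since `Y` kills x, u and
  -- v, it projects to a multiple of the last coordinate field.
  let w : E → ℝ := fun q => fderiv ℝ v q (X₁ q) / fderiv ℝ x q (X₁ q)
  have hw : SmoothNear w p := hn.div hm hx1
  have hdF := hD.dForm_eq hθ₁.self_of_nhds hθN
  rw [hdF] at hN
  have hNne := right_ne_zero_of_mul hN
  -- Because x and v are first integrals of `Y`, the numerator of Y(w) is X₁(x) N(v) − X₁(v) N(x),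
  -- that is, dθ(X₁, N)/ρ.
  have hwY : fderiv ℝ w p (Y p) ≠ 0 := by
    rw [fderiv_div_apply hn hm hx1,
      fderiv_fderiv_apply_of_firstIntegral hD.smooth_v hX₁ hY (hI.mono fun q h => h.2.2),
      fderiv_fderiv_apply_of_firstIntegral hD.smooth_x hX₁ hY (hI.mono fun q h => h.1)]
    refine div_ne_zero (fun h => hNne ?_) (pow_ne_zero 2 hx1)
    linarith
  have hwYne := (hw.fderiv_apply hY).continuousAt.eventually_ne hwY
  refine ⟨fun q => !₂[x q, u q, v q, w q], hD.smooth_x.vec4 hD.smooth_u hD.smooth_v hw, ?_, ?_⟩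
  -- Testing the covector on `Y` kills `f 3`, on X₁ and `N` together kills `f 2`, and on a vector
  -- outside the kernel of `θ` kills the rest.
  · refine surjective_of_forall_sum fun f hf => ?_
    simp only [fderiv_vec4 hD.smooth_x hD.smooth_u hD.smooth_v hw, Fin.sum_univ_four] at hf
    change ∀ ξ, f 0 * fderiv ℝ x p ξ + f 1 * fderiv ℝ u p ξ + f 2 * fderiv ℝ v p ξ +
      f 3 * fderiv ℝ w p ξ = 0 at hf
    have hu : ∀ ξ, θ p ξ = 0 → fderiv ℝ u p ξ = v p * fderiv ℝ x p ξ := by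
      intro ξ hξ
      rw [hD.eq.self_of_nhds] at hξ
      exact sub_eq_zero.1 ((mul_eq_zero.1 hξ).resolve_left hD.rho_ne)
    have h3 : f 3 = 0 := by
      have := hf (Y p)
      rw [hI.self_of_nhds.1, hI.self_of_nhds.2.1, hI.self_of_nhds.2.2] at this
      simpa [hwY] using this
    have hX := hf (X₁ p)
    have hNf := hf N
    rw [hu _ hθ₁.self_of_nhds, h3] at hX
    rw [hu _ hθN, h3] at hNf
    have h2 : f 2 = 0 := by
      have : f 2 * (fderiv ℝ x p (X₁ p) * fderiv ℝ v p N - fderiv ℝ x p N * fderiv ℝ v p (X₁ p)) =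
          0 := by linear_combination fderiv ℝ x p (X₁ p) * hNf - fderiv ℝ x p N * hX
      exact (mul_eq_zero.1 this).resolve_right hNne
    have h01 : f 0 + f 1 * v p = 0 := by
      have : (f 0 + f 1 * v p) * fderiv ℝ x p (X₁ p) = 0 := by rw [h2] at hX; linarith
      exact (mul_eq_zero.1 this).resolve_right hx1
    obtain ⟨e, he⟩ : ∃ e, θ p e ≠ 0 := by
      by_contra! hcon
      exact hθp (ContinuousLinearMap.ext hcon)
    rw [hD.eq.self_of_nhds] at he
    have h1 : f 1 = 0 := by
      have h4 := hf e
      rw [h2, h3] at h4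
      have : f 1 * (fderiv ℝ u p e - v p * fderiv ℝ x p e) = 0 := by
        linear_combination h4 - fderiv ℝ x p e * h01
      exact (mul_eq_zero.1 this).resolve_right (right_ne_zero_of_mul he)
    have h0 : f 0 = 0 := by rw [h1] at h01; linarith
    funext i
    fin_cases i
    exacts [h0, h1, h2, h3]
  · filter_upwards [hI, hD.smooth_x.eventually, hD.smooth_u.eventually, hD.smooth_v.eventually,
      hw.eventually, hmne, hwYne, hD.eq, hθ₁, ha.continuousAt.eventually_ne hap,
      hD.smooth_rho.continuousAt.eventually_ne hD.rho_ne]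
      with q h1 k1 k2 k3 k4 h2 h3 h4 h5 h6 h7
    have hu : fderiv ℝ u q (X₁ q) = v q * fderiv ℝ x q (X₁ q) := by
      rw [h4] at h5
      exact sub_eq_zero.1 ((mul_eq_zero.1 h5).resolve_left h7)
    have hs : Submodule.span ℝ {X₁ q, X₂ q} = Submodule.span ℝ {X₁ q, Y q} :=
      (span_pair_eq_of_det_ne_zero (a := 1) (b := 0) (c := b q) (d := -a q) (by simp)
        (by simp [Y, sub_eq_add_neg]) (by simpa using h6)).symm
    rw [hs, map_span_pair]
    refine span_pair_eq_of_det_ne_zero (a := fderiv ℝ x q (X₁ q)) (b := fderiv ℝ w q (X₁ q))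
      (c := 0) (d := fderiv ℝ w q (Y q)) ?_ ?_ (by simpa using ⟨h2, h3⟩)
    · refine (fderiv_vec4 k1 k2 k3 k4 _).trans ?_
      ext i
      fin_cases i
      · simp
      · simp [hu, mul_comm]
      · simp [w]; field_simp
      · simp
    · refine (fderiv_vec4 k1 k2 k3 k4 _).trans ?_
      ext i
      fin_cases i <;> simp [h1]

end Projections

/-! ### Projections for growth (2, 2) and (2, 3, 3). -/

section Charts

variable {E : Type} [NormedAddCommGroup E] [NormedSpace ℝ E] [FiniteDimensional ℝ E]

/-- An involutive rank two distribution in dimension five projects onto an involutive one. -/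
theorem exists_projectsBy_involutive (hdim : Module.finrank ℝ E = 5) {X₁ X₂ : E → E} {p : E}
    (hX₁ : SmoothNear X₁ p) (hX₂ : SmoothNear X₂ p) (hli : LinearIndependent ℝ ![X₁ p, X₂ p])
    (hinv : ∀ᶠ q in 𝓝 p, VectorField.lieBracket ℝ X₁ X₂ q ∈
      Submodule.span ℝ (Set.range ![X₁ q, X₂ q])) :
    ∃ π, ProjectsBy π X₁ X₂ p (fun _ => !₂[1, 0, 0, 0]) (fun _ => !₂[0, 1, 0, 0]) := by
  have hfam : ∀ q, (fun i => (![X₁, X₂] : Fin 2 → E → E) i q) = ![X₁ q, X₂ q] := fun q => by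
    ext i; fin_cases i <;> rfl
  obtain ⟨F, hF, hFs, hFX⟩ := exists_frobenius 2 (n := 3) hdim (X := ![X₁, X₂]) (p := p)
    (by intro i; fin_cases i; exacts [hX₁, hX₂]) (by rw [hfam]; exact hli) (by
      filter_upwards [hinv] with q hq i j
      rw [hfam]
      fin_cases i <;> fin_cases j
      · simp [VectorField.lieBracket_self]
      · exact hq
      · have := Submodule.neg_mem _ hq
        rw [VectorField.lieBracket_swap] at this
        simpa using this
      · simp [VectorField.lieBracket_self])
  obtain ⟨L, hL⟩ := exists_leftInverse hli
  let l : Fin 2 → E →L[ℝ] ℝ := fun i => (ContinuousLinearMap.proj i).comp L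
  have hl : ∀ i, SmoothNear (fun q => l i q) p := fun i => .clm (l i) p
  have hld : ∀ i q ξ, fderiv ℝ (fun q => l i q) q ξ = l i ξ := fun i q ξ => by
    rw [show fderiv ℝ (fun q => l i q) q = l i from (l i).fderiv]
  have hlX : l 0 (X₁ p) = 1 ∧ l 1 (X₁ p) = 0 ∧ l 0 (X₂ p) = 0 ∧ l 1 (X₂ p) = 1 := by
    have h0 := hL 0
    have h1 := hL 1
    simp only [Matrix.cons_val_zero, Matrix.cons_val_one] at h0 h1
    simp [l, h0, h1]
  have hπ := fun q (h : SmoothNear F q) ξ =>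
    fderiv_vec4 (.clm (l 0) q) (.clm (l 1) q) (h.apply 0) (h.apply 1) ξ
  -- Two linear functionals give coordinates along the leaves. Of the three first integrals two are
  -- kept; the dropped one is the fibre direction.
  refine ⟨fun q => !₂[l 0 q, l 1 q, F q 0, F q 1],
    (hl 0).vec4 (hl 1) (hF.apply 0) (hF.apply 1), ?_, ?_⟩
  · refine surjective_of_forall_sum fun f hf => ?_
    simp only [hπ p hF, hld, Fin.sum_univ_four, fderiv_pi_apply hF] at hf
    change ∀ ξ, f 0 * l 0 ξ + f 1 * l 1 ξ + f 2 * fderiv ℝ F p ξ 0 + f 3 * fderiv ℝ F p ξ 1 = 0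
      at hf
    have hFp := hFX.self_of_nhds
    have hp0 : fderiv ℝ F p (X₁ p) = 0 := hFp 0
    have hp1 : fderiv ℝ F p (X₂ p) = 0 := hFp 1
    have h0 : f 0 = 0 := by simpa [hlX, hp0] using hf (X₁ p)
    have h1 : f 1 = 0 := by simpa [hlX, hp1] using hf (X₂ p)
    obtain ⟨ξ₂, hξ₂⟩ := hFs (Pi.single 0 1)
    obtain ⟨ξ₃, hξ₃⟩ := hFs (Pi.single 1 1)
    have h2 : f 2 = 0 := by simpa [h0, h1, hξ₂] using hf ξ₂
    have h3 : f 3 = 0 := by simpa [h0, h1, hξ₃] using hf ξ₃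
    funext i
    fin_cases i
    exacts [h0, h1, h2, h3]
  · have hdet : SmoothNear (fun q => l 0 (X₁ q) * l 1 (X₂ q) - l 1 (X₁ q) * l 0 (X₂ q)) p :=
      ((hX₁.clm_comp (l 0)).mul (hX₂.clm_comp (l 1))).sub
        ((hX₁.clm_comp (l 1)).mul (hX₂.clm_comp (l 0)))
    filter_upwards [hFX, hF.eventually, hdet.continuousAt.eventually_ne
      (show _ ≠ (0 : ℝ) by simp [hlX])] with q hq hFq hd
    have hq0 : fderiv ℝ F q (X₁ q) = 0 := hq 0
    have hq1 : fderiv ℝ F q (X₂ q) = 0 := hq 1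
    rw [map_span_pair]
    refine span_pair_eq_of_det_ne_zero ?_ ?_ hd
    · refine (hπ q hFq _).trans ?_
      ext i
      fin_cases i <;> simp [fderiv_pi_apply hFq, hq0]
    · refine (hπ q hFq _).trans ?_
      ext i
      fin_cases i <;> simp [fderiv_pi_apply hFq, hq1]

/-- A rank two distribution of growth `(2, 3, 3)` in dimension five projects onto the Cartan
distribution of `J¹` times a line. -/
theorem exists_projectsBy_contact (hdim : Module.finrank ℝ E = 5) {X₁ X₂ : E → E} {p : E}
    (hX₁ : SmoothNear X₁ p) (hX₂ : SmoothNear X₂ p)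
    (hli : LinearIndependent ℝ ![X₁ p, X₂ p, VectorField.lieBracket ℝ X₁ X₂ p])
    (hinv : ∀ᶠ q in 𝓝 p, ∀ X ∈ ({X₁, X₂} : Set (E → E)),
      VectorField.lieBracket ℝ X (VectorField.lieBracket ℝ X₁ X₂) q ∈
        Submodule.span ℝ (Set.range ![X₁ q, X₂ q, VectorField.lieBracket ℝ X₁ X₂ q])) :
    ∃ π, ProjectsBy π X₁ X₂ p (fun y => !₂[1, y 2, 0, 0]) (fun _ => !₂[0, 0, 1, 0]) := by
  set W := VectorField.lieBracket ℝ X₁ X₂ with hWdef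
  have hW : SmoothNear W p := hX₁.lieBracket hX₂
  have hfam : ∀ q, (fun i => (![X₁, X₂, W] : Fin 3 → E → E) i q) = ![X₁ q, X₂ q, W q] :=
    fun q => by ext i; fin_cases i <;> rfl
  obtain ⟨F, hF, hFs, hFX⟩ := exists_frobenius 3 (n := 2) hdim (X := ![X₁, X₂, W]) (p := p)
    (by intro i; fin_cases i; exacts [hX₁, hX₂, hW]) (by rw [hfam]; exact hli) (by
      filter_upwards [hinv] with q hq i j
      rw [hfam]
      have h1 := hq X₁ (by simp)
      have h2 := hq X₂ (by simp)
      have h3 : W q ∈ Submodule.span ℝ (Set.range ![X₁ q, X₂ q, W q]) :=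
        Submodule.subset_span ⟨2, rfl⟩
      have hneg : ∀ {A B : E → E}, VectorField.lieBracket ℝ A B q ∈
          Submodule.span ℝ (Set.range ![X₁ q, X₂ q, W q]) → VectorField.lieBracket ℝ B A q ∈
          Submodule.span ℝ (Set.range ![X₁ q, X₂ q, W q]) := by
        intro A B h
        rw [VectorField.lieBracket_swap]
        exact Submodule.neg_mem _ h
      have hz : ∀ {A : E → E}, VectorField.lieBracket ℝ A A q ∈
          Submodule.span ℝ (Set.range ![X₁ q, X₂ q, W q]) := by
        intro A
        simp [VectorField.lieBracket_self]
      fin_cases i <;> fin_cases j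
      exacts [hz, h3, h1, hneg h3, hz, h2, hneg h1, hneg h2, hz])
  have hX₂p : X₂ p ≠ 0 := hli.ne_zero 1
  obtain ⟨G, hG, hGs, hGX⟩ := exists_firstIntegrals (n := 4) hdim hX₂ hX₂p
  -- The differential of `G` kills only the line of X₂. A left inverse then combines the components
  -- of `G` into two first integrals of X₂ dual to X₁ and `W` at `p`.
  have hli' : LinearIndependent ℝ ![fderiv ℝ G p (X₁ p), fderiv ℝ G p (W p)] := by
    rw [LinearIndependent.pair_iff]
    intro s t hst
    obtain ⟨a, ha⟩ := exists_smul_of_map_eq_zero hGs hX₂p hGX.self_of_nhds (by simpa using hdim)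
      (x := s • X₁ p + t • W p) (by simpa using hst)
    have h := Fintype.linearIndependent_iff.1 hli ![s, -a, t] (by
      rw [Fin.sum_univ_three]
      simp only [Matrix.cons_val]
      rw [add_right_comm, ha]
      simp)
    exact ⟨h 0, h 2⟩
  obtain ⟨L, hL⟩ := exists_leftInverse hli'
  let g : Fin 2 → E → ℝ := fun i q => L (G q) i
  have hg : ∀ i q, SmoothNear G q → SmoothNear (g i) q := fun i q h => (h.clm_comp L).apply i
  have hgd : ∀ i q, SmoothNear G q → ∀ ξ, fderiv ℝ (g i) q ξ = L (fderiv ℝ G q ξ) i := by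
    intro i q h ξ
    rw [show fderiv ℝ (g i) q = ((ContinuousLinearMap.proj i).comp L).comp (fderiv ℝ G q) from
      (((ContinuousLinearMap.proj i : (Fin 2 → ℝ) →L[ℝ] ℝ).comp L).hasFDerivAt.comp q
        h.differentiableAt.hasFDerivAt).fderiv]
    rfl
  have hgX : fderiv ℝ (g 0) p (X₁ p) = 1 ∧ fderiv ℝ (g 1) p (X₁ p) = 0 ∧
      fderiv ℝ (g 0) p (W p) = 0 ∧ fderiv ℝ (g 1) p (W p) = 1 := by
    have h0 := hL 0
    have h1 := hL 1
    simp only [Matrix.cons_val_zero, Matrix.cons_val_one] at h0 h1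
    simp [hgd _ p hG, h0, h1]
  have hgY : ∀ i, ∀ᶠ q in 𝓝 p, fderiv ℝ (g i) q (X₂ q) = 0 := by
    intro i
    filter_upwards [hGX, hG.eventually] with q hq hGq
    rw [hgd i q hGq, hq]
    simp
  have hm : SmoothNear (fun q => fderiv ℝ (g 0) q (X₁ q)) p := (hg 0 p hG).fderiv_apply hX₁
  have hn : SmoothNear (fun q => fderiv ℝ (g 1) q (X₁ q)) p := (hg 1 p hG).fderiv_apply hX₁
  have hmp : fderiv ℝ (g 0) p (X₁ p) ≠ 0 := by rw [hgX.1]; exact one_ne_zero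
  -- The slope of X₁ in the plane of the two first integrals, in the role of u₁. Its derivative
  -- along X₂ at `p` comes from [X₂, X₁] = −W and is −1.
  let v : E → ℝ := fun q => fderiv ℝ (g 1) q (X₁ q) / fderiv ℝ (g 0) q (X₁ q)
  have hv : SmoothNear v p := hn.div hm hmp
  have hvY : fderiv ℝ v p (X₂ p) = -1 := by
    rw [fderiv_div_apply hn hm hmp,
      fderiv_fderiv_apply_of_firstIntegral (hg 1 p hG) hX₁ hX₂ (hgY 1),
      fderiv_fderiv_apply_of_firstIntegral (hg 0 p hG) hX₁ hX₂ (hgY 0),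
      VectorField.lieBracket_swap]
    change (fderiv ℝ (g 1) p (-W p) * _ - _ * fderiv ℝ (g 0) p (-W p)) / _ = _
    simp [hgX]
  have hπ := fun q (h : SmoothNear G q) (hv : SmoothNear v q) (h' : SmoothNear F q) ξ =>
    fderiv_vec4 (hg 0 q h) (hg 1 q h) hv (h'.apply 0) ξ
  refine ⟨fun q => !₂[g 0 q, g 1 q, v q, F q 0],
    (hg 0 p hG).vec4 (hg 1 p hG) hv (hF.apply 0), ?_, ?_⟩
  · refine surjective_of_forall_sum fun f hf => ?_
    simp only [hπ p hG hv hF, Fin.sum_univ_four, fderiv_pi_apply hF] at hf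
    change ∀ ξ, f 0 * fderiv ℝ (g 0) p ξ + f 1 * fderiv ℝ (g 1) p ξ + f 2 * fderiv ℝ v p ξ +
      f 3 * fderiv ℝ F p ξ 0 = 0 at hf
    have hFp := hFX.self_of_nhds
    have hp0 : fderiv ℝ F p (X₁ p) = 0 := hFp 0
    have hp1 : fderiv ℝ F p (X₂ p) = 0 := hFp 1
    have hp2 : fderiv ℝ F p (W p) = 0 := hFp 2
    have h2 : f 2 = 0 := by
      simpa [(hgY _).self_of_nhds, hvY, hp1] using hf (X₂ p)
    have h0 : f 0 = 0 := by simpa [hgX, h2, hp0] using hf (X₁ p)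
    have h1 : f 1 = 0 := by simpa [hgX, h2, hp2] using hf (W p)
    obtain ⟨ξ, hξ⟩ := hFs (Pi.single 0 1)
    have h3 : f 3 = 0 := by simpa [h0, h1, h2, hξ] using hf ξ
    funext i
    fin_cases i
    exacts [h0, h1, h2, h3]
  · filter_upwards [hFX, hF.eventually, hG.eventually, hv.eventually, hgY 0, hgY 1,
      hm.continuousAt.eventually_ne hmp, (hv.fderiv_apply hX₂).continuousAt.eventually_ne
        (show fderiv ℝ v p (X₂ p) ≠ 0 by rw [hvY]; norm_num)] with q hq hFq hGq hvq hY0 hY1 hmq hvYq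
    have hq0 : fderiv ℝ F q (X₁ q) = 0 := hq 0
    have hq1 : fderiv ℝ F q (X₂ q) = 0 := hq 1
    rw [map_span_pair]
    refine span_pair_eq_of_det_ne_zero (a := fderiv ℝ (g 0) q (X₁ q)) (b := fderiv ℝ v q (X₁ q))
      (c := 0) (d := fderiv ℝ v q (X₂ q)) ?_ ?_ (by simpa using ⟨hmq, hvYq⟩)
    · refine (hπ q hGq hvq hFq _).trans ?_
      ext i
      fin_cases i
      · simp
      · simp [v]; field_simp
      · simp
      · simp [fderiv_pi_apply hFq, hq0]
    · refine (hπ q hGq hvq hFq _).trans ?_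
      ext i
      fin_cases i <;> simp [fderiv_pi_apply hFq, hq1, hY0, hY1]

end Charts

/-! ### Monge coordinates from a projection onto J². -/

section MongeChart

variable {E : Type} [NormedAddCommGroup E] [NormedSpace ℝ E] [FiniteDimensional ℝ E]

theorem SmoothNear.vec5 {x u v w z : E → ℝ} {p : E} (hx : SmoothNear x p) (hu : SmoothNear u p)
    (hv : SmoothNear v p) (hw : SmoothNear w p) (hz : SmoothNear z p) :
    SmoothNear (fun q => (!₂[x q, u q, v q, w q, z q] : EuclideanSpace ℝ (Fin 5))) p := by
  refine SmoothNear.euclidean fun i => ?_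
  fin_cases i
  exacts [hx, hu, hv, hw, hz]

theorem fderiv_vec5 {x u v w z : E → ℝ} {p : E} (hx : SmoothNear x p) (hu : SmoothNear u p)
    (hv : SmoothNear v p) (hw : SmoothNear w p) (hz : SmoothNear z p) (ξ : E) :
    fderiv ℝ (fun q => (!₂[x q, u q, v q, w q, z q] : EuclideanSpace ℝ (Fin 5))) p ξ =
      !₂[fderiv ℝ x p ξ, fderiv ℝ u p ξ, fderiv ℝ v p ξ, fderiv ℝ w p ξ, fderiv ℝ z p ξ] := by
  ext i
  rw [fderiv_euclidean_apply (hx.vec5 hu hv hw hz)]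
  fin_cases i <;> rfl

/-- A projection onto the Cartan distribution of `J²` is completed to Monge coordinates by a first
integral of the lift of `∂/∂u₂`. -/
theorem exists_monge_chart (hdim : Module.finrank ℝ E = 5) {X₁ X₂ : E → E} {p : E}
    (hX₁ : SmoothNear X₁ p) (hX₂ : SmoothNear X₂ p)
    {π : E → EuclideanSpace ℝ (Fin 4)}
    (h : ProjectsBy π X₁ X₂ p (fun y => !₂[1, y 2, y 3, 0]) (fun _ => !₂[0, 0, 0, 1])) {s : Set E}
    (hs : s ∈ 𝓝 p) :
    ∃ (e : OpenPartialHomeomorph E (EuclideanSpace ℝ (Fin 5)))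
      (f : EuclideanSpace ℝ (Fin 5) → ℝ), p ∈ e.source ∧ e.source ⊆ s ∧
      (∀ q ∈ e.source, ContDiffAt ℝ ∞ e q) ∧ (∀ y ∈ e.target, ContDiffAt ℝ ∞ e.symm y) ∧
      ContDiffOn ℝ ∞ f e.target ∧ ∀ q ∈ e.source,
        (Submodule.span ℝ {X₁ q, X₂ q}).map (fderiv ℝ e q).toLinearMap =
          Submodule.span ℝ {(!₂[1, e q 2, e q 3, 0, f (e q)] : EuclideanSpace ℝ (Fin 5)),
            !₂[0, 0, 0, 1, 0]} := by
  have : CompleteSpace E := FiniteDimensional.complete ℝ E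
  have hπ := h.smooth
  let T : E → E →L[ℝ] EuclideanSpace ℝ (Fin 4) := fderiv ℝ π
  let a : (E → E) → E → ℝ := fun X q => T q (X q) 0
  let b : (E → E) → E → ℝ := fun X q => T q (X q) 3
  have ha : ∀ {X : E → E}, SmoothNear X p → SmoothNear (a X) p := fun hX =>
    (hπ.fderiv_apply hX).euclidean_apply 0
  have hb : ∀ {X : E → E}, SmoothNear X p → SmoothNear (b X) p := fun hX =>
    (hπ.fderiv_apply hX).euclidean_apply 3
  have hT : ∀ᶠ q in 𝓝 p, ∀ X ∈ ({X₁, X₂} : Set (E → E)), T q (X q) =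
      !₂[a X q, a X q * π q 2, a X q * π q 3, b X q] := by
    filter_upwards [h.map_eq] with q hq X hX
    have hmem : T q (X q) ∈ Submodule.span ℝ
        {(!₂[1, π q 2, π q 3, 0] : EuclideanSpace ℝ (Fin 4)), !₂[0, 0, 0, 1]} := by
      rw [← hq]
      refine Submodule.mem_map_of_mem (Submodule.subset_span ?_)
      rcases hX with rfl | rfl <;> simp
    obtain ⟨c, d, hcd⟩ := Submodule.mem_span_pair.1 hmem
    have h0 : a X q = c := by simp [a, ← hcd]
    have h3 : b X q = d := by simp [b, ← hcd]
    rw [h0, h3, ← hcd]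
    ext i
    fin_cases i <;> simp
  -- The determinant of the projected fields in the Cartan frame. By Cramer's rule `Y₁` and `Y₂`
  -- below lift δ times the two Cartan fields.
  let δ : E → ℝ := fun q => a X₁ q * b X₂ q - a X₂ q * b X₁ q
  have hδ : SmoothNear δ p := ((ha hX₁).mul (hb hX₂)).sub ((ha hX₂).mul (hb hX₁))
  have hδp : δ p ≠ 0 := by
    have hsp := h.map_eq.self_of_nhds
    rw [map_span_pair] at hsp
    have h1 : (!₂[1, π p 2, π p 3, 0] : EuclideanSpace ℝ (Fin 4)) ∈
        Submodule.span ℝ {T p (X₁ p), T p (X₂ p)} := by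
      refine hsp.symm ▸ Submodule.subset_span (by simp)
    have h2 : (!₂[0, 0, 0, 1] : EuclideanSpace ℝ (Fin 4)) ∈
        Submodule.span ℝ {T p (X₁ p), T p (X₂ p)} := by
      refine hsp.symm ▸ Submodule.subset_span (by simp)
    obtain ⟨c, d, hcd⟩ := Submodule.mem_span_pair.1 h1
    obtain ⟨c', d', hcd'⟩ := Submodule.mem_span_pair.1 h2
    have e1 : c * a X₁ p + d * a X₂ p = 1 := by simpa using congrArg (fun y => y 0) hcd
    have e2 : c * b X₁ p + d * b X₂ p = 0 := by simpa using congrArg (fun y => y 3) hcd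
    have e3 : c' * a X₁ p + d' * a X₂ p = 0 := by simpa using congrArg (fun y => y 0) hcd'
    have e4 : c' * b X₁ p + d' * b X₂ p = 1 := by simpa using congrArg (fun y => y 3) hcd'
    intro h0
    have : (c * d' - d * c') * δ p = 1 := by
      simp only [δ]
      linear_combination (c' * b X₁ p + d' * b X₂ p) * e1 + e4 - (c' * a X₁ p + d' * a X₂ p) * e2
    rw [h0] at this
    simp at this
  let Y₁ : E → E := fun q => b X₂ q • X₁ q - b X₁ q • X₂ q
  let Y₂ : E → E := fun q => a X₁ q • X₂ q - a X₂ q • X₁ q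
  have hY₁ : SmoothNear Y₁ p := ((hb hX₂).smul hX₁).sub ((hb hX₁).smul hX₂)
  have hY₂ : SmoothNear Y₂ p := ((ha hX₁).smul hX₂).sub ((ha hX₂).smul hX₁)
  have hTY : ∀ᶠ q in 𝓝 p, T q (Y₁ q) = !₂[δ q, δ q * π q 2, δ q * π q 3, 0] ∧
      T q (Y₂ q) = !₂[0, 0, 0, δ q] := by
    filter_upwards [hT] with q hq
    have h1 := hq X₁ (by simp)
    have h2 := hq X₂ (by simp)
    constructor
    · simp only [Y₁, map_sub, map_smul, h1, h2]
      ext i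
      fin_cases i <;> simp [δ] <;> ring
    · simp only [Y₂, map_sub, map_smul, h1, h2]
      ext i
      fin_cases i <;> simp [δ] <;> ring
  have hY₂p : Y₂ p ≠ 0 := by
    intro h0
    have := hTY.self_of_nhds.2
    rw [h0, map_zero] at this
    exact hδp (by simpa using (congrArg (fun y => y 3) this).symm)
  obtain ⟨G, hG, hGs, hGY⟩ := exists_firstIntegrals (n := 4) hdim hY₂ hY₂p
  obtain ⟨Z, hZ, hZ0⟩ : ∃ Z, T p Z = 0 ∧ Z ≠ 0 := by
    by_contra! hcon
    have := finrank_ker_of_surjective h.surj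
    rw [LinearMap.ker_eq_bot'.2 fun Z hZ => hcon Z hZ, hdim] at this
    simp at this
  -- The fibre direction `Z` is not parallel to `Y₂`, whose projection is nonzero, so some first
  -- integral of `Y₂` varies along the fibre. It becomes the coordinate v, and the field ∂_{u₂}
  -- acquires no v-component.
  obtain ⟨i, hi⟩ : ∃ i, fderiv ℝ G p Z i ≠ 0 := by
    by_contra! hcon
    obtain ⟨c, rfl⟩ := exists_smul_of_map_eq_zero hGs hY₂p hGY.self_of_nhds (by simpa using hdim)
      (x := Z) (funext hcon)
    rw [map_smul, hTY.self_of_nhds.2] at hZ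
    have : c = 0 ∨ δ p = 0 := by simpa using congrArg (fun y => y 3) hZ
    rw [this.resolve_right hδp, zero_smul] at hZ0
    exact hZ0 rfl
  let v : E → ℝ := fun q => G q i
  have hv : SmoothNear v p := hG.apply i
  let Ψ : E → EuclideanSpace ℝ (Fin 5) := fun q => !₂[π q 0, π q 1, π q 2, π q 3, v q]
  have hΨ : SmoothNear Ψ p := (hπ.euclidean_apply 0).vec5 (hπ.euclidean_apply 1)
    (hπ.euclidean_apply 2) (hπ.euclidean_apply 3) hv
  have hΨd : ∀ q, SmoothNear π q → SmoothNear v q → ∀ ξ, fderiv ℝ Ψ q ξ =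
      !₂[T q ξ 0, T q ξ 1, T q ξ 2, T q ξ 3, fderiv ℝ v q ξ] := by
    intro q h1 h2 ξ
    refine (fderiv_vec5 (h1.euclidean_apply 0) (h1.euclidean_apply 1) (h1.euclidean_apply 2)
      (h1.euclidean_apply 3) h2 ξ).trans ?_
    simp only [T, fderiv_euclidean_apply h1]
  have hinv : (fderiv ℝ Ψ p).IsInvertible := by
    refine isInvertible_of_injective (by simpa using hdim) fun ξ hξ => ?_
    rw [hΨd p hπ hv] at hξ
    obtain ⟨c, rfl⟩ := exists_smul_of_map_eq_zero h.surj hZ0 hZ (by simpa using hdim) (x := ξ) (by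
      ext j
      fin_cases j
      exacts [congrArg (fun y => y 0) hξ, congrArg (fun y => y 1) hξ, congrArg (fun y => y 2) hξ,
        congrArg (fun y => y 3) hξ])
    have h4 : fderiv ℝ v p (c • Z) = 0 := congrArg (fun y => y 4) hξ
    rw [map_smul, fderiv_pi_apply hG] at h4
    rw [(smul_eq_zero.1 h4).resolve_right hi, zero_smul]
  -- The v-component of the lifted total derivative; read in the chart it is the right-hand side of
  -- the Monge equation.
  let r : E → ℝ := fun q => fderiv ℝ v q (Y₁ q) / δ q
  have hr : SmoothNear r p := (hv.fderiv_apply hY₁).div hδ hδp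
  obtain ⟨e, hpe, hes, heΨ, hsm, hsm'⟩ := hΨ.exists_openPartialHomeomorph hinv
    (Filter.inter_mem hs ((((hr.and hTY).and hGY).and (hπ.eventually.and hG.eventually)).and
      (hδ.continuousAt.eventually_ne hδp)))
  have heq : (e : E → EuclideanSpace ℝ (Fin 5)) = Ψ := funext heΨ
  refine ⟨e, fun y => r (e.symm y), hpe, fun q hq => (hes hq).1, ?_, hsm', ?_, ?_⟩
  · rw [heq]
    exact hsm
  · intro y hy
    have h1 : ContDiffAt ℝ ∞ r (e.symm y) := (hes (e.map_target hy)).2.1.1.1.1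
    exact (h1.comp y (hsm' y hy)).contDiffWithinAt
  · intro q hq
    obtain ⟨-, ⟨⟨⟨-, h1, h2⟩, h3⟩, h4, h5⟩, h6⟩ := hes hq
    have h3' : fderiv ℝ v q (Y₂ q) = 0 := by rw [fderiv_pi_apply h5, h3]; rfl
    simp only [e.left_inv hq]
    rw [heq, ← span_pair_eq_of_det_ne_zero (x₁ := X₁ q) (x₂ := X₂ q) (y₁ := Y₁ q) (y₂ := Y₂ q)
      (a := b X₂ q) (b := -b X₁ q) (c := -a X₂ q) (d := a X₁ q) (by simp only [Y₁]; module)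
      (by simp only [Y₂]; module) (fun h0 => h6 (by simp only [δ]; linarith)), map_span_pair]
    refine span_pair_eq_of_det_ne_zero (a := δ q) (b := 0) (c := 0) (d := δ q) ?_ ?_
      (by simpa using h6)
    · refine (hΨd q h4 (h5.apply i) _).trans ?_
      rw [h1]
      ext j
      fin_cases j
      · simp
      · simp [Ψ]
      · simp [Ψ]
      · simp
      · simp [r]; field_simp
    · refine (hΨd q h4 (h5.apply i) _).trans ?_
      rw [h2, h3']
      ext j
      fin_cases j <;> simp

end MongeChart

/-! ### Vector fields, brackets and derived distributions read in a chart. -/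

section Transfer

variable {n : ℕ} {M : Type*} [TopologicalSpace M] [ChartedSpace (EuclideanSpace ℝ (Fin n)) M]
  [IsManifold (𝓡 n) ∞ M] {φ : OpenPartialHomeomorph M (EuclideanSpace ℝ (Fin n))}

theorem mdifferentiable_of_mem_maximalAtlas (hφ : φ ∈ IsManifold.maximalAtlas (𝓡 n) ∞ M) :
    φ.MDifferentiable (𝓡 n) (𝓡 n) :=
  ⟨(contMDiffOn_of_mem_maximalAtlas hφ).mdifferentiableOn (by simp),
    (contMDiffOn_symm_of_mem_maximalAtlas hφ).mdifferentiableOn (by simp)⟩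

/-- The differential of a chart, with values in the model space. -/
noncomputable def chartDeriv (φ : OpenPartialHomeomorph M (EuclideanSpace ℝ (Fin n))) (q : M) :
    TangentSpace (𝓡 n) q →L[ℝ] EuclideanSpace ℝ (Fin n) :=
  mfderiv (𝓡 n) (𝓡 n) φ q

theorem chartDeriv_bijective (hφ : φ ∈ IsManifold.maximalAtlas (𝓡 n) ∞ M) {q : M}
    (hq : q ∈ φ.source) : Function.Bijective (chartDeriv φ q) :=
  (mdifferentiable_of_mem_maximalAtlas hφ).mfderiv_bijective hq

/-- A vector field read in a chart. -/
noncomputable def chartField (φ : OpenPartialHomeomorph M (EuclideanSpace ℝ (Fin n)))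
    (X : (q : M) → TangentSpace (𝓡 n) q) : EuclideanSpace ℝ (Fin n) → EuclideanSpace ℝ (Fin n) :=
  VectorField.mpullback (𝓡 n) (𝓡 n) φ.symm X

theorem isInvertible_mfderiv_symm (hφ : φ ∈ IsManifold.maximalAtlas (𝓡 n) ∞ M)
    {y : EuclideanSpace ℝ (Fin n)} (hy : y ∈ φ.target) :
    (mfderiv (𝓡 n) (𝓡 n) φ.symm y).IsInvertible :=
  ⟨(mdifferentiable_of_mem_maximalAtlas hφ).symm.mfderiv hy, rfl⟩

theorem chartField_apply (hφ : φ ∈ IsManifold.maximalAtlas (𝓡 n) ∞ M)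
    (X : (q : M) → TangentSpace (𝓡 n) q) {q : M} (hq : q ∈ φ.source) :
    chartField φ X (φ q) = chartDeriv φ q (X q) := by
  have hy := φ.map_source hq
  have h : ∀ y ∈ φ.target, chartField φ X y = chartDeriv φ (φ.symm y) (X (φ.symm y)) := by
    intro y hy
    obtain ⟨A, hA⟩ := isInvertible_mfderiv_symm hφ hy
    have h1 := (mdifferentiable_of_mem_maximalAtlas hφ).comp_symm_deriv hy
    have h2 : chartField φ X y = A.symm (X (φ.symm y)) := by
      rw [chartField, VectorField.mpullback_apply, ← hA, ContinuousLinearMap.inverse_equiv]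
      rfl
    rw [h2]
    have h3 := congrArg (fun T => T (A.symm (X (φ.symm y)))) h1
    rw [← hA] at h3
    exact h3.symm.trans (congrArg (chartDeriv φ (φ.symm y)) (A.apply_symm_apply _))
  rw [h _ hy, φ.left_inv hq]

theorem smoothNear_chartField (hφ : φ ∈ IsManifold.maximalAtlas (𝓡 n) ∞ M)
    {X : (q : M) → TangentSpace (𝓡 n) q} {q : M} (hq : q ∈ φ.source)
    (hX : ∀ᶠ q in 𝓝 q, ContMDiffAt (𝓡 n) (𝓡 n).tangent ∞
      (fun q => (⟨q, X q⟩ : TangentBundle (𝓡 n) M)) q) : SmoothNear (chartField φ X) (φ q) := by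
  have hy := φ.map_source hq
  have h1 : ∀ᶠ y in 𝓝 (φ q), ContMDiffAt (𝓡 n) (𝓡 n).tangent ∞
      (fun q => (⟨q, X q⟩ : TangentBundle (𝓡 n) M)) (φ.symm y) :=
    (φ.continuousAt_symm hy).eventually (by rwa [φ.left_inv hq])
  have := IsManifold.of_le (m := 1) (n := ∞) (I := 𝓡 n) (M := M) (by simp)
  filter_upwards [h1, φ.open_target.mem_nhds hy] with y h hyt
  exact contMDiffAt_vectorSpace_iff_contDiffAt.1 (h.mpullback_vectorField_preimage
    (contMDiffAt_symm_of_mem_maximalAtlas hφ hyt) (isInvertible_mfderiv_symm hφ hyt) (by simp))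

/-- Naturality of the bracket under pullback along `φ.symm`; it moves bracket computations to the
model space. -/
theorem chartField_mlieBracket (hφ : φ ∈ IsManifold.maximalAtlas (𝓡 n) ∞ M)
    {X Y : (q : M) → TangentSpace (𝓡 n) q} {q : M} (hq : q ∈ φ.source)
    (hX : ContMDiffAt (𝓡 n) (𝓡 n).tangent ∞ (fun q => (⟨q, X q⟩ : TangentBundle (𝓡 n) M)) q)
    (hY : ContMDiffAt (𝓡 n) (𝓡 n).tangent ∞ (fun q => (⟨q, Y q⟩ : TangentBundle (𝓡 n) M)) q) :
    chartField φ (VectorField.mlieBracket (𝓡 n) X Y) (φ q) =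
      VectorField.lieBracket ℝ (chartField φ X) (chartField φ Y) (φ q) := by
  have hy := φ.map_source hq
  have : IsManifold (𝓡 n) (minSmoothness ℝ 2) M := by
    rw [minSmoothness_of_isRCLikeNormedField]
    exact IsManifold.of_le (n := ∞) (WithTop.coe_le_coe.2 le_top)
  have h := VectorField.mpullback_mlieBracket (I := 𝓡 n) (I' := 𝓡 n) (f := φ.symm) (x₀ := φ q)
    (V := X) (W := Y) (n := ∞)
    (by rw [φ.left_inv hq]; exact hX.mdifferentiableAt (by simp))
    (by rw [φ.left_inv hq]; exact hY.mdifferentiableAt (by simp))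
    (contMDiffAt_symm_of_mem_maximalAtlas hφ hy)
    (by rw [minSmoothness_of_isRCLikeNormedField]; exact (WithTop.coe_le_coe.2 le_top))
  refine h.trans ?_
  rw [← VectorField.mlieBracketWithin_univ, ← VectorField.lieBracketWithin_univ]
  exact congrFun VectorField.mlieBracketWithin_eq_lieBracketWithin (φ q)

theorem contMDiffAt_mlieBracket {X Y : (q : M) → TangentSpace (𝓡 n) q} {q : M}
    (hX : ContMDiffAt (𝓡 n) (𝓡 n).tangent ∞ (fun q => (⟨q, X q⟩ : TangentBundle (𝓡 n) M)) q)
    (hY : ContMDiffAt (𝓡 n) (𝓡 n).tangent ∞ (fun q => (⟨q, Y q⟩ : TangentBundle (𝓡 n) M)) q) :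
    ContMDiffAt (𝓡 n) (𝓡 n).tangent ∞ (fun q =>
      (⟨q, VectorField.mlieBracket (𝓡 n) X Y q⟩ : TangentBundle (𝓡 n) M)) q := by
  have : IsManifold (𝓡 n) (∞ + 1) M := by simpa using ‹IsManifold (𝓡 n) ∞ M›
  have : IsManifold (𝓡 n) (minSmoothness ℝ 3) M := by
    rw [minSmoothness_of_isRCLikeNormedField]
    exact IsManifold.of_le (n := ∞) (by exact WithTop.coe_le_coe.2 le_top)
  exact ContMDiffAt.mlieBracket_vectorField (n := ⊤) (m := ⊤) hX hY
    (by rw [minSmoothness_of_isRCLikeNormedField]; simp)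

theorem lieBracket_congr_of_eventually {E : Type*} [NormedAddCommGroup E] [NormedSpace ℝ E]
    {X X' Y Y' : E → E} {p : E} (hX : X =ᶠ[𝓝 p] X') (hY : Y =ᶠ[𝓝 p] Y') :
    VectorField.lieBracket ℝ X Y p = VectorField.lieBracket ℝ X' Y' p := by
  simp only [VectorField.lieBracket, hX.fderiv_eq, hY.fderiv_eq, hX.self_of_nhds,
    hY.self_of_nhds]

/-- The derived distribution is contained in every subspace that contains a frame and its
brackets. -/
theorem derived_le {ι : Type*} [Fintype ι] {D : (q : M) → Submodule ℝ (TangentSpace (𝓡 n) q)}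
    {X : ι → (q : M) → TangentSpace (𝓡 n) q} {p : M}
    (hX : ∀ i, ∀ᶠ q in 𝓝 p, ContMDiffAt (𝓡 n) (𝓡 n).tangent ∞
      (fun q => (⟨q, X i q⟩ : TangentBundle (𝓡 n) M)) q)
    (hli : LinearIndependent ℝ fun i => X i p)
    (hD : ∀ᶠ q in 𝓝 p, D q = Submodule.span ℝ (Set.range fun i => X i q))
    {W : Submodule ℝ (TangentSpace (𝓡 n) p)} (hW : ∀ i, X i p ∈ W)
    (hW' : ∀ i j, VectorField.mlieBracket (𝓡 n) (X i) (X j) p ∈ W) : derived D p ≤ W := by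
  have hφ := IsManifold.chart_mem_maximalAtlas (I := 𝓡 n) (n := ∞) p
  set φ := chartAt (EuclideanSpace ℝ (Fin n)) p with hφdef
  have hp : p ∈ φ.source := mem_chart_source _ p
  have hinj := (chartDeriv_bijective hφ hp).1
  refine sup_le ?_ ?_
  · rw [hD.self_of_nhds, Submodule.span_le]
    rintro _ ⟨i, rfl⟩
    exact hW i
  · rw [Submodule.span_le]
    rintro _ ⟨S, T, hS, hT, rfl⟩
    have hmem : ∀ {S : (q : M) → TangentSpace (𝓡 n) q}, IsLocalSectionAt D S p →
        ∀ᶠ y in 𝓝 (φ p), chartField φ S y ∈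
          Submodule.span ℝ (Set.range fun i => chartField φ (X i) y) := by
      intro S hS
      have h1 : ∀ᶠ y in 𝓝 (φ p), S (φ.symm y) ∈
          Submodule.span ℝ (Set.range fun i => X i (φ.symm y)) :=
        (φ.continuousAt_symm (φ.map_source hp)).eventually (p := fun q =>
          S q ∈ Submodule.span ℝ (Set.range fun i => X i q)) (by
          rw [φ.left_inv hp]
          filter_upwards [hS, hD] with q h2 h3
          rw [← h3]
          exact h2.2)
      filter_upwards [h1, φ.open_target.mem_nhds (φ.map_source hp)] with y h2 hy
      have h3 : ∀ S, chartField φ S y = chartDeriv φ (φ.symm y) (S (φ.symm y)) := fun S => by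
        rw [← chartField_apply hφ S (φ.map_target hy), φ.right_inv hy]
      have h4 := Submodule.mem_map_of_mem (f := (chartDeriv φ (φ.symm y)).toLinearMap) h2
      rw [Submodule.map_span, ← Set.range_comp] at h4
      simp only [h3]
      exact h4
    -- Tensoriality is applied in the chart, and the injectivity of the chart differential brings
    -- the conclusion back to the tangent space.
    have key := lieBracket_mem_span (W := W.map (chartDeriv φ p).toLinearMap)
      (fun i => smoothNear_chartField hφ hp (hX i)) (by
        simp only [chartField_apply hφ _ hp]
        exact hli.map' (chartDeriv φ p).toLinearMap (LinearMap.ker_eq_bot.2 hinj))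
      (smoothNear_chartField hφ hp (hS.mono fun _ h => h.1))
      (smoothNear_chartField hφ hp (hT.mono fun _ h => h.1)) (hmem hS) (hmem hT)
      (fun i => by
        rw [chartField_apply hφ _ hp]
        exact Submodule.mem_map_of_mem (hW i))
      (fun i j => by
        rw [← chartField_mlieBracket hφ hp (hX i).self_of_nhds (hX j).self_of_nhds,
          chartField_apply hφ _ hp]
        exact Submodule.mem_map_of_mem (hW' i j))
    rw [← chartField_mlieBracket hφ hp hS.self_of_nhds.1 hT.self_of_nhds.1,
      chartField_apply hφ _ hp] at key
    obtain ⟨w, hw, hwe⟩ := key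
    rw [← hinj hwe]
    exact hw

end Transfer

/-! ### Submersions of manifolds and surjective derivatives. -/

section Submersions

variable {m k : ℕ} {M : Type*} [TopologicalSpace M] [ChartedSpace (EuclideanSpace ℝ (Fin m)) M]
  [IsManifold (𝓡 m) ∞ M] {φ : OpenPartialHomeomorph M (EuclideanSpace ℝ (Fin m))}

theorem trans_mem_maximalAtlas (hφ : φ ∈ IsManifold.maximalAtlas (𝓡 m) ∞ M)
    {e : OpenPartialHomeomorph (EuclideanSpace ℝ (Fin m)) (EuclideanSpace ℝ (Fin m))}
    (he : ∀ y ∈ e.source, ContDiffAt ℝ ∞ e y) (he' : ∀ y ∈ e.target, ContDiffAt ℝ ∞ e.symm y) :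
    φ.trans e ∈ IsManifold.maximalAtlas (𝓡 m) ∞ M := by
  refine OpenPartialHomeomorph.mem_maximalAtlas_of_contMDiffOn _ ?_ ?_
  · intro q hq
    rw [OpenPartialHomeomorph.trans_source] at hq
    exact ((he _ hq.2).contMDiffAt.comp q
      (contMDiffAt_of_mem_maximalAtlas hφ hq.1)).contMDiffWithinAt
  · intro y hy
    rw [OpenPartialHomeomorph.trans_target] at hy
    exact ((contMDiffAt_symm_of_mem_maximalAtlas hφ hy.2).comp y
      (he' _ hy.1).contMDiffAt).contMDiffWithinAt

theorem mfderiv_comp_chart (hφ : φ ∈ IsManifold.maximalAtlas (𝓡 m) ∞ M) {q : M}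
    (hq : q ∈ φ.source) {P : EuclideanSpace ℝ (Fin m) → EuclideanSpace ℝ (Fin k)}
    (hP : DifferentiableAt ℝ P (φ q)) :
    mfderiv (𝓡 m) (𝓡 k) (P ∘ φ) q = (fderiv ℝ P (φ q)).comp (chartDeriv φ q) := by
  rw [← mfderiv_eq_fderiv]
  exact mfderiv_comp q hP.mdifferentiableAt
    ((mdifferentiable_of_mem_maximalAtlas hφ).mdifferentiableAt hq)

/-- A submersion is required to be a linear projection in suitable charts. Completing `P` by a
projection onto the kernel of its derivative supplies the new chart of the domain. -/
theorem isSubmersionAt_comp_chart (hφ : φ ∈ IsManifold.maximalAtlas (𝓡 m) ∞ M) {q : M}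
    (hq : q ∈ φ.source) {P : EuclideanSpace ℝ (Fin m) → EuclideanSpace ℝ (Fin k)}
    (hP : SmoothNear P (φ q)) (hs : Function.Surjective (fderiv ℝ P (φ q))) :
    Manifold.IsSubmersionAt (𝓡 m) (𝓡 k) ∞ (P ∘ φ) q := by
  set T := fderiv ℝ P (φ q)
  let K := LinearMap.ker T.toLinearMap
  obtain ⟨κ', hκ'⟩ := K.subtype.exists_leftInverse_of_injective K.ker_subtype
  let κ : EuclideanSpace ℝ (Fin m) →L[ℝ] K := κ'.toContinuousLinearMap
  have hκ : ∀ x : K, κ x = x := fun x => congrArg (fun T : K →ₗ[ℝ] K => T x) hκ'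
  obtain ⟨A, hA⟩ := isInvertible_of_injective (T := T.prod κ) (by
    rw [Module.finrank_prod]
    exact (finrank_ker_of_surjective hs).symm) fun v hv => by
      have h1 : T v = 0 := congrArg Prod.fst hv
      have h2 : κ v = 0 := congrArg Prod.snd hv
      have h3 := hκ ⟨v, h1⟩
      rw [h2] at h3
      exact (congrArg Subtype.val h3).symm
  have hAv : ∀ v, A v = (T v, κ v) := fun v => congrArg (fun L => L v) hA
  -- Composing with the inverse of `A` returns to the model space, as a chart must, and makes the
  -- derivative at the base point the identity.
  let Φ : EuclideanSpace ℝ (Fin m) → EuclideanSpace ℝ (Fin m) := fun x => A.symm (P x, κ x)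
  have hΦ : SmoothNear Φ (φ q) := (hP.prodMk (.clm κ _)).clm_comp 
    (A.symm : (EuclideanSpace ℝ (Fin k) × K) →L[ℝ] EuclideanSpace ℝ (Fin m))
  have hΦd : fderiv ℝ Φ (φ q) = .id ℝ _ := by
    refine ((A.symm : _ →L[ℝ] EuclideanSpace ℝ (Fin m)).hasFDerivAt.comp (φ q)
      (hP.differentiableAt.hasFDerivAt.prodMk κ.hasFDerivAt)).fderiv.trans ?_
    ext1 v
    exact (congrArg A.symm (hAv v).symm).trans (A.symm_apply_apply v)
  obtain ⟨e, hpe, -, heΦ, hsm, hsm'⟩ := hΦ.exists_openPartialHomeomorph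
    (by rw [hΦd]; exact ⟨.refl ℝ _, rfl⟩) Filter.univ_mem
  have heq : (e : EuclideanSpace ℝ (Fin m) → EuclideanSpace ℝ (Fin m)) = Φ := funext heΦ
  refine Manifold.IsSubmersionAt.mk_of_charts A (φ.trans e) (OpenPartialHomeomorph.refl _)
    ⟨hq, hpe⟩ (Set.mem_univ _) (trans_mem_maximalAtlas hφ (by rwa [heq]) hsm')
    (StructureGroupoid.id_mem_maximalAtlas _) (fun _ _ => Set.mem_univ _) ?_
  intro y hy
  have hy' : y ∈ (φ.trans e).target := by simpa using hy
  rw [OpenPartialHomeomorph.trans_target] at hy'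
  have h1 : A y = (P (e.symm y), κ (e.symm y)) := by
    conv_lhs => rw [← e.right_inv hy'.1, heΦ]
    exact A.apply_symm_apply _
  have h2 : φ (φ.symm (e.symm y)) = e.symm y := φ.right_inv hy'.2
  simp [h1, h2]

/-- In the adapted charts the map is a linear isomorphism followed by a projection, and the chart
differentials are bijective. -/
theorem surjective_mfderiv_of_isSubmersionAt {π : M → EuclideanSpace ℝ (Fin k)} {q : M}
    (h : Manifold.IsSubmersionAt (𝓡 m) (𝓡 k) ∞ π q) :
    Function.Surjective (mfderiv (𝓡 m) (𝓡 k) π q) := by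
  have hπ : ContMDiffAt (𝓡 m) (𝓡 k) ∞ π q := h.contMDiffAt
  obtain ⟨F, _, _, h⟩ := h
  set a := h.domChart
  set c := h.codChart
  have ha := h.domChart_mem_maximalAtlas
  have hc := h.codChart_mem_maximalAtlas
  have hqa : q ∈ a.source := h.mem_domChart_source
  have hqc : π q ∈ c.source := h.mem_codChart_source
  let L : EuclideanSpace ℝ (Fin m) →L[ℝ] EuclideanSpace ℝ (Fin k) :=
    (ContinuousLinearMap.fst ℝ _ F).comp (h.equiv : _ →L[ℝ] _)
  have hev : c ∘ π =ᶠ[𝓝 q] L ∘ a := by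
    filter_upwards [a.open_source.mem_nhds hqa] with x hx
    have hy : a x ∈ (a.extend (𝓡 m)).target := by simpa using a.map_source hx
    have := h.writtenInCharts hy
    simpa [a, c, L, a.left_inv hx, h.domChart.left_inv hx] using this
  have h1 : mfderiv (𝓡 m) (𝓡 k) (c ∘ π) q =
      (chartDeriv c (π q)).comp (mfderiv (𝓡 m) (𝓡 k) π q) :=
    mfderiv_comp q ((mdifferentiable_of_mem_maximalAtlas hc).mdifferentiableAt hqc)
      (hπ.mdifferentiableAt (by simp))
  rw [hev.mfderiv_eq, mfderiv_comp_chart ha hqa L.differentiableAt, L.fderiv] at h1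
  intro w
  obtain ⟨v, hv⟩ := h.equiv.surjective (chartDeriv c (π q) w, 0)
  obtain ⟨u, hu⟩ := (chartDeriv_bijective ha hqa).2 v
  refine ⟨u, (chartDeriv_bijective hc hqc).1 ?_⟩
  have h2 := congrArg (fun T => T u) h1
  refine h2.symm.trans ?_
  change (h.equiv (chartDeriv a q u)).1 = _
  rw [hu, hv]

end Submersions

/-! ### Frames of a distribution and of its derived distribution. -/

section Frames

variable {n : ℕ} {M : Type*} [TopologicalSpace M] [ChartedSpace (EuclideanSpace ℝ (Fin n)) M]
  [IsManifold (𝓡 n) ∞ M] {φ : OpenPartialHomeomorph M (EuclideanSpace ℝ (Fin n))}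
  {D : (q : M) → Submodule ℝ (TangentSpace (𝓡 n) q)} {ι : Type*} [Fintype ι]
  {X : ι → (q : M) → TangentSpace (𝓡 n) q} {p : M}

/-- Near `p` the fields `X i` are a smooth frame of `D`. -/
structure IsFrameAt (D : (q : M) → Submodule ℝ (TangentSpace (𝓡 n) q))
    (X : ι → (q : M) → TangentSpace (𝓡 n) q) (p : M) : Prop where
  isLocalSectionAt : ∀ i, IsLocalSectionAt D (X i) p
  span_eq : ∀ᶠ q in 𝓝 p, LinearIndependent ℝ (fun i => X i q) ∧
    D q = Submodule.span ℝ (Set.range fun i => X i q)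

theorem IsFrameAt.eventually (h : IsFrameAt D X p) : ∀ᶠ q in 𝓝 p, IsFrameAt D X q := by
  filter_upwards [Filter.eventually_all.2 fun i =>
    eventually_eventually_nhds.2 (h.isLocalSectionAt i), eventually_eventually_nhds.2 h.span_eq]
    with q h1 h2
  exact ⟨h1, h2⟩

theorem IsFrameAt.finrank_eq (h : IsFrameAt D X p) : Module.finrank ℝ (D p) = Fintype.card ι := by
  rw [h.span_eq.self_of_nhds.2]
  exact finrank_span_eq_card h.span_eq.self_of_nhds.1

theorem IsFrameAt.derived_le (h : IsFrameAt D X p)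
    {W : Submodule ℝ (TangentSpace (𝓡 n) p)} (hW : ∀ i, X i p ∈ W)
    (hW' : ∀ i j, VectorField.mlieBracket (𝓡 n) (X i) (X j) p ∈ W) : derived D p ≤ W :=
  RankTwo.derived_le (fun i => (h.isLocalSectionAt i).mono fun _ h => h.1)
    h.span_eq.self_of_nhds.1 (h.span_eq.mono fun _ h => h.2) hW hW'

theorem le_derived : D p ≤ derived D p := le_sup_left

theorem IsFrameAt.mlieBracket_mem (h : IsFrameAt D X p) (i j : ι) :
    VectorField.mlieBracket (𝓡 n) (X i) (X j) p ∈ derived D p :=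
  Submodule.mem_sup_right (Submodule.subset_span
    ⟨_, _, h.isLocalSectionAt i, h.isLocalSectionAt j, rfl⟩)

/-- If the derived distribution has constant rank and does not grow at `p`, it does not grow
near `p`. -/
theorem IsFrameAt.derived_eq (h : IsFrameAt D X p)
    (hc : ∀ᶠ q in 𝓝 p, Module.finrank ℝ (derived D q) = Module.finrank ℝ (derived D p))
    (hmem : ∀ i j, VectorField.mlieBracket (𝓡 n) (X i) (X j) p ∈ D p) :
    ∀ᶠ q in 𝓝 p, derived D q = D q := by
  have hp : derived D p = D p := le_antisymm
    (h.derived_le (fun i => (h.isLocalSectionAt i).self_of_nhds.2) hmem) le_derived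
  filter_upwards [hc, h.eventually] with q hq hFq
  have : FiniteDimensional ℝ (TangentSpace (𝓡 n) q) :=
    inferInstanceAs (FiniteDimensional ℝ (EuclideanSpace ℝ (Fin n)))
  refine (Submodule.eq_of_le_of_finrank_eq le_derived ?_).symm
  rw [hq, hp, h.finrank_eq, hFq.finrank_eq]

theorem mem_span_iff_chart (hφ : φ ∈ IsManifold.maximalAtlas (𝓡 n) ∞ M) (hp : p ∈ φ.source)
    (Y : (q : M) → TangentSpace (𝓡 n) q) :
    Y p ∈ Submodule.span ℝ (Set.range fun i => X i p) ↔ chartField φ Y (φ p) ∈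
      Submodule.span ℝ (Set.range fun i => chartField φ (X i) (φ p)) := by
  simp only [chartField_apply hφ _ hp]
  rw [show (Set.range fun i => chartDeriv φ p (X i p)) =
    (chartDeriv φ p).toLinearMap '' Set.range fun i => X i p by
      rw [← Set.range_comp]; rfl, ← Submodule.map_span]
  refine ⟨fun h => Submodule.mem_map_of_mem h, ?_⟩
  rintro ⟨v, hv, hvY⟩
  rwa [← (chartDeriv_bijective hφ hp).1 hvY]

theorem linearIndependent_iff_chart (hφ : φ ∈ IsManifold.maximalAtlas (𝓡 n) ∞ M)
    (hp : p ∈ φ.source) : (LinearIndependent ℝ fun i => X i p) ↔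
      LinearIndependent ℝ fun i => chartField φ (X i) (φ p) := by
  simp only [chartField_apply hφ _ hp]
  exact (LinearMap.linearIndependent_iff (chartDeriv φ p).toLinearMap
    (LinearMap.ker_eq_bot.2 (chartDeriv_bijective hφ hp).1)).symm

theorem eventually_chart (hp : p ∈ φ.source) {P : EuclideanSpace ℝ (Fin n) → Prop}
    (h : ∀ᶠ q in 𝓝 p, P (φ q)) : ∀ᶠ y in 𝓝 (φ p), P y := by
  rw [← φ.map_nhds_eq hp]
  exact h

/-- Independence is an open condition, and membership of the fields in `D` gives the reverse
inclusion of spans. -/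
theorem isFrameAt_of_linearIndependent (hX : ∀ i, IsLocalSectionAt D (X i) p)
    (hli : LinearIndependent ℝ fun i => X i p)
    (hD : ∀ᶠ q in 𝓝 p, D q ≤ Submodule.span ℝ (Set.range fun i => X i q)) : IsFrameAt D X p := by
  have hφ := IsManifold.chart_mem_maximalAtlas (I := 𝓡 n) (n := ∞) p
  have hp : p ∈ (chartAt (EuclideanSpace ℝ (Fin n)) p).source := mem_chart_source _ p
  have h1 := eventually_linearIndependent
    (fun i => smoothNear_chartField hφ hp ((hX i).mono fun _ h => h.1))
    ((linearIndependent_iff_chart hφ hp).1 hli)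
  refine ⟨hX, ?_⟩
  filter_upwards [((chartAt (EuclideanSpace ℝ (Fin n)) p).continuousAt hp).eventually h1,
    (chartAt (EuclideanSpace ℝ (Fin n)) p).open_source.mem_nhds hp, hD, Filter.eventually_all.2 hX]
    with q hq hqs hqD hqX
  refine ⟨(linearIndependent_iff_chart hφ hqs).2 hq, le_antisymm hqD ?_⟩
  rw [Submodule.span_le]
  rintro _ ⟨i, rfl⟩
  exact (hqX i).2

/-- If a rank two distribution has nonzero bracket at `p`, its derived distribution has the obvious
frame. -/
theorem IsFrameAt.derived {X : Fin 2 → (q : M) → TangentSpace (𝓡 n) q} (h : IsFrameAt D X p)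
    (hli : LinearIndependent ℝ
      ![X 0 p, X 1 p, VectorField.mlieBracket (𝓡 n) (X 0) (X 1) p]) :
    IsFrameAt (RankTwo.derived D)
      ![X 0, X 1, VectorField.mlieBracket (𝓡 n) (X 0) (X 1)] p := by
  have hfam : ∀ q, (fun i => (![X 0, X 1, VectorField.mlieBracket (𝓡 n) (X 0) (X 1)] :
      Fin 3 → (q : M) → TangentSpace (𝓡 n) q) i q) =
      ![X 0 q, X 1 q, VectorField.mlieBracket (𝓡 n) (X 0) (X 1) q] := fun q => by
    ext i; fin_cases i <;> rfl
  refine isFrameAt_of_linearIndependent ?_ (by rw [hfam]; exact hli) ?_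
  · have hs : ∀ i, IsLocalSectionAt (RankTwo.derived D) (X i) p := fun i => by
      filter_upwards [h.isLocalSectionAt i] with q hq
      exact ⟨hq.1, le_derived hq.2⟩
    intro i
    fin_cases i
    · exact hs 0
    · exact hs 1
    · filter_upwards [h.eventually] with q hq
      exact ⟨contMDiffAt_mlieBracket (hq.isLocalSectionAt 0).self_of_nhds.1
        (hq.isLocalSectionAt 1).self_of_nhds.1, hq.mlieBracket_mem 0 1⟩
  · filter_upwards [h.eventually] with q hq
    rw [hfam]
    have hW : VectorField.mlieBracket (𝓡 n) (X 0) (X 1) q ∈ Submodule.span ℝ (Set.range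
        ![X 0 q, X 1 q, VectorField.mlieBracket (𝓡 n) (X 0) (X 1) q]) :=
      Submodule.subset_span ⟨2, rfl⟩
    refine hq.derived_le (fun i => ?_) fun i j => ?_
    · fin_cases i
      exacts [Submodule.subset_span ⟨0, rfl⟩, Submodule.subset_span ⟨1, rfl⟩]
    · fin_cases i <;> fin_cases j
      · simp
      · exact hW
      · have h := Submodule.neg_mem _ hW
        rw [← VectorField.mlieBracket_swap_apply] at h
        exact h
      · simp

end Frames

/-- Exchanging the two fields only changes signs of brackets, so Goursat's case needs just one of
[X₁, W], [X₂, W] outside the derived distribution. -/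
theorem exists_projectsBy_cartan_swap {E : Type} [NormedAddCommGroup E] [NormedSpace ℝ E]
    [FiniteDimensional ℝ E] (hdim : Module.finrank ℝ E = 5) {X₁ X₂ : E → E} {p : E}
    (hX₁ : SmoothNear X₁ p) (hX₂ : SmoothNear X₂ p)
    (hli : LinearIndependent ℝ ![X₁ p, X₂ p, VectorField.lieBracket ℝ X₁ X₂ p])
    (hG : VectorField.lieBracket ℝ X₂ (VectorField.lieBracket ℝ X₁ X₂) p ∉
      Submodule.span ℝ (Set.range ![X₁ p, X₂ p, VectorField.lieBracket ℝ X₁ X₂ p])) :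
    ∃ π, ProjectsBy π X₁ X₂ p (fun y => !₂[1, y 2, y 3, 0]) (fun _ => !₂[0, 0, 0, 1]) := by
  have hsw : VectorField.lieBracket ℝ X₂ X₁ = fun q => -VectorField.lieBracket ℝ X₁ X₂ q :=
    funext fun q => VectorField.lieBracket_swap
  obtain ⟨π, hπ⟩ := exists_projectsBy_cartan hdim hX₂ hX₁ (p := p) (by
    rw [Fintype.linearIndependent_iff] at hli ⊢
    intro g hg
    have h := hli ![g 1, g 0, -g 2] (by
      rw [Fin.sum_univ_three] at hg ⊢
      simp only [Matrix.cons_val, hsw] at hg ⊢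
      rw [← hg]
      module)
    intro i
    fin_cases i
    exacts [h 1, h 0, neg_eq_zero.1 (h 2)]) fun h => hG (by
      have hle : Submodule.span ℝ (Set.range ![X₂ p, X₁ p, VectorField.lieBracket ℝ X₂ X₁ p]) ≤
          Submodule.span ℝ (Set.range ![X₁ p, X₂ p, VectorField.lieBracket ℝ X₁ X₂ p]) := by
        rw [Submodule.span_le]
        rintro _ ⟨i, rfl⟩
        fin_cases i
        · exact Submodule.subset_span ⟨1, rfl⟩
        · exact Submodule.subset_span ⟨0, rfl⟩
        · rw [hsw]
          exact Submodule.neg_mem _ (Submodule.subset_span ⟨2, rfl⟩)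
      have h1 := Submodule.neg_mem _ (hle h)
      have h2 : VectorField.lieBracket ℝ X₂ (VectorField.lieBracket ℝ X₂ X₁) p =
          -VectorField.lieBracket ℝ X₂ (VectorField.lieBracket ℝ X₁ X₂) p := by
        rw [hsw]
        simp only [VectorField.lieBracket_eq, fderiv_fun_neg, neg_apply, map_neg]
        abel
      rwa [h2, neg_neg] at h1)
  refine ⟨π, hπ.smooth, hπ.surj, ?_⟩
  filter_upwards [hπ.map_eq] with q hq
  rw [Set.pair_comm (X₁ q), hq]

/-! ### The three growth types and their projections. -/

section Classification

variable {M : Type*} [TopologicalSpace M] [ChartedSpace (EuclideanSpace ℝ (Fin 5)) M]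
  [IsManifold (𝓡 5) ∞ M] {φ : OpenPartialHomeomorph M (EuclideanSpace ℝ (Fin 5))}
  {D : (q : M) → Submodule ℝ (TangentSpace (𝓡 5) q)}
  {X : Fin 2 → (q : M) → TangentSpace (𝓡 5) q} {p : M}

/-- Every regular rank two distribution in dimension five projects locally onto one of three normal
forms in dimension four. -/
theorem exists_projection (hreg : IsRegular D) (hX : IsFrameAt D X p)
    (hφ : φ ∈ IsManifold.maximalAtlas (𝓡 5) ∞ M) (hp : p ∈ φ.source) :
    ∃ π C₁ C₂, ProjectsBy π (chartField φ (X 0)) (chartField φ (X 1)) (φ p) C₁ C₂ ∧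
      ContDiff ℝ ∞ C₁ ∧ ContDiff ℝ ∞ C₂ ∧ (∀ y, LinearIndependent ℝ ![C₁ y, C₂ y]) ∧
      (4 ≤ Module.finrank ℝ (derivedFlag D 2 p) →
        C₁ = (fun y => !₂[1, y 2, y 3, 0]) ∧ C₂ = fun _ => !₂[0, 0, 0, 1]) := by
  have hdim : Module.finrank ℝ (EuclideanSpace ℝ (Fin 5)) = 5 := by simp
  set W := VectorField.mlieBracket (𝓡 5) (X 0) (X 1) with hWdef
  set x₁ := chartField φ (X 0)
  set x₂ := chartField φ (X 1)
  have hx₁ : SmoothNear x₁ (φ p) :=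
    smoothNear_chartField hφ hp ((hX.isLocalSectionAt 0).mono fun _ h => h.1)
  have hx₂ : SmoothNear x₂ (φ p) :=
    smoothNear_chartField hφ hp ((hX.isLocalSectionAt 1).mono fun _ h => h.1)
  have hsrc := φ.open_source.mem_nhds hp
  have hw : ∀ᶠ y in 𝓝 (φ p), chartField φ W y = VectorField.lieBracket ℝ x₁ x₂ y := by
    refine eventually_chart hp ?_
    filter_upwards [hX.eventually, hsrc] with q hq hqs
    exact chartField_mlieBracket hφ hqs (hq.isLocalSectionAt 0).self_of_nhds.1
      (hq.isLocalSectionAt 1).self_of_nhds.1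
  have hww : ∀ i, ∀ᶠ q in 𝓝 p, chartField φ (VectorField.mlieBracket (𝓡 5) (X i) W) (φ q) =
      VectorField.lieBracket ℝ (chartField φ (X i)) (VectorField.lieBracket ℝ x₁ x₂) (φ q) := by
    intro i
    filter_upwards [hX.eventually, hsrc,
      (φ.continuousAt hp).eventually (eventually_eventually_nhds.2 hw)] with q hq hqs hwq
    rw [chartField_mlieBracket hφ hqs (hq.isLocalSectionAt i).self_of_nhds.1
      (contMDiffAt_mlieBracket (hq.isLocalSectionAt 0).self_of_nhds.1
        (hq.isLocalSectionAt 1).self_of_nhds.1)]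
    exact lieBracket_congr_of_eventually .rfl hwq
  have hfam2 : ∀ q, (fun i => X i q) = ![X 0 q, X 1 q] := fun q => by
    ext i; fin_cases i <;> rfl
  have hfam2' : ∀ y, (fun i => chartField φ (X i) y) = ![x₁ y, x₂ y] := fun q => by
    ext1 i; fin_cases i <;> rfl
  have hfam3 : ∀ q, (fun i => (![X 0, X 1, W] : Fin 3 → (q : M) → TangentSpace (𝓡 5) q) i q) =
      ![X 0 q, X 1 q, W q] := fun q => by
    ext i; fin_cases i <;> rfl
  have hfam3' : ∀ᶠ y in 𝓝 (φ p), (fun i => chartField φ ((![X 0, X 1, W] :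
      Fin 3 → (q : M) → TangentSpace (𝓡 5) q) i) y) =
      ![x₁ y, x₂ y, VectorField.lieBracket ℝ x₁ x₂ y] := by
    filter_upwards [hw] with y hy
    ext1 i
    fin_cases i
    exacts [rfl, rfl, hy]
  have hli2 : LinearIndependent ℝ ![x₁ (φ p), x₂ (φ p)] := by
    rw [← hfam2']
    exact (linearIndependent_iff_chart hφ hp).1 hX.span_eq.self_of_nhds.1
  -- The rank of the first derived distribution at `p` is 3 or 2.
  by_cases hli : LinearIndependent ℝ ![X 0 p, X 1 p, W p]
  · have hli3 : LinearIndependent ℝ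
        ![x₁ (φ p), x₂ (φ p), VectorField.lieBracket ℝ x₁ x₂ (φ p)] := by
      rw [← hfam3'.self_of_nhds]
      exact (linearIndependent_iff_chart hφ hp).1 (by rw [hfam3]; exact hli)
    have hX' := hX.derived hli
    have hmem : ∀ i, ∀ᶠ q in 𝓝 p, (VectorField.mlieBracket (𝓡 5) (X i) W q ∈ derived D q ↔
        VectorField.lieBracket ℝ (chartField φ (X i)) (VectorField.lieBracket ℝ x₁ x₂) (φ q) ∈
        Submodule.span ℝ (Set.range
          ![x₁ (φ q), x₂ (φ q), VectorField.lieBracket ℝ x₁ x₂ (φ q)])) := by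
      intro i
      filter_upwards [hX'.span_eq, hsrc, hww i, (φ.continuousAt hp).eventually hfam3']
        with q h1 h2 h3 h4
      rw [h1.2, mem_span_iff_chart hφ h2, h3, h4]
    -- Either the derived distribution stops growing at `p`, the case (2, 3, 3), or one bracket
    -- leaves it and Goursat's argument applies.
    by_cases hB : ∀ i, VectorField.mlieBracket (𝓡 5) (X i) W p ∈ derived D p
    · have hB' : ∀ i j, VectorField.mlieBracket (𝓡 5)
          ((![X 0, X 1, W] : Fin 3 → (q : M) → TangentSpace (𝓡 5) q) i)
          ((![X 0, X 1, W] : Fin 3 → (q : M) → TangentSpace (𝓡 5) q) j) p ∈ derived D p := by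
        have h3 := hX.mlieBracket_mem 0 1
        have hneg : ∀ {Y Z : (q : M) → TangentSpace (𝓡 5) q},
            VectorField.mlieBracket (𝓡 5) Y Z p ∈ derived D p →
            VectorField.mlieBracket (𝓡 5) Z Y p ∈ derived D p := by
          intro Y Z h
          have h := Submodule.neg_mem _ h
          rwa [← VectorField.mlieBracket_swap_apply] at h
        have hz : ∀ {Y : (q : M) → TangentSpace (𝓡 5) q},
            VectorField.mlieBracket (𝓡 5) Y Y p ∈ derived D p := by simp
        intro i j
        fin_cases i <;> fin_cases j
        exacts [hz, h3, hB 0, hneg h3, hz, hB 1, hneg (hB 0), hneg (hB 1), hz]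
      -- Regularity spreads the absence of growth from `p` to a neighbourhood, as involutivity
      -- requires. It also makes the rank of `derivedFlag D 2` at `p` equal to 3, contrary to the
      -- Goursat hypothesis.
      have heq := hX'.derived_eq (hreg 2 p) hB'
      obtain ⟨π, hπ⟩ := exists_projectsBy_contact hdim hx₁ hx₂ hli3 (by
        refine eventually_chart hp ?_
        filter_upwards [heq, hmem 0, hmem 1, hX'.eventually] with q hq h0 h1 hFq
        have hm : ∀ i, VectorField.mlieBracket (𝓡 5) (X i) W q ∈ derived D q := by
          intro i
          rw [← hq]
          fin_cases i
          exacts [hFq.mlieBracket_mem 0 2, hFq.mlieBracket_mem 1 2]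
        rintro Y (rfl | rfl)
        exacts [h0.1 (hm 0), h1.1 (hm 1)])
      refine ⟨π, _, _, hπ, ?_, contDiff_const, fun y => ?_, fun h4 => ?_⟩
      · exact (contDiff_euclidean.2 fun i => by
          fin_cases i <;> simp <;> fun_prop)
      · rw [LinearIndependent.pair_iff]
        intro s t hst
        have h0 := congrArg (fun y => y 0) hst
        have h2 := congrArg (fun y => y 2) hst
        simp at h0 h2
        exact ⟨h0, h2⟩
      · exfalso
        have h5 : derivedFlag D 2 p = derived D p := heq.self_of_nhds
        rw [h5, hX'.finrank_eq] at h4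
        simp at h4
    · push Not at hB
      have hG : ∃ π, ProjectsBy π x₁ x₂ (φ p) (fun y => !₂[1, y 2, y 3, 0])
          (fun _ => !₂[0, 0, 0, 1]) := by
        obtain ⟨i, hi⟩ := hB
        rw [(hmem i).self_of_nhds] at hi
        fin_cases i
        · exact exists_projectsBy_cartan hdim hx₁ hx₂ hli3 hi
        · exact exists_projectsBy_cartan_swap hdim hx₁ hx₂ hli3 hi
      obtain ⟨π, hπ⟩ := hG
      refine ⟨π, _, _, hπ, ?_, contDiff_const, fun y => ?_, fun _ => ⟨rfl, rfl⟩⟩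
      · exact (contDiff_euclidean.2 fun i => by
          fin_cases i <;> simp <;> fun_prop)
      · rw [LinearIndependent.pair_iff]
        intro s t hst
        have h0 := congrArg (fun y => y 0) hst
        have h2 := congrArg (fun y => y 3) hst
        simp at h0 h2
        exact ⟨h0, h2⟩
  · have hWp : W p ∈ D p := by
      by_contra hcon
      rw [hX.span_eq.self_of_nhds.2, hfam2] at hcon
      apply hli
      have := linearIndependent_finSnoc.2 ⟨hX.span_eq.self_of_nhds.1, (by rwa [hfam2])⟩
      have he : (Fin.snoc (fun i => X i p) (W p) : Fin 3 → TangentSpace (𝓡 5) p) =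
          ![X 0 p, X 1 p, W p] := by
        ext1 i
        fin_cases i <;> rfl
      rwa [he] at this
    have heq := hX.derived_eq (hreg 1 p) (by
      intro i j
      fin_cases i <;> fin_cases j
      · simp
      · exact hWp
      · have h := Submodule.neg_mem _ hWp
        rw [hWdef, ← VectorField.mlieBracket_swap_apply] at h
        exact h
      · simp)
    obtain ⟨π, hπ⟩ := exists_projectsBy_involutive hdim hx₁ hx₂ hli2 (by
      refine eventually_chart hp ?_
      filter_upwards [heq, hX.eventually, hsrc, (φ.continuousAt hp).eventually hw]
        with q hq hFq hqs hwq
      rw [← hfam2', ← hwq, ← mem_span_iff_chart hφ hqs, ← hFq.span_eq.self_of_nhds.2, ← hq]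
      exact hFq.mlieBracket_mem 0 1)
    refine ⟨π, _, _, hπ, contDiff_const, contDiff_const, fun y => ?_, fun h4 => ?_⟩
    · rw [LinearIndependent.pair_iff]
      intro s t hst
      have h0 := congrArg (fun y => y 0) hst
      have h2 := congrArg (fun y => y 1) hst
      simp at h0 h2
      exact ⟨h0, h2⟩
    · exfalso
      have hle : derivedFlag D 2 p ≤ D p := by
        refine RankTwo.derived_le
          (fun i => (hX.isLocalSectionAt i).mono fun _ h => h.1) hX.span_eq.self_of_nhds.1 ?_
          (fun i => (hX.isLocalSectionAt i).self_of_nhds.2) fun i j => ?_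
        · filter_upwards [heq, hX.span_eq] with q h1 h2
          exact h1.trans h2.2
        · rw [← heq.self_of_nhds]
          exact hX.mlieBracket_mem i j
      have : FiniteDimensional ℝ (TangentSpace (𝓡 5) p) :=
        inferInstanceAs (FiniteDimensional ℝ (EuclideanSpace ℝ (Fin 5)))
      have h6 := Submodule.finrank_mono hle
      rw [hX.finrank_eq] at h6
      simp at h6
      omega

end Classification

/-! ### Integrable extensions obtained in a chart. -/

section Extensions

theorem range_fin_two {V : Type*} (v : Fin 2 → V) : Set.range v = {v 0, v 1} := by
  ext x
  simp [Fin.exists_fin_two, eq_comm]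

theorem finrank_span_pair {V : Type*} [AddCommGroup V] [Module ℝ V] {x y : V}
    (h : LinearIndependent ℝ ![x, y]) : Module.finrank ℝ (Submodule.span ℝ {x, y}) = 2 := by
  have := finrank_span_eq_card h
  rwa [range_fin_two, Fintype.card_fin] at this

theorem injOn_of_finrank_map {V W : Type*} [AddCommGroup V] [Module ℝ V] [FiniteDimensional ℝ V]
    [AddCommGroup W] [Module ℝ W] (T : V →ₗ[ℝ] W) {S : Submodule ℝ V}
    (h : Module.finrank ℝ (S.map T) = Module.finrank ℝ S) : Set.InjOn T S := by
  have h1 := (T.domRestrict S).finrank_range_add_finrank_ker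
  rw [LinearMap.range_domRestrict, h] at h1
  have h2 : LinearMap.ker (T.domRestrict S) = ⊥ := Submodule.finrank_eq_zero.1 (by omega)
  intro x hx y hy hxy
  exact congrArg Subtype.val (LinearMap.ker_eq_bot.1 h2 (a₁ := ⟨x, hx⟩) (a₂ := ⟨y, hy⟩) hxy)

variable {m k : ℕ} {M : Type*} [TopologicalSpace M] [ChartedSpace (EuclideanSpace ℝ (Fin m)) M]
  [IsManifold (𝓡 m) ∞ M] {φ : OpenPartialHomeomorph M (EuclideanSpace ℝ (Fin m))}
  {D : (q : M) → Submodule ℝ (TangentSpace (𝓡 m) q)}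

/-- Equality of ranks turns surjectivity onto the target distribution into injectivity on `D`, so
only images have to be computed. -/
theorem isIntegrableExtensionOn_comp_chart (hφ : φ ∈ IsManifold.maximalAtlas (𝓡 m) ∞ M)
    {D' : (y : EuclideanSpace ℝ (Fin k)) → Submodule ℝ (TangentSpace (𝓡 k) y)}
    {P : EuclideanSpace ℝ (Fin m) → EuclideanSpace ℝ (Fin k)} {U : Set M} (hU : U ⊆ φ.source)
    (hP : ∀ q ∈ U, SmoothNear P (φ q)) (hs : ∀ q ∈ U, Function.Surjective (fderiv ℝ P (φ q)))
    (hmap : ∀ q ∈ U, ((D q).map (chartDeriv φ q).toLinearMap).map (fderiv ℝ P (φ q)).toLinearMap =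
      D' (P (φ q)))
    (hrank : ∀ q ∈ U, Module.finrank ℝ (D' (P (φ q))) = Module.finrank ℝ (D q)) :
    IsIntegrableExtensionOn D D' (P ∘ φ) U := by
  intro q hq
  have hmap' : (D q).map (mfderiv (𝓡 m) (𝓡 k) (P ∘ φ) q).toLinearMap = D' (P (φ q)) := by
    rw [mfderiv_comp_chart hφ (hU hq) (hP q hq).differentiableAt, ← hmap q hq,
      ← Submodule.map_comp]
    rfl
  have : FiniteDimensional ℝ (TangentSpace (𝓡 m) q) :=
    inferInstanceAs (FiniteDimensional ℝ (EuclideanSpace ℝ (Fin m)))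
  exact ⟨isSubmersionAt_comp_chart hφ (hU hq) (hP q hq) (hs q hq),
    injOn_of_finrank_map (mfderiv (𝓡 m) (𝓡 k) (P ∘ φ) q).toLinearMap
      (by rw [hmap']; exact hrank q hq), hmap'⟩

theorem map_chartDeriv_span (hφ : φ ∈ IsManifold.maximalAtlas (𝓡 m) ∞ M) {q : M}
    (hq : q ∈ φ.source) {X : Fin 2 → (q : M) → TangentSpace (𝓡 m) q}
    (h : D q = Submodule.span ℝ (Set.range fun i => X i q)) :
    (D q).map (chartDeriv φ q).toLinearMap =
      Submodule.span ℝ {chartField φ (X 0) (φ q), chartField φ (X 1) (φ q)} := by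
  rw [h, range_fin_two, map_span_pair, chartField_apply hφ _ hq, chartField_apply hφ _ hq]
  rfl

theorem IsSmoothDistribution.exists_isFrameAt {r : ℕ} (hD : IsSmoothDistribution r D) (p : M) :
    ∃ X : Fin r → (q : M) → TangentSpace (𝓡 m) q, IsFrameAt D X p := by
  obtain ⟨X, h1, h2⟩ := hD p
  exact ⟨X, h1, h2⟩

theorem IsSmoothDistribution.finrank_eq {r : ℕ} (hD : IsSmoothDistribution r D) (p : M) :
    Module.finrank ℝ (D p) = r := by
  obtain ⟨X, hX⟩ := hD.exists_isFrameAt p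
  rw [hX.finrank_eq, Fintype.card_fin]

theorem linearIndependent_cartan (y : EuclideanSpace ℝ (Fin 4)) :
    LinearIndependent ℝ ![(!₂[1, y 2, y 3, 0] : EuclideanSpace ℝ (Fin 4)), !₂[0, 0, 0, 1]] := by
  rw [LinearIndependent.pair_iff]
  intro s t hst
  have h0 := congrArg (fun y => y 0) hst
  have h2 := congrArg (fun y => y 3) hst
  simp at h0 h2
  exact ⟨h0, h2⟩

theorem finrank_cartanJ2 (y : EuclideanSpace ℝ (Fin 4)) :
    Module.finrank ℝ (cartanJ2 y) = 2 := finrank_span_pair (linearIndependent_cartan y)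

end Extensions

/-! ### Monge equations as extensions of J², and conversely. -/

section Monge

variable {M : Type*} [TopologicalSpace M] [ChartedSpace (EuclideanSpace ℝ (Fin 5)) M]
  [IsManifold (𝓡 5) ∞ M] {φ : OpenPartialHomeomorph M (EuclideanSpace ℝ (Fin 5))}
  {D : (q : M) → Submodule ℝ (TangentSpace (𝓡 5) q)}
  {X : Fin 2 → (q : M) → TangentSpace (𝓡 5) q} {p : M}

theorem isMongeAt_of_projectsBy (hX : IsFrameAt D X p)
    (hφ : φ ∈ IsManifold.maximalAtlas (𝓡 5) ∞ M) (hp : p ∈ φ.source)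
    {π : EuclideanSpace ℝ (Fin 5) → EuclideanSpace ℝ (Fin 4)}
    (h : ProjectsBy π (chartField φ (X 0)) (chartField φ (X 1)) (φ p)
      (fun y => !₂[1, y 2, y 3, 0]) (fun _ => !₂[0, 0, 0, 1])) : IsMongeAt D p := by
  have hx := fun i => smoothNear_chartField hφ hp ((hX.isLocalSectionAt i).mono fun _ h => h.1)
  -- Quantifying over preimages states the frame identity at points of the model space without
  -- transporting it along `φ.symm`.
  have hs : {y | ∀ q ∈ φ.source, φ q = y →
      D q = Submodule.span ℝ (Set.range fun i => X i q)} ∈ 𝓝 (φ p) := by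
    refine eventually_chart hp ?_
    filter_upwards [hX.span_eq, φ.open_source.mem_nhds hp] with q hq hqs q' hq' he
    rw [φ.injOn hq' hqs he]
    exact hq.2
  obtain ⟨e, f, hpe, hes, hsm, hsm', hf, hmap⟩ :=
    exists_monge_chart (by simp) (hx 0) (hx 1) h hs
  refine ⟨φ.trans e, trans_mem_maximalAtlas hφ hsm hsm', ⟨hp, hpe⟩, f,
    hf.mono (by rw [OpenPartialHomeomorph.trans_target]; exact Set.inter_subset_left), ?_⟩
  rintro q ⟨hq, hqe⟩
  rw [OpenPartialHomeomorph.coe_trans,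
    mfderiv_comp_chart hφ hq ((hsm _ hqe).differentiableAt (by simp))]
  refine (Submodule.map_comp _ _ _).trans ?_
  rw [map_chartDeriv_span hφ hq (hes hqe q hq rfl)]
  exact hmap _ hqe

/-- Forgetting the coordinate v sends the two Monge fields to the two Cartan fields of J². -/
theorem IsMongeAt.exists_extension (hD : IsSmoothDistribution 2 D) (h : IsMongeAt D p) :
    ∃ (U : Set M) (π : M → EuclideanSpace ℝ (Fin 4)), IsOpen U ∧ p ∈ U ∧
      IsIntegrableExtensionOn D cartanJ2 π U := by
  obtain ⟨φ, hφ, hp, f, -, hmap⟩ := h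
  let P : EuclideanSpace ℝ (Fin 5) → EuclideanSpace ℝ (Fin 4) := fun y => !₂[y 0, y 1, y 2, y 3]
  have hc : ∀ (i : Fin 5) y, SmoothNear (fun y : EuclideanSpace ℝ (Fin 5) => y i) y :=
    fun i y => .clm (EuclideanSpace.proj (𝕜 := ℝ) i) y
  have hcd : ∀ (i : Fin 5) (y ξ : EuclideanSpace ℝ (Fin 5)),
      fderiv ℝ (fun y : EuclideanSpace ℝ (Fin 5) => y i) y ξ = ξ i := fun i y ξ => by
    rw [show fderiv ℝ (fun y : EuclideanSpace ℝ (Fin 5) => y i) y =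
      EuclideanSpace.proj (𝕜 := ℝ) i from (EuclideanSpace.proj (𝕜 := ℝ) i).fderiv]
    rfl
  have hP : ∀ y, SmoothNear P y := fun y => (hc 0 y).vec4 (hc 1 y) (hc 2 y) (hc 3 y)
  have hPd : ∀ y ξ, fderiv ℝ P y ξ = !₂[ξ 0, ξ 1, ξ 2, ξ 3] := fun y ξ => by
    refine (fderiv_vec4 (hc 0 y) (hc 1 y) (hc 2 y) (hc 3 y) ξ).trans ?_
    simp only [hcd]
  refine ⟨φ.source, P ∘ φ, φ.open_source, hp, isIntegrableExtensionOn_comp_chart hφ subset_rfl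
    (fun q _ => hP _) (fun q _ z => ⟨!₂[z 0, z 1, z 2, z 3, 0], ?_⟩) (fun q hq => ?_)
    fun q _ => ?_⟩
  · rw [hPd]
    ext i
    fin_cases i <;> rfl
  · rw [show (D q).map (chartDeriv φ q).toLinearMap = mongeDistribution f (φ q) from hmap q hq,
      mongeDistribution]
    refine (map_span_pair _ _ _).trans ?_
    change Submodule.span ℝ {fderiv ℝ P (φ q) _, fderiv ℝ P (φ q) _} = _
    rw [hPd, hPd]
    rfl
  · rw [finrank_cartanJ2, hD.finrank_eq]

/-- Read in a chart, the extension is a submersion satisfying `ProjectsBy`, which suffices for Monge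
coordinates. No regularity enters. -/
theorem isMongeAt_of_extension (hD : IsSmoothDistribution 2 D) {U : Set M}
    {π : M → EuclideanSpace ℝ (Fin 4)} (hU : IsOpen U) (hp : p ∈ U)
    (h : IsIntegrableExtensionOn D cartanJ2 π U) : IsMongeAt D p := by
  obtain ⟨X, hX⟩ := hD.exists_isFrameAt p
  have hφ := IsManifold.chart_mem_maximalAtlas (I := 𝓡 5) (n := ∞) p
  have hps : p ∈ (chartAt (EuclideanSpace ℝ (Fin 5)) p).source := mem_chart_source _ p
  set φ := chartAt (EuclideanSpace ℝ (Fin 5)) p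
  have hsm : ∀ q ∈ U ∩ φ.source, ContDiffAt ℝ ∞ (π ∘ φ.symm) (φ q) := by
    intro q hq
    have h1 : ContMDiffAt (𝓡 5) (𝓡 4) ∞ π (φ.symm (φ q)) := by
      rw [φ.left_inv hq.2]
      exact (h q hq.1).1.contMDiffAt
    exact (h1.comp (φ q) (contMDiffAt_symm_of_mem_maximalAtlas hφ
      (φ.map_source hq.2))).contDiffAt
  have hd : ∀ q ∈ U ∩ φ.source, mfderiv (𝓡 5) (𝓡 4) π q =
      (fderiv ℝ (π ∘ φ.symm) (φ q)).comp (chartDeriv φ q) := by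
    intro q hq
    rw [← mfderiv_comp_chart hφ hq.2 ((hsm q hq).differentiableAt (by simp))]
    refine Filter.EventuallyEq.mfderiv_eq ?_
    filter_upwards [φ.open_source.mem_nhds hq.2] with x hx
    simp [φ.left_inv hx]
  have hev : ∀ᶠ q in 𝓝 p, q ∈ U ∩ φ.source := (hU.inter φ.open_source).mem_nhds ⟨hp, hps⟩
  refine isMongeAt_of_projectsBy hX hφ hps (π := π ∘ φ.symm) ⟨?_, ?_, ?_⟩
  · exact eventually_chart hps (hev.mono hsm)
  · have h1 := surjective_mfderiv_of_isSubmersionAt (h p hp).1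
    rw [hd p ⟨hp, hps⟩] at h1
    exact Function.Surjective.of_comp h1
  · refine eventually_chart hps ?_
    filter_upwards [hev, hX.span_eq] with q hq hXq
    rw [← map_chartDeriv_span hφ hq.2 hXq.2]
    have h1 := (h q hq.1).2.2
    rw [hd q hq] at h1
    refine (Submodule.map_comp _ _ _).symm.trans (h1.trans ?_)
    simp only [Function.comp_apply, φ.left_inv hq.2]
    rfl

end Monge

/-! ### Local projections made onto a four-dimensional manifold. -/

section LocalProjection

variable {M : Type*} [TopologicalSpace M] [ChartedSpace (EuclideanSpace ℝ (Fin 5)) M]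
  [IsManifold (𝓡 5) ∞ M] {φ : OpenPartialHomeomorph M (EuclideanSpace ℝ (Fin 5))}
  {D : (q : M) → Submodule ℝ (TangentSpace (𝓡 5) q)}
  {X : Fin 2 → (q : M) → TangentSpace (𝓡 5) q} {p : M}

/-- A submersion onto a four-dimensional model near a point restricts to one onto a ball, which is
identified with the whole space. -/
theorem exists_extension_of_projectsBy (hD : IsSmoothDistribution 2 D) (hX : IsFrameAt D X p)
    (hφ : φ ∈ IsManifold.maximalAtlas (𝓡 5) ∞ M) (hp : p ∈ φ.source)
    {π : EuclideanSpace ℝ (Fin 5) → EuclideanSpace ℝ (Fin 4)}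
    {C₁ C₂ : EuclideanSpace ℝ (Fin 4) → EuclideanSpace ℝ (Fin 4)}
    (h : ProjectsBy π (chartField φ (X 0)) (chartField φ (X 1)) (φ p) C₁ C₂)
    (hC₁ : ContDiff ℝ ∞ C₁) (hC₂ : ContDiff ℝ ∞ C₂)
    (hC : ∀ y, LinearIndependent ℝ ![C₁ y, C₂ y]) :
    ∃ (D' : (y : EuclideanSpace ℝ (Fin 4)) → Submodule ℝ (TangentSpace (𝓡 4) y)) (U : Set M)
      (π : M → EuclideanSpace ℝ (Fin 4)), IsSmoothDistribution 2 D' ∧ IsOpen U ∧ p ∈ U ∧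
        π '' U = Set.univ ∧ IsIntegrableExtensionOn D D' π U := by
  have hev : ∀ᶠ y in 𝓝 (φ p), y ∈ φ.target ∧ SmoothNear π y ∧
      Function.Surjective (fderiv ℝ π y) ∧
      ((D (φ.symm y)).map (chartDeriv φ (φ.symm y)).toLinearMap).map (fderiv ℝ π y).toLinearMap =
        Submodule.span ℝ {C₁ (π y), C₂ (π y)} := by
    have h1 : ∀ᶠ y in 𝓝 (φ p), (D (φ.symm y)).map (chartDeriv φ (φ.symm y)).toLinearMap =
        Submodule.span ℝ {chartField φ (X 0) y, chartField φ (X 1) y} := by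
      refine eventually_chart hp ?_
      filter_upwards [hX.span_eq, φ.open_source.mem_nhds hp] with q hq hqs
      rw [φ.left_inv hqs]
      exact map_chartDeriv_span hφ hqs hq.2
    filter_upwards [φ.open_target.mem_nhds (φ.map_source hp), h.smooth.eventually,
      eventually_surjective h.smooth.fderiv.continuousAt h.surj, h.map_eq, h1] with y h2 h3 h4 h5 h6
    exact ⟨h2, h3, h4, by rw [h6, h5]⟩
  obtain ⟨V, hV, hVo, hpV⟩ := mem_nhds_iff.1 hev
  have hopen : π '' V ∈ 𝓝 (π (φ p)) := by
    rw [← (h.smooth.contDiffAt.hasStrictFDerivAt (by simp)).map_nhds_eq_of_surj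
      (LinearMap.range_eq_top.2 h.surj)]
    exact Filter.image_mem_map (hVo.mem_nhds hpV)
  obtain ⟨r, hr, hrV⟩ := Metric.mem_nhds_iff.1 hopen
  -- A submersion is open, so the image contains a ball; this diffeomorphism from ℝ⁴ to the ball
  -- allows ℝ⁴ itself as the base.
  set b := OpenPartialHomeomorph.univBall (π (φ p)) r
  have hbt : b.target = Metric.ball (π (φ p)) r := OpenPartialHomeomorph.univBall_target _ hr
  have hbs : ∀ y, y ∈ b.source := fun y => by
    simp [b, OpenPartialHomeomorph.univBall_source]
  have hb : ContDiff ℝ ∞ b := OpenPartialHomeomorph.contDiff_univBall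
  have hb' : ∀ z ∈ b.target, SmoothNear b.symm z := by
    intro z hz
    filter_upwards [b.open_target.mem_nhds hz] with w hw
    refine (OpenPartialHomeomorph.contDiffOn_univBall_symm w (hbt ▸ hw)).contDiffAt ?_
    exact Metric.isOpen_ball.mem_nhds (hbt ▸ hw)
  have hinv : ∀ z ∈ b.target, Function.Bijective (fderiv ℝ b.symm z) := by
    intro z hz
    have h1 : HasFDerivAt b (fderiv ℝ b (b.symm z)) (b.symm z) :=
      (hb.differentiable (by simp) _).hasFDerivAt
    have h2 := h1.comp z (hb' z hz).differentiableAt.hasFDerivAt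
    have h3 : HasFDerivAt (b ∘ b.symm) (.id ℝ _) z := (hasFDerivAt_id z).congr_of_eventuallyEq (by
      filter_upwards [b.open_target.mem_nhds hz] with w hw using b.right_inv hw)
    have h4 := h2.unique h3
    have hinj : Function.Injective (fderiv ℝ b.symm z) := by
      refine Function.LeftInverse.injective (g := fderiv ℝ b (b.symm z)) fun v => ?_
      exact congrArg (fun T => T v) h4
    exact ⟨hinj, LinearMap.injective_iff_surjective (f := (fderiv ℝ b.symm z).toLinearMap).1 hinj⟩
  -- The model frame on the ball, pulled back to ℝ⁴ along `b`.
  let Z : Fin 2 → EuclideanSpace ℝ (Fin 4) → EuclideanSpace ℝ (Fin 4) :=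
    fun i y => fderiv ℝ b.symm (b y) (![C₁ (b y), C₂ (b y)] i)
  have hZ : ∀ i, ContDiff ℝ ∞ (Z i) := by
    refine fun i => contDiff_iff_contDiffAt.2 fun y => ?_
    have h1 : SmoothNear (fun y => ![C₁ (b y), C₂ (b y)] i) y := by
      fin_cases i
      exacts [(hC₁.comp hb).smoothNear y, (hC₂.comp hb).smoothNear y]
    exact (((hb' (b y) (b.map_source (hbs y))).fderiv.comp (hb.smoothNear y)).clm_apply
      h1).contDiffAt
  let D' : (y : EuclideanSpace ℝ (Fin 4)) → Submodule ℝ (TangentSpace (𝓡 4) y) :=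
    fun y => Submodule.span ℝ (Set.range fun i => Z i y)
  have hli : ∀ y, LinearIndependent ℝ fun i => Z i y := fun y =>
    (hC (b y)).map' (fderiv ℝ b.symm (b y)).toLinearMap
      (LinearMap.ker_eq_bot.2 (hinv _ (b.map_source (hbs y))).1)
  have hD' : IsSmoothDistribution 2 D' := fun y =>
    ⟨fun i y => Z i y, fun i => .of_forall fun q =>
      ⟨contMDiffAt_vectorSpace_iff_contDiffAt.2 (hZ i).contDiffAt,
        Submodule.subset_span ⟨i, rfl⟩⟩, .of_forall fun q => ⟨hli q, rfl⟩⟩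
  have hπc : ContinuousOn π V := fun y hy =>
    (hV hy).2.1.continuousAt.continuousWithinAt
  refine ⟨D', φ.source ∩ φ ⁻¹' (V ∩ π ⁻¹' b.target), (b.symm ∘ π) ∘ φ, hD',
    φ.isOpen_inter_preimage (hπc.isOpen_inter_preimage hVo b.open_target),
    ⟨hp, hpV, by simpa [hbt] using hr⟩, Set.eq_univ_of_forall fun y => ?_,
    isIntegrableExtensionOn_comp_chart hφ Set.inter_subset_left ?_ ?_ ?_ ?_⟩
  · have hy := b.map_source (hbs y)
    obtain ⟨v, hv, hvy⟩ := hrV (hbt ▸ hy)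
    have hφv := φ.right_inv (hV hv).1
    refine ⟨φ.symm v, ⟨φ.map_target (hV hv).1, ?_⟩, ?_⟩
    · rw [Set.mem_preimage, hφv]
      exact ⟨hv, by rw [Set.mem_preimage, hvy]; exact hy⟩
    · simp only [Function.comp_apply, hφv, hvy]
      exact b.left_inv (hbs y)
  · rintro q ⟨hq, hqV, hqb⟩
    exact (hb' _ hqb).comp (hV hqV).2.1
  · rintro q ⟨hq, hqV, hqb⟩
    rw [fderiv_comp _ (hb' _ hqb).differentiableAt (hV hqV).2.1.differentiableAt]
    exact (hinv _ hqb).2.comp (hV hqV).2.2.1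
  · rintro q ⟨hq, hqV, hqb⟩
    have h1 := (hV hqV).2.2.2
    rw [φ.left_inv hq] at h1
    rw [fderiv_comp _ (hb' _ hqb).differentiableAt (hV hqV).2.1.differentiableAt]
    refine (Submodule.map_comp _ _ _).trans ?_
    rw [h1, map_span_pair]
    simp only [D', Z, Function.comp_apply, b.right_inv hqb]
    exact congrArg (Submodule.span ℝ) (range_fin_two fun i =>
      fderiv ℝ b.symm (π (φ q)) (![C₁ (π (φ q)), C₂ (π (φ q))] i)).symm
  · rintro q -
    rw [hD.finrank_eq, hD'.finrank_eq]

end LocalProjection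

end RankTwo

theorem mainTheorem6 {M : Type*} [TopologicalSpace M]
    [ChartedSpace (EuclideanSpace ℝ (Fin 5)) M] [IsManifold (𝓡 5) ∞ M]
    (D : (q : M) → Submodule ℝ (TangentSpace (𝓡 5) q))
    (hD : RankTwo.IsSmoothDistribution 2 D) (hreg : RankTwo.IsRegular D) (p : M) :
    (∃ (N : Type) (_ : TopologicalSpace N) (_ : T2Space N) (_ : SecondCountableTopology N)
      (_ : ChartedSpace (EuclideanSpace ℝ (Fin 4)) N) (_ : IsManifold (𝓡 4) ∞ N)
      (D' : (q : N) → Submodule ℝ (TangentSpace (𝓡 4) q)) (U : Set M) (π : M → N),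
      RankTwo.IsSmoothDistribution 2 D' ∧ IsOpen U ∧ p ∈ U ∧ π '' U = Set.univ ∧
        RankTwo.IsIntegrableExtensionOn D D' π U) ∧
    (4 ≤ Module.finrank ℝ (RankTwo.derivedFlag D 2 p) → RankTwo.IsMongeAt D p) ∧
    (RankTwo.IsMongeAt D p ↔
      ∃ (U : Set M) (π : M → EuclideanSpace ℝ (Fin 4)), IsOpen U ∧ p ∈ U ∧
        RankTwo.IsIntegrableExtensionOn D RankTwo.cartanJ2 π U) := by
  obtain ⟨X, hX⟩ := hD.exists_isFrameAt p
  have hφ := IsManifold.chart_mem_maximalAtlas (I := 𝓡 5) (n := ∞) p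
  have hp := mem_chart_source (EuclideanSpace ℝ (Fin 5)) p
  -- One projection serves parts 1 and 2: under the rank condition its target is the Cartan
  -- distribution of J².
  obtain ⟨π, C₁, C₂, hπ, hC₁, hC₂, hC, hgoursat⟩ := RankTwo.exists_projection hreg hX hφ hp
  refine ⟨?_, fun h4 => ?_, fun h => h.exists_extension hD, ?_⟩
  · obtain ⟨D', U, π', h⟩ :=
      RankTwo.exists_extension_of_projectsBy hD hX hφ hp hπ hC₁ hC₂ hC
    exact ⟨EuclideanSpace ℝ (Fin 4), inferInstance, inferInstance, inferInstance, inferInstance,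
      inferInstance, D', U, π', h⟩
  · obtain ⟨rfl, rfl⟩ := hgoursat h4
    exact RankTwo.isMongeAt_of_projectsBy hX hφ hp hπ
  · rintro ⟨U, π', hU, hpU, h⟩
    exact RankTwo.isMongeAt_of_extension hD hU hpU h
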